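/- For a particle configuration $\eta\in\{0,1\}^{\mathbb Z}$, let $S=(S_n)_{n\in\mathbb Z}$ be its path encoding, given by $S_0=0$ and $S_n-S_{n-1}=1-2\eta_n$ for all $n\in\mathbb Z$. If $\sup_{m\le 0}S_m<\infty$, set $M_n=\sup_{m\le n}S_m$, let $W=M-S$ be the carrier process, $(TS)_n=2M_n-S_n-2M_0$, and $(T\eta)_n=\mathbf 1_{\{(TS)_n=(TS)_{n-1}-1\}}$ (one step of the box-ball system). The path $S$ is *sub-critical* if there are strictly increasing functions $F^+,F^-:\mathbb Z\to\mathbb R$ with $F^+(n)\to\infty$ and $S_n/F^+(n)\to1$ as $n\to\infty$, and $F^-(n)\to-\infty$ and $S_n/F^-(n)\to 1$ as $n\to-\infty$. **Theorem.** Each of the following random configurations $\eta$ has almost surely a sub-critical path encoding (in particular, $T\eta$ is almost surely well-defined) and satisfies $T\eta\overset{d}{=}\eta$. (a) $(\eta_n)_{n\in\mathbb Z}$ is a sequence of i.i.d. Bernoulli($p$) random variables with $p\in[0,\tfrac12)$. (b) $(\eta_n)_{n\in\mathbb Z}$ is a two-sided stationary Markov chain on $\{0,1\}$ with transition matrix $\begin{pmatrix}1-p_0&p_0\\1-p_1&p_1\end{pmatrix}$,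 where $p_0\in(0,1)$, $p_1\in[0,1)$ and $p_0+p_1<1$. (c) The i.i.d. Bernoulli($p$) configuration, $p\in(0,1)$, conditioned on $\sup_{n}W_n\le K$, for any $K\in\{0,1,2,\dots\}$, in the following sense. Let $(\eta_n)_{n\in\mathbb Z}$ be i.i.d. Bernoulli($p$), put $\eta^{[-N,N]}_n=\eta_n\mathbf 1_{\{-N<n\le N\}}$, and let $W^{[-N,N]}$ be the carrier process of $\eta^{[-N,N]}$. Then the event $\{\sup_{n\in\mathbb Z}W^{[-N,N]}_n\le K\}$ has positive probability for every $N$, and, conditionally on it, $\eta^{[-N,N]}$ converges in distribution, as $N\to\infty$, to a random configuration $\tilde\eta$ (the conditioned configuration), and $W^{[-N,N]}$ converges in distribution to the carrier process $\tilde W$ of $\tilde\eta$. Moreover, $\tilde W$ is a two-sided stationary Markov chain on $\{0,\dots,K\}$ with transition matrix $$\tilde P(x,y)=\frac{P^{(K)}(x,y)\,h(y)}{\lambda\,h(x)},$$ where $P^{(K)}$ is the restriction to $\{0,\dots,K\}$ of the matrix $P$ on $\{0,1,2,\dots\}$ with $P(x,x+1)=p$, $P(x,x-1)=1-p$ for $x\ge1$,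 $P(0,0)=1-p$ and all other entries $0$; $\lambda\in(0,1)$ is the unique eigenvalue of $P^{(K)}$ of largest modulus; and $h$ is a strictly positive eigenvector, $P^{(K)}h=\lambda h$. The configuration $\tilde\eta$ has almost surely a sub-critical path encoding and satisfies $T\tilde\eta\overset{d}{=}\tilde\eta$. -/

import Mathlib

open MeasureTheory ProbabilityTheory Filter Topology

namespace BoxBall

/-- Two-sided particle configurations: `η n = 1` if there is a particle at `n`, `0` otherwise. -/
abbrev Config : Type := ℤ → Fin 2

/-- The increment `1 - 2 η n` of the path encoding at `n`. -/
noncomputable def increment (η : Config) (n : ℤ) : ℤ := 1 - 2 * ((η n : ℕ) : ℤ)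

/-- The path encoding `S` of `η`: the two-sided path with `S 0 = 0` and
`S n - S (n - 1) = 1 - 2 η n` for all `n : ℤ` (see `path_zero`, `path_sub_path`). -/
noncomputable def path (η : Config) (n : ℤ) : ℤ :=
  ∑ i ∈ Finset.Ioc 0 n, increment η i - ∑ i ∈ Finset.Ioc n 0, increment η i

theorem path_zero (η : Config) : path η 0 = 0 := by
  simp [path]

theorem path_sub_path (η : Config) (n : ℤ) :
    path η n - path η (n - 1) = 1 - 2 * ((η n : ℕ) : ℤ) := by
  change path η n - path η (n - 1) = increment η n
  unfold path
  rcases lt_or_ge 0 n with h | h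
  · have h1 : Finset.Ioc 0 n = insert n (Finset.Ioc 0 (n - 1)) := by
      ext i; simp only [Finset.mem_Ioc, Finset.mem_insert]; omega
    have h2 : Finset.Ioc n 0 = ∅ := Finset.Ioc_eq_empty (by omega)
    have h3 : Finset.Ioc (n - 1) 0 = ∅ := Finset.Ioc_eq_empty (by omega)
    rw [h1, h2, h3, Finset.sum_insert (by simp)]
    simp
  · have h1 : Finset.Ioc (n - 1) 0 = insert n (Finset.Ioc n 0) := by
      ext i; simp only [Finset.mem_Ioc, Finset.mem_insert]; omega
    have h2 : Finset.Ioc 0 n = ∅ := Finset.Ioc_eq_empty (by omega)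
    have h3 : Finset.Ioc 0 (n - 1) = ∅ := Finset.Ioc_eq_empty (by omega)
    rw [h1, h2, h3, Finset.sum_insert (by simp)]
    simp

/-- Two-sided nearest-neighbour paths started from `0`. -/
def nearestNeighbourPaths : Set (ℤ → ℤ) :=
  {S | S 0 = 0 ∧ ∀ n, |S n - S (n - 1)| = 1}

theorem path_mem (η : Config) : path η ∈ nearestNeighbourPaths := by
  refine ⟨path_zero η, fun n => ?_⟩
  rw [path_sub_path]
  generalize η n = a
  fin_cases a <;> simp

/-- The past maximum `M n = sup_{m ≤ n} S m`. It is meaningful when `S` is bounded above on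
`{m | m ≤ n}`; otherwise the value is the conventional `0`. -/
noncomputable def pastMax (S : ℤ → ℤ) (n : ℤ) : ℤ := sSup (S '' Set.Iic n)

/-- The paths on which the dynamics is defined: those with `M 0 = sup_{m ≤ 0} S m < ∞`. -/
def dynamicsDomain : Set (ℤ → ℤ) :=
  {S | S ∈ nearestNeighbourPaths ∧ BddAbove (S '' Set.Iic 0)}

/-- The carrier process `W = M - S` of a configuration. -/
noncomputable def carrier (η : Config) (n : ℤ) : ℤ := pastMax (path η) n - path η n

/-- Reflection in the past maximum: `(T S) n = 2 M n - S n - 2 M 0`. -/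
noncomputable def pitman (S : ℤ → ℤ) (n : ℤ) : ℤ := 2 * pastMax S n - S n - 2 * pastMax S 0

/-- One step of the box-ball system on configurations: there is a particle at `n` in `T η`
exactly when the transformed path has a down step from `n - 1` to `n`. -/
noncomputable def boxBall (η : Config) (n : ℤ) : Fin 2 :=
  if pitman (path η) n = pitman (path η) (n - 1) - 1 then 1 else 0

/-- Paths that are sub-critical at `+∞`. -/
def subcriticalPlus : Set (ℤ → ℤ) :=
  {S | S ∈ nearestNeighbourPaths ∧ ∃ F : ℤ → ℝ, StrictMono F ∧ Tendsto F atTop atTop ∧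
    Tendsto (fun n => (S n : ℝ) / F n) atTop (𝓝 1)}

/-- Paths that are sub-critical at `-∞`. -/
def subcriticalMinus : Set (ℤ → ℤ) :=
  {S | S ∈ nearestNeighbourPaths ∧ ∃ F : ℤ → ℝ, StrictMono F ∧ Tendsto F atBot atBot ∧
    Tendsto (fun n => (S n : ℝ) / F n) atBot (𝓝 1)}

/-- Sub-critical paths. -/
def subcritical : Set (ℤ → ℤ) := subcriticalMinus ∩ subcriticalPlus

/-- The random configuration `η` almost surely has a sub-critical path encoding, the dynamics is
almost surely defined on it, and `T η` has the same distribution as `η`. -/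
def IsSubcriticalInvariant {Ω : Type*} [MeasurableSpace Ω] (P : Measure Ω) (η : Ω → Config) :
    Prop :=
  (∀ᵐ ω ∂P, path (η ω) ∈ subcritical) ∧
  (∀ᵐ ω ∂P, path (η ω) ∈ dynamicsDomain) ∧
  IdentDistrib (fun ω => boxBall (η ω)) η P P

/-- `(η n)` is a sequence of independent Bernoulli(`p`) random variables. -/
def IsIIDBernoulli {Ω : Type*} [MeasurableSpace Ω] (P : Measure Ω) (η : Ω → Config) (p : ℝ) :
    Prop :=
  (∀ n, Measurable fun ω => η ω n) ∧ iIndepFun (fun (n : ℤ) (ω : Ω) => η ω n) P ∧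
  ∀ n, P.real {ω | η ω n = 1} = p

/-- `X` is a two-sided stationary Markov chain with transition matrix `Q` on a countable state
space: its law is shift-invariant and
`P(X_n = x_0, …, X_{n+k+1} = x_{k+1}) = P(X_n = x_0, …, X_{n+k} = x_k) Q(x_k, x_{k+1})`. -/
def IsStationaryMarkovChain {Ω : Type*} [MeasurableSpace Ω] {α : Type*} [MeasurableSpace α]
    (P : Measure Ω) (X : Ω → ℤ → α) (Q : Matrix α α ℝ) : Prop :=
  (∀ n, Measurable fun ω => X ω n) ∧
  (∀ k : ℤ, IdentDistrib (fun ω n => X ω (n + k)) X P P) ∧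
  ∀ (n : ℤ) (k : ℕ) (x : ℕ → α),
    P.real {ω | ∀ i : ℕ, i ≤ k + 1 → X ω (n + i) = x i} =
      P.real {ω | ∀ i : ℕ, i ≤ k → X ω (n + i) = x i} * Q (x k) (x (k + 1))

/-- Truncation of a configuration to the sites `-N < n ≤ N`. -/
def truncate (N : ℕ) (η : Config) (n : ℤ) : Fin 2 :=
  if -(N : ℤ) < n ∧ n ≤ N then η n else 0

/-- The event that the carrier of the configuration truncated to `-N < n ≤ N` never holds more
than `K` particles. -/
def carrierBounded {Ω : Type*} (η : Ω → Config) (K N : ℕ) : Set Ω :=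
  {ω | ∀ n : ℤ, carrier (truncate N (η ω)) n ≤ K}

/-- The transition matrix on `{0, 1, 2, …}` of the carrier of an i.i.d. Bernoulli(`p`)
configuration: up by one with probability `p`; otherwise down by one, or stay put at `0`. -/
noncomputable def carrierMatrix (p : ℝ) : Matrix ℕ ℕ ℝ := Matrix.of fun x y =>
  if y = x + 1 then p
  else if x = y + 1 then 1 - p
  else if x = 0 ∧ y = 0 then 1 - p
  else 0

/-- The restriction of the carrier transition matrix to the states `{0, …, K}`. -/
noncomputable def restrictedCarrierMatrix (p : ℝ) (K : ℕ) :
    Matrix (Fin (K + 1)) (Fin (K + 1)) ℝ :=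
  Matrix.of fun x y => carrierMatrix p x y

/-- `lam` is the unique (complex) eigenvalue of `A` of largest modulus and `h` is a strictly
positive eigenvector for it. -/
def IsPerronPair {ι : Type*} [Fintype ι] [DecidableEq ι] (A : Matrix ι ι ℝ) (lam : ℝ)
    (h : ι → ℝ) : Prop :=
  (∀ x, 0 < h x) ∧ A.mulVec h = lam • h ∧
  ∀ z ∈ spectrum ℂ (A.map Complex.ofReal), z ≠ (lam : ℂ) → ‖z‖ < lam

/-- The Doob transform `A x y * h y / (lam * h x)` of `A`. -/
noncomputable def doobTransform {ι : Type*} (A : Matrix ι ι ℝ) (lam : ℝ) (h : ι → ℝ) :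
    Matrix ι ι ℝ :=
  Matrix.of fun x y => A x y * h y / (lam * h x)

end BoxBall

/-! The configuration `η` consists of the rises of its carrier `W`, while `T η` has a particle at
`n` exactly when `W` drops between `n - 1` and `n`. So `T η` is obtained from `W` by reversing time,
reading off the up-steps and reversing again (`boxBall_eq`); without the first reversal the same
recipe yields the reversal of `η` (`decode_load`). Hence, if the laws of `W` and of `η` are both
invariant under time reversal, then `T η` and `η` have the same law (`identDistrib_boxBall`). What
remains is to check these two reversibilities and sub-criticality.

Part (b). A stationary Markov chain moving between neighbouring levels is reversible, because
stationarity makes up- and down-crossings of each level equally likely (`flux_balance`,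
`IsMarkovLaw.map_rev`); this covers `η`. The carrier need not be Markov, but its last step reveals
the last site, so it is Markov of second order. Its reversibility reduces to a balance relation for
three consecutive values (`map_rev_eq_of_balance`, `IsMarkovLaw.map_rev_load`). Sub-criticality is a
strong law for the particle density, which is below one half because `p₀ + p₁ < 1`. Part (a) with `p
> 0` is the case `p₀ = p₁`; for `p = 0` there are no particles.

Part (c). The truncated carrier starts from `0` at time `-N` and follows the carrier matrix inside
the window, so conditioned word probabilities are products of entries of the restricted matrix and
of its powers. After a Doob transform the eigenvalues cancel and only powers of a stochastic matrix
remain, which converge (`exists_tendsto_pow_mulVec`). By compactness the trajectories converge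
weakly to a stationary Markov law with the Doob matrix, which is nearest-neighbour and hence
reversible. A carrier bounded by `K` means `S m - S n ≤ K` for all `m ≤ n`, a condition unchanged by
reversing the configuration; so the conditioned configurations, and their limit, are reversible.
Finally the limiting carrier rests at `0` infinitely often in both directions. Each rest raises `M`
by one while `M - S` stays bounded, which gives sub-criticality. -/

namespace BoxBall

/-! ### Laws on two-sided trajectories, words and past events -/

/-- Two finite measures on a product of countable discrete spaces are equal if they agree on the
cylinders over a cofinal family of finite sets of coordinates. -/
theorem measure_ext_cylinder {ι α κ : Type*} [MeasurableSpace α] [Countable α]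
    [MeasurableSingletonClass α] [Nonempty α] (s : κ → Finset ι)
    (hs : ∀ I : Finset ι, ∃ n, I ⊆ s n) (μ ν : Measure (ι → α)) [IsFiniteMeasure μ]
    [IsFiniteMeasure ν]
    (h : ∀ n (x : ι → α), μ {ω | ∀ i ∈ s n, ω i = x i} = ν {ω | ∀ i ∈ s n, ω i = x i}) :
    μ = ν := by
  classical
  have key : ∀ n, μ.map (s n).restrict = ν.map (s n).restrict := by
    intro n
    refine Measure.ext_of_singleton fun y => ?_
    rw [Measure.map_apply (Finset.measurable_restrict _) (measurableSet_singleton _),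
      Measure.map_apply (Finset.measurable_restrict _) (measurableSet_singleton _)]
    have := h n (fun i => if hi : i ∈ s n then y ⟨i, hi⟩ else Classical.arbitrary α)
    have e : (s n).restrict ⁻¹' ({y} : Set (s n → α)) = {ω : ι → α | ∀ i ∈ s n,
        ω i = (fun i => if hi : i ∈ s n then y ⟨i, hi⟩ else Classical.arbitrary α) i} := by
      ext ω
      simp only [Set.mem_preimage, Set.mem_singleton_iff, funext_iff, Finset.restrict,
        Subtype.forall, Set.mem_ofPred_eq]
      refine forall₂_congr fun i hi => ?_
      simp [hi]
    rw [e, this]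
  -- Every finite marginal is a projection of one in the cofinal family, so both measures are
  -- projective limits of the same family.
  refine IsProjectiveLimit.unique (P := fun I => ν.map I.restrict) (fun I => ?_) (fun I => rfl)
  obtain ⟨n, hn⟩ := hs I
  have e : (I.restrict : (ι → α) → _) = Finset.restrict₂ hn ∘ (s n).restrict := rfl
  rw [e, ← Measure.map_map (Finset.measurable_restrict₂ _) (Finset.measurable_restrict _), key,
    Measure.map_map (Finset.measurable_restrict₂ _) (Finset.measurable_restrict _), ← e]

theorem measurableSet_coord {ι α : Type*} [MeasurableSpace α] [MeasurableSingletonClass α] (m : ι)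
    (a : α) : MeasurableSet {ω : ι → α | ω m = a} :=
  show MeasurableSet ((fun ω : ι → α => ω m) ⁻¹' {a}) from
    measurable_pi_apply m (measurableSet_singleton a)

/-- Trajectories following the word `x 0, …, x k` from time `n` on. -/
def word {α : Type*} (n : ℤ) (k : ℕ) (x : ℕ → α) : Set (ℤ → α) :=
  {ω | ∀ i : ℕ, i ≤ k → ω (n + i) = x i}

theorem measurableSet_word {α : Type*} [MeasurableSpace α] [MeasurableSingletonClass α] (n : ℤ)
    (k : ℕ) (x : ℕ → α) : MeasurableSet (word n k x) := by
  have : word n k x = ⋂ i : ℕ, ⋂ _ : i ≤ k, {ω : ℤ → α | ω (n + i) = x i} := by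
    ext ω; simp [word]
  rw [this]
  exact MeasurableSet.iInter fun i => MeasurableSet.iInter fun _ =>
    measurableSet_coord _ _

theorem word_succ {α : Type*} (n : ℤ) (k : ℕ) (x : ℕ → α) :
    word n (k + 1) x = word n k x ∩ {ω | ω (n + k + 1) = x (k + 1)} := by
  ext ω
  simp only [word, Set.mem_ofPred_eq, Set.mem_inter_iff]
  constructor
  · intro h
    refine ⟨fun i hi => h i (by omega), ?_⟩
    have := h (k + 1) le_rfl
    rwa [show n + ((k + 1 : ℕ) : ℤ) = n + k + 1 by push_cast; ring] at this
  · rintro ⟨h, h'⟩ i hi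
    rcases Nat.lt_or_ge k i with hk | hk
    · obtain rfl : i = k + 1 := by omega
      rwa [show n + ((k + 1 : ℕ) : ℤ) = n + k + 1 by push_cast; ring]
    · exact h i hk

theorem word_zero {α : Type*} (n : ℤ) (x : ℕ → α) :
    word n 0 x = {ω | ω n = x 0} := by
  ext ω; simp [word]

/-- Finite measures on two-sided trajectories that agree on all words are equal. -/
theorem measure_ext_word {α : Type*} [MeasurableSpace α] [Countable α]
    [MeasurableSingletonClass α] [Nonempty α] (μ ν : Measure (ℤ → α)) [IsFiniteMeasure μ]
    [IsFiniteMeasure ν] (h : ∀ n k x, μ (word n k x) = ν (word n k x)) : μ = ν := by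
  refine measure_ext_cylinder (fun n : ℕ => Finset.Icc (-n : ℤ) n) (fun I => ?_) μ ν
    fun n x => ?_
  · obtain ⟨n, hn⟩ : ∃ n : ℕ, ∀ i ∈ I, i.natAbs ≤ n := ⟨I.sup Int.natAbs, fun i hi =>
      Finset.le_sup (f := Int.natAbs) hi⟩
    exact ⟨n, fun i hi => by have := hn i hi; simp only [Finset.mem_Icc]; omega⟩
  · have : {ω : ℤ → α | ∀ i ∈ Finset.Icc (-n : ℤ) n, ω i = x i} =
        word (-n) (2 * n) (fun i => x (-n + i)) := by
      ext ω
      simp only [Finset.mem_Icc, Set.mem_ofPred_eq, word]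
      constructor
      · intro h i hi
        exact h _ ⟨by omega, by omega⟩
      · intro h i hi
        have := h (i + n).toNat (by omega)
        rwa [show -(n : ℤ) + ((i + n).toNat : ℤ) = i by omega] at this
    rw [this]
    exact h _ _ _

/-- Events measurable with respect to the past of time `m`. -/
def IsPast {α : Type*} [MeasurableSpace α] (m : ℤ) (A : Set (ℤ → α)) : Prop :=
  MeasurableSet A ∧ ∀ ω ω' : ℤ → α, (∀ i ≤ m, ω i = ω' i) → ω ∈ A → ω' ∈ A

theorem IsPast.inter {α : Type*} [MeasurableSpace α] {m : ℤ} {A B : Set (ℤ → α)}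
    (hA : IsPast m A) (hB : IsPast m B) : IsPast m (A ∩ B) :=
  ⟨hA.1.inter hB.1, fun ω ω' h hω => ⟨hA.2 ω ω' h hω.1, hB.2 ω ω' h hω.2⟩⟩

theorem IsPast.mono {α : Type*} [MeasurableSpace α] {m n : ℤ} {A : Set (ℤ → α)}
    (hA : IsPast m A) (h : m ≤ n) : IsPast n A :=
  ⟨hA.1, fun ω ω' h' hω => hA.2 ω ω' (fun i hi => h' i (hi.trans h)) hω⟩

theorem IsPast.coord {α : Type*} [MeasurableSpace α] [MeasurableSingletonClass α] (m : ℤ)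
    (a : α) : IsPast m {ω : ℤ → α | ω m = a} :=
  ⟨measurableSet_coord m a, fun ω ω' h hω => by simpa [← h m le_rfl] using hω⟩

theorem isPast_of_fun {α β : Type*} [MeasurableSpace α] [MeasurableSpace β]
    {m : ℤ} {f : (ℤ → α) → β} (hf : Measurable f)
    (h : ∀ ω ω' : ℤ → α, (∀ i ≤ m, ω i = ω' i) → f ω = f ω') {s : Set β} (hs : MeasurableSet s) :
    IsPast m (f ⁻¹' s) :=
  ⟨hf hs, fun ω ω' h' hω => by simpa [← h ω ω' h'] using hω⟩

theorem isPast_univ {α : Type*} [MeasurableSpace α] (m : ℤ) :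
    IsPast m (Set.univ : Set (ℤ → α)) := ⟨MeasurableSet.univ, fun _ _ _ _ => trivial⟩

/-- The Markov property with respect to the whole past. -/
theorem markov_past {α : Type*} [MeasurableSpace α] [Countable α] [MeasurableSingletonClass α]
    [Nonempty α] {μ : Measure (ℤ → α)} [IsFiniteMeasure μ] {Q : Matrix α α ℝ}
    (hQ : ∀ a b, 0 ≤ Q a b)
    (h : ∀ n k x, μ.real (word n (k + 1) x) = μ.real (word n k x) * Q (x k) (x (k + 1)))
    {m : ℤ} {A : Set (ℤ → α)} (hA : IsPast m A) (c b : α) :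
    μ.real (A ∩ {ω | ω m = c} ∩ {ω | ω (m + 1) = b}) =
      μ.real (A ∩ {ω | ω m = c}) * Q c b := by
  -- `τ` reads the past of `m` backwards as a one-sided sequence and `σ` restores it, with the
  -- constant value `ω m` after `m`; a past event is a preimage under `τ`.
  let τ : (ℤ → α) → (ℕ → α) := fun ω j => ω (m - j)
  let σ : (ℕ → α) → (ℤ → α) := fun y i => y (m - i).toNat
  have hτ : Measurable τ := measurable_pi_lambda _ fun j => measurable_pi_apply _
  have hσ : Measurable σ := measurable_pi_lambda _ fun j => measurable_pi_apply _
  have hAτ : A = τ ⁻¹' (σ ⁻¹' A) := by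
    have e : ∀ ω : ℤ → α, ∀ i ≤ m, ω i = σ (τ ω) i := fun ω i hi => by
      simp only [σ, τ]; congr 1; omega
    ext ω
    exact ⟨fun hω => hA.2 _ _ (e ω) hω, fun hω => hA.2 _ _ (fun i hi => (e ω i hi).symm) hω⟩
  have hcm : MeasurableSet {ω : ℤ → α | ω m = c} :=
    measurableSet_coord m c
  have hbm : MeasurableSet {ω : ℤ → α | ω (m + 1) = b} :=
    measurableSet_coord (m + 1) b
  -- Both sides are finite measures on pasts, so it suffices to compare them on cylinders, where the
  -- identity is the one-step property for words.
  have key : (μ.restrict ({ω | ω m = c} ∩ {ω | ω (m + 1) = b})).map τ =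
      ((Q c b).toNNReal • (μ.restrict {ω | ω m = c}).map τ) := by
    refine measure_ext_cylinder (fun n : ℕ => Finset.range (n + 1)) (fun I => ?_) _ _
      fun n x => ?_
    · exact ⟨I.sup id, fun i hi => Finset.mem_range.2
        (Nat.lt_succ_of_le (Finset.le_sup (f := id) hi))⟩
    · have hcyl : MeasurableSet {y : ℕ → α | ∀ i ∈ Finset.range (n + 1), y i = x i} := by
        have : {y : ℕ → α | ∀ i ∈ Finset.range (n + 1), y i = x i} =
          ⋂ i ∈ Finset.range (n + 1), {y | y i = x i} := by ext; simp
        rw [this]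
        exact Finset.measurableSet_biInter _ fun i _ =>
          measurableSet_coord i _
      rw [Measure.smul_apply, Measure.map_apply hτ hcyl, Measure.map_apply hτ hcyl,
        Measure.restrict_apply (hτ hcyl), Measure.restrict_apply (hτ hcyl)]
      by_cases hx : x 0 = c
      · let z : ℕ → α := fun i => if i ≤ n then x (n - i) else b
        have e1 : τ ⁻¹' {y | ∀ i ∈ Finset.range (n + 1), y i = x i} ∩ {ω | ω m = c} =
            word (m - n) n z := by
          ext ω
          simp only [Set.mem_inter_iff, Set.mem_preimage, Set.mem_ofPred_eq, word,
            Finset.mem_range, τ, z]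
          constructor
          · rintro ⟨h1, -⟩ i hi
            have := h1 (n - i) (by omega)
            simp only [hi, if_true]
            rw [← this]; congr 1; omega
          · intro h1
            have h2 : ∀ i < n + 1, ω (m - i) = x i := by
              intro i hi
              have := h1 (n - i) (by omega)
              rw [if_pos (by omega), show n - (n - i) = i by omega] at this
              rw [← this]; congr 1; omega
            refine ⟨h2, ?_⟩
            have := h2 0 (by omega)
            simpa [hx] using this
        have e2 : τ ⁻¹' {y | ∀ i ∈ Finset.range (n + 1), y i = x i} ∩
            ({ω | ω m = c} ∩ {ω | ω (m + 1) = b}) = word (m - n) (n + 1) z := by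
          rw [word_succ, ← e1, Set.inter_assoc]
          have : z (n + 1) = b := by simp [z]
          rw [this]
          simp
        rw [e1, e2]
        have h3 := h (m - n) n z
        have h4 : z n = c := by simp [z, hx]
        have h5 : z (n + 1) = b := by simp [z]
        rw [h4, h5] at h3
        rw [← ENNReal.toReal_eq_toReal_iff' (measure_ne_top _ _)
          (by simp [ENNReal.smul_def, ENNReal.mul_eq_top])]
        simp only [Measure.real] at h3
        rw [h3, ENNReal.smul_def, smul_eq_mul, ENNReal.toReal_mul]
        simp [hQ, mul_comm]
      · have e1 : τ ⁻¹' {y | ∀ i ∈ Finset.range (n + 1), y i = x i} ∩ {ω | ω m = c} = ∅ := by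
          ext ω
          simp only [Set.mem_inter_iff, Set.mem_preimage, Set.mem_ofPred_eq, Finset.mem_range, τ,
            Set.mem_empty_iff_false, iff_false, not_and]
          intro h1 h2
          have := h1 0 (by omega)
          simp [h2] at this
          exact hx this.symm
        rw [← Set.inter_assoc, e1]
        simp
  have := congrArg (fun ν : Measure (ℕ → α) => (ν (σ ⁻¹' A)).toReal) key
  simp only [Measure.smul_apply] at this
  rw [Measure.map_apply hτ (hσ hA.1), Measure.map_apply hτ (hσ hA.1), ← hAτ,
    Measure.restrict_apply hA.1, Measure.restrict_apply hA.1, ← Set.inter_assoc,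
    ENNReal.smul_def, smul_eq_mul, ENNReal.toReal_mul] at this
  simp only [Measure.real]
  rw [this]
  simp [hQ, mul_comm]

/-! ### The carrier load and its recursion -/

/-- The number of particles minus the number of empty sites among the `j` sites
`n - j + 1, …, n`. -/
def excess (ω : Config) (n : ℤ) (j : ℕ) : ℤ :=
  ∑ i ∈ Finset.range j, (2 * ((ω (n - i) : ℕ) : ℤ) - 1)

/-- The carrier load at `n` as a natural number, written as a function of the sites up to `n`. -/
noncomputable def load (ω : Config) (n : ℤ) : ℕ := (⨆ j, excess ω n j).toNat

/-- Configurations on which the dynamics is defined. -/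
def IsGood (ω : Config) : Prop := BddAbove (path ω '' Set.Iic 0)

theorem excess_zero (ω : Config) (n : ℤ) : excess ω n 0 = 0 := by simp [excess]

theorem excess_succ (ω : Config) (n : ℤ) (j : ℕ) :
    excess ω n (j + 1) = (2 * ((ω n : ℕ) : ℤ) - 1) + excess ω (n - 1) j := by
  rw [excess, Finset.sum_range_succ', add_comm]
  simp only [excess, Nat.cast_zero, sub_zero]
  congr 1
  refine Finset.sum_congr rfl fun i _ => ?_
  rw [show n - ((i + 1 : ℕ) : ℤ) = n - 1 - i by push_cast; ring]

theorem excess_eq (ω : Config) (n : ℤ) (j : ℕ) :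
    excess ω n j = path ω (n - j) - path ω n := by
  induction j generalizing n with
  | zero => simp [excess_zero]
  | succ j ih =>
    rw [excess_succ, ih]
    have := path_sub_path ω n
    rw [show n - ((j + 1 : ℕ) : ℤ) = n - 1 - j by push_cast; ring]
    linarith

theorem bddAbove_path_of_isGood {ω : Config} (h : IsGood ω) (n : ℤ) :
    BddAbove (path ω '' Set.Iic n) := by
  have : path ω '' Set.Iic n ⊆ path ω '' Set.Iic 0 ∪ path ω '' Set.Icc 0 n := by
    rw [← Set.image_union]
    refine Set.image_mono fun m hm => ?_
    rcases le_or_gt m 0 with h | h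
    · exact Or.inl h
    · exact Or.inr ⟨h.le, hm⟩
  exact (BddAbove.union h ((Set.finite_Icc 0 n).image _).bddAbove).mono this

theorem bddAbove_excess {ω : Config} (h : IsGood ω) (n : ℤ) :
    BddAbove (Set.range (excess ω n)) := by
  obtain ⟨B, hB⟩ := bddAbove_path_of_isGood h n
  refine ⟨B - path ω n, ?_⟩
  rintro _ ⟨j, rfl⟩
  have := hB (Set.mem_image_of_mem (path ω) (show n - (j : ℤ) ∈ Set.Iic n by simp))
  rw [excess_eq]
  linarith

theorem excess_le_load {ω : Config} (h : IsGood ω) (n : ℤ) (j : ℕ) :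
    excess ω n j ≤ load ω n :=
  (le_ciSup (bddAbove_excess h n) j).trans (Int.self_le_toNat _)

theorem exists_excess_eq_load {ω : Config} (h : IsGood ω) (n : ℤ) :
    ∃ j, excess ω n j = load ω n := by
  obtain ⟨j, hj⟩ : (⨆ j, excess ω n j) ∈ Set.range (excess ω n) :=
    Int.csSup_mem (Set.range_nonempty _) (bddAbove_excess h n)
  refine ⟨j, ?_⟩
  have h0 : 0 ≤ ⨆ j, excess ω n j := by
    have := le_ciSup (bddAbove_excess h n) 0
    rwa [excess_zero] at this
  rw [load, hj, Int.toNat_of_nonneg h0]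

theorem load_eq_of {ω : Config} (h : IsGood ω) {n : ℤ} {w : ℕ} (h1 : ∀ j, excess ω n j ≤ w)
    (h2 : ∃ j, excess ω n j = w) : load ω n = w := by
  obtain ⟨j, hj⟩ := exists_excess_eq_load h n
  obtain ⟨i, hi⟩ := h2
  have := h1 j
  have := excess_le_load h n i
  omega

theorem carrier_eq_load {ω : Config} (h : IsGood ω) (n : ℤ) : carrier ω n = load ω n := by
  have hne : (path ω '' Set.Iic n).Nonempty := ⟨path ω n, n, by simp, rfl⟩
  obtain ⟨m, hm, hm'⟩ : sSup (path ω '' Set.Iic n) ∈ path ω '' Set.Iic n :=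
    Int.csSup_mem hne (bddAbove_path_of_isGood h n)
  obtain ⟨j, hj⟩ := exists_excess_eq_load h n
  rw [excess_eq] at hj
  have h1 := le_csSup (bddAbove_path_of_isGood h n)
    (Set.mem_image_of_mem (path ω) (show n - (j : ℤ) ∈ Set.Iic n by simp))
  have h2 := excess_le_load h n (n - m).toNat
  have hm : m ≤ n := hm
  rw [excess_eq, show n - ((n - m).toNat : ℤ) = m by omega] at h2
  rw [carrier, pastMax]
  linarith

theorem load_of_eq_one {ω : Config} (h : IsGood ω) {n : ℤ} (hn : ω n = 1) :
    load ω n = load ω (n - 1) + 1 := by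
  refine load_eq_of h (fun j => ?_) ?_
  · cases j with
    | zero => rw [excess_zero]; positivity
    | succ j =>
      have := excess_le_load h (n - 1) j
      rw [excess_succ, hn]
      push_cast
      simp only [Fin.isValue, Fin.val_one, Nat.cast_one]
      linarith
  · obtain ⟨j, hj⟩ := exists_excess_eq_load h (n - 1)
    refine ⟨j + 1, ?_⟩
    rw [excess_succ, hn, hj]
    push_cast
    simp only [Fin.isValue, Fin.val_one, Nat.cast_one]
    ring

theorem load_of_eq_zero {ω : Config} (h : IsGood ω) {n : ℤ} (hn : ω n = 0) :
    load ω n = load ω (n - 1) - 1 := by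
  refine load_eq_of h (fun j => ?_) ?_
  · cases j with
    | zero => rw [excess_zero]; positivity
    | succ j =>
      have := excess_le_load h (n - 1) j
      rw [excess_succ, hn]
      simp only [Fin.isValue, Fin.val_zero]
      omega
  -- An empty carrier stays empty, and then the supremum is attained at the empty window `j = 0`.
  · rcases Nat.eq_zero_or_pos (load ω (n - 1)) with h0 | h0
    · exact ⟨0, by rw [excess_zero, h0]; rfl⟩
    · obtain ⟨j, hj⟩ := exists_excess_eq_load h (n - 1)
      refine ⟨j + 1, ?_⟩
      rw [excess_succ, hn, hj]
      simp only [Fin.isValue, Fin.val_zero]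
      omega

/-- One step of the carrier: pick up a particle or drop one if possible. -/
def carry (w : ℕ) (e : Fin 2) : ℕ := if e = 1 then w + 1 else w - 1

theorem fin_two_ne_one {e : Fin 2} : e ≠ 1 ↔ e = 0 := by
  fin_cases e <;> simp

theorem load_step {ω : Config} (h : IsGood ω) (n : ℤ) :
    load ω n = carry (load ω (n - 1)) (ω n) := by
  unfold carry
  split_ifs with h1
  · exact load_of_eq_one h h1
  · exact load_of_eq_zero h (fin_two_ne_one.1 h1)

theorem load_step_succ {ω : Config} (h : IsGood ω) (n : ℤ) :
    load ω (n + 1) = carry (load ω n) (ω (n + 1)) := by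
  have := load_step h (n + 1)
  rwa [add_sub_cancel_right] at this

/-- A process that follows the carrier recursion and is `0` at arbitrarily negative times is the
carrier load, and the dynamics is defined. -/
theorem isGood_and_load_eq {ω : Config} {w : ℤ → ℕ} (hw : ∀ n, w n = carry (w (n - 1)) (ω n))
    (h0 : ∀ n, ∃ m ≤ n, w m = 0) : IsGood ω ∧ load ω = w := by
  -- The recursion alone makes `w` dominate every excess; the zeros of `w` are needed only for
  -- attainment.
  have h1 : ∀ j n, excess ω n j ≤ w n := by
    intro j
    induction j with
    | zero => intro n; rw [excess_zero]; positivity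
    | succ j ih =>
      intro n
      have h2 := ih (n - 1)
      have h3 := hw n
      rw [excess_succ]
      unfold carry at h3
      split_ifs at h3 with h4
      · rw [h4, h3]
        simp only [Fin.isValue, Fin.val_one]
        push_cast
        linarith
      · rw [fin_two_ne_one.1 h4]
        simp only [Fin.isValue, Fin.val_zero]
        omega
  have h2 : ∀ m, w m = 0 → ∀ k : ℕ, ∃ j, excess ω (m + k) j = w (m + k) := by
    intro m hm k
    induction k with
    | zero => exact ⟨0, by simp [excess_zero, hm]⟩
    | succ k ih =>
      obtain ⟨j, hj⟩ := ih
      have h3 := hw (m + (k + 1 : ℕ))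
      rw [show m + ((k + 1 : ℕ) : ℤ) - 1 = m + k by push_cast; ring] at h3
      unfold carry at h3
      split_ifs at h3 with h4
      · refine ⟨j + 1, ?_⟩
        rw [excess_succ, show m + ((k + 1 : ℕ) : ℤ) - 1 = m + k by push_cast; ring, hj, h4, h3]
        simp only [Fin.isValue, Fin.val_one]
        push_cast
        ring
      · rcases Nat.eq_zero_or_pos (w (m + k)) with h5 | h5
        · exact ⟨0, by rw [excess_zero, h3, h5]; rfl⟩
        · refine ⟨j + 1, ?_⟩
          rw [excess_succ, show m + ((k + 1 : ℕ) : ℤ) - 1 = m + k by push_cast; ring, hj,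
            fin_two_ne_one.1 h4, h3]
          simp only [Fin.isValue, Fin.val_zero]
          omega
  have hg : IsGood ω := by
    refine ⟨w 0, ?_⟩
    rintro _ ⟨m, hm, rfl⟩
    have hm : m ≤ 0 := hm
    have := h1 (-m).toNat 0
    rw [excess_eq, path_zero, show (0 : ℤ) - ((-m).toNat : ℤ) = m by omega] at this
    linarith
  refine ⟨hg, funext fun n => load_eq_of hg (fun j => h1 j n) ?_⟩
  obtain ⟨m, hm, hm'⟩ := h0 n
  have := h2 m hm' (n - m).toNat
  rwa [show m + ((n - m).toNat : ℤ) = n by omega] at this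

/-! ### The dynamics as time reversal of the carrier -/

/-- The configuration whose particles are the up-steps of `w`. -/
def decode {α : Type*} (f : α → ℕ) (w : ℤ → α) (n : ℤ) : Fin 2 :=
  if f (w n) = f (w (n - 1)) + 1 then 1 else 0

/-- Reversal of time `n ↦ c - n`. -/
def rev {α : Type*} (c : ℤ) (w : ℤ → α) (n : ℤ) : α := w (c - n)

/-- At an empty site the load never increases, so the rises of the load are exactly the particles
and the carrier determines the configuration. -/
theorem decode_load {ω : Config} (h : IsGood ω) : decode id (load ω) = ω := by
  ext n
  have := load_step h n
  unfold carry at this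
  simp only [decode, id]
  split_ifs at this with h1
  · rw [h1, if_pos this]
  · rw [fin_two_ne_one.1 h1, if_neg (by omega)]

/-- Since `pitman` equals `2M - S` up to a constant, it steps down exactly where the carrier drops.
Site `n` is the edge between times `n - 1` and `n`; the reversal `n ↦ -n` of times therefore acts on
sites as `n ↦ 1 - n`, which accounts for `rev 0` on loads and `rev 1` on configurations. -/
theorem boxBall_eq {ω : Config} (h : IsGood ω) :
    boxBall ω = rev 1 (decode id (rev 0 (load ω))) := by
  -- With `M = W + S`, the increment of `2M - S` is that of `2W + S`, and each kind of site is
  -- checked separately; it is `+1` when an empty carrier meets an empty site.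
  have key : ∀ n, pitman (path ω) n = pitman (path ω) (n - 1) - 1 ↔
      load ω (n - 1) = load ω n + 1 := by
    intro n
    have h1 : pastMax (path ω) n = load ω n + path ω n := by
      rw [← carrier_eq_load h, carrier]; ring
    have h2 : pastMax (path ω) (n - 1) = load ω (n - 1) + path ω (n - 1) := by
      rw [← carrier_eq_load h, carrier]; ring
    have h3 := path_sub_path ω n
    have h4 := load_step h n
    unfold pitman
    rw [h1, h2]
    unfold carry at h4
    split_ifs at h4 with h5
    · rw [h5] at h3
      simp only [Fin.isValue, Fin.val_one] at h3
      omega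
    · rw [fin_two_ne_one.1 h5] at h3
      simp only [Fin.isValue, Fin.val_zero] at h3
      omega
  ext n
  have e1 : (0 : ℤ) - (1 - n) = n - 1 := by ring
  have e2 : (0 : ℤ) - (1 - n - 1) = n := by ring
  simp only [boxBall, rev, decode, id, key, e1, e2]

theorem mem_dynamicsDomain {ω : Config} (h : IsGood ω) : path ω ∈ dynamicsDomain :=
  ⟨path_mem ω, h⟩

theorem excess_congr {ω ω' : Config} {n : ℤ} (h : ∀ i ≤ n, ω i = ω' i) (j : ℕ) :
    excess ω n j = excess ω' n j :=
  Finset.sum_congr rfl fun i _ => by rw [h (n - i) (by simp)]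

theorem load_congr {ω ω' : Config} {n : ℤ} (h : ∀ i ≤ n, ω i = ω' i) :
    load ω n = load ω' n := by
  simp only [load, excess_congr h]

theorem load_shift (ω : Config) (k n : ℤ) : load (fun i => ω (i + k)) n = load ω (n + k) := by
  simp only [load, excess]
  congr 2
  ext j
  refine Finset.sum_congr rfl fun i _ => ?_
  rw [show n - (i : ℤ) + k = n + k - i by ring]

theorem measurable_load : Measurable load := by
  refine measurable_pi_lambda _ fun n => ?_
  have : Measurable fun ω : Config => ⨆ j, excess ω n j := by
    refine Measurable.iSup fun j => ?_
    refine Finset.measurable_sum _ fun i _ => ?_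
    exact (measurable_of_countable fun e : Fin 2 => 2 * ((e : ℕ) : ℤ) - 1).comp
      (measurable_pi_apply (n - (i : ℤ)))
  exact (measurable_of_countable Int.toNat).comp this

theorem measurable_rev {α : Type*} [MeasurableSpace α] (c : ℤ) :
    Measurable (rev c : (ℤ → α) → ℤ → α) :=
  measurable_pi_lambda _ fun _ => measurable_pi_apply _

theorem continuous_rev {α : Type*} [TopologicalSpace α] (c : ℤ) :
    Continuous (rev c : (ℤ → α) → ℤ → α) :=
  continuous_pi fun _ => continuous_apply _

theorem measurable_decode {α : Type*} [MeasurableSpace α] [Countable α]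
    [MeasurableSingletonClass α] (f : α → ℕ) : Measurable (decode f) := by
  refine measurable_pi_lambda _ fun n => ?_
  have h : Measurable fun w : ℤ → α => (w n, w (n - 1)) :=
    (measurable_pi_apply n).prodMk (measurable_pi_apply (n - 1))
  exact (measurable_of_countable fun q : α × α =>
    if f q.1 = f q.2 + 1 then (1 : Fin 2) else 0).comp h

theorem continuous_decode {α : Type*} [TopologicalSpace α] [DiscreteTopology α] (f : α → ℕ) :
    Continuous (decode f) := by
  refine continuous_pi fun n => ?_
  have h : Continuous fun w : ℤ → α => (w n, w (n - 1)) :=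
    (continuous_apply n).prodMk (continuous_apply (n - 1))
  exact (continuous_of_discreteTopology (f := fun q : α × α =>
    if f q.1 = f q.2 + 1 then (1 : Fin 2) else 0)).comp h

/-! ### Time reversal of stationary processes -/

theorem word_congr {α : Type*} {n : ℤ} {k : ℕ} {x y : ℕ → α} (h : ∀ i ≤ k, x i = y i) :
    word n k x = word n k y := by
  ext ω
  simp only [word, Set.mem_ofPred_eq]
  exact forall₂_congr fun i hi => by rw [h i hi]

theorem rev_preimage_word {α : Type*} (c n : ℤ) (k : ℕ) (x : ℕ → α) :
    rev c ⁻¹' word n k x = word (c - n - k) k (fun i => x (k - i)) := by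
  ext ω
  simp only [word, Set.mem_preimage, Set.mem_ofPred_eq, rev]
  constructor
  · intro h i hi
    rw [← h (k - i) (by omega)]
    congr 1
    omega
  · intro h i hi
    have := h (k - i) (by omega)
    rw [show k - (k - i) = i by omega] at this
    rw [← this]
    congr 1
    omega

/-- A stationary process with second-order Markov dependence `q` and symmetric edge weights in
detailed balance with `q` is invariant under reversal of time. -/
theorem map_rev_eq_of_balance {α : Type*} [MeasurableSpace α] [Countable α]
    [MeasurableSingletonClass α] [Nonempty α] {μ : Measure (ℤ → α)} [IsFiniteMeasure μ]
    (hshift : ∀ n k x, μ.real (word n k x) = μ.real (word 0 k x))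
    (q : α → α → α → ℝ) (a : α → α → ℝ)
    (hrec : ∀ k x, μ.real (word 0 (k + 2) x) =
      μ.real (word 0 (k + 1) x) * q (x k) (x (k + 1)) (x (k + 2)))
    (ha : ∀ x, μ.real (word 0 1 x) = a (x 0) (x 1)) (hsymm : ∀ u v, a u v = a v u)
    (hbal : ∀ u v w, a u v * q u v w = a w v * q w v u) (c : ℤ) :
    μ.map (rev c) = μ := by
  -- The recursion peels letters off the end of a word. The balance relation starts an induction by
  -- which letters are also peeled off the front, with the reversed weight `q`.
  have hback : ∀ k x, μ.real (word 0 (k + 2) x) =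
      q (x 2) (x 1) (x 0) * μ.real (word 0 (k + 1) (fun i => x (i + 1))) := by
    intro k
    induction k with
    | zero =>
      intro x
      rw [hrec, ha, ha, hbal, hsymm, mul_comm]
    | succ k ih =>
      intro x
      rw [hrec, ih, hrec]
      ring
  -- Peeling the reversed word at its end and the original word at its front produces the same
  -- factor.
  have hrev : ∀ k x, μ.real (word 0 (k + 1) (fun i => x (k + 1 - i))) =
      μ.real (word 0 (k + 1) x) := by
    intro k
    induction k with
    | zero =>
      intro x
      rw [ha, ha, hsymm]
    | succ k ih =>
      intro x
      rw [hrec, hback, ← ih, mul_comm]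
      congr 1
      · congr 1 <;> congr 1 <;> omega
      · congr 1
        refine word_congr fun i hi => ?_
        congr 1
        omega
  have hfin : IsFiniteMeasure (μ.map (rev c)) := inferInstance
  refine measure_ext_word _ _ fun n k x => ?_
  rw [← ENNReal.toReal_eq_toReal_iff' (measure_ne_top _ _) (measure_ne_top _ _),
    Measure.map_apply (measurable_rev c) (measurableSet_word n k x), rev_preimage_word]
  change μ.real _ = μ.real _
  rw [hshift, hshift n]
  cases k with
  | zero => simp [word_zero]
  | succ k => exact hrev k x

/-- Up- and down-crossings of a level by identically distributed neighbours are equally likely. -/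
theorem flux_balance {Ω : Type*} [MeasurableSpace Ω] {μ : Measure Ω} [IsFiniteMeasure μ]
    {X Y : Ω → ℕ} (hX : Measurable X) (hY : Measurable Y) (hXY : μ.map X = μ.map Y)
    (h1 : ∀ᵐ ω ∂μ, X ω ≤ Y ω + 1) (h2 : ∀ᵐ ω ∂μ, Y ω ≤ X ω + 1) (x : ℕ) :
    μ.real {ω | X ω = x ∧ Y ω = x + 1} = μ.real {ω | X ω = x + 1 ∧ Y ω = x} := by
  -- The events `X ≤ x` and `Y ≤ x` are equally likely; removing their intersection leaves the up-
  -- and the down-crossings of the level.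
  have e : μ.real (X ⁻¹' Set.Iic x) = μ.real (Y ⁻¹' Set.Iic x) := by
    have := congrArg (fun ν : Measure ℕ => ν.real (Set.Iic x)) hXY
    simpa only [map_measureReal_apply hX measurableSet_Iic,
      map_measureReal_apply hY measurableSet_Iic] using this
  have d1 := measureReal_inter_add_sdiff (μ := μ) (s := X ⁻¹' Set.Iic x)
    (hY (measurableSet_Iic (a := x)))
  have d2 := measureReal_inter_add_sdiff (μ := μ) (s := Y ⁻¹' Set.Iic x)
    (hX (measurableSet_Iic (a := x)))
  have e1 : μ.real (X ⁻¹' Set.Iic x \ Y ⁻¹' Set.Iic x) = μ.real {ω | X ω = x ∧ Y ω = x + 1} := by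
    refine measureReal_congr ?_
    filter_upwards [h1, h2] with ω h1 h2
    apply propext
    change (X ω ≤ x ∧ ¬ Y ω ≤ x) ↔ (X ω = x ∧ Y ω = x + 1)
    omega
  have e2 : μ.real (Y ⁻¹' Set.Iic x \ X ⁻¹' Set.Iic x) = μ.real {ω | X ω = x + 1 ∧ Y ω = x} := by
    refine measureReal_congr ?_
    filter_upwards [h1, h2] with ω h1 h2
    apply propext
    change (Y ω ≤ x ∧ ¬ X ω ≤ x) ↔ (X ω = x + 1 ∧ Y ω = x)
    omega
  rw [Set.inter_comm] at d2
  linarith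

/-- A translation-invariant law on two-sided trajectories. -/
def IsShiftInvariant {α : Type*} [MeasurableSpace α] (μ : Measure (ℤ → α)) : Prop :=
  ∀ k : ℤ, μ.map (fun ω n => ω (n + k)) = μ

theorem measurable_shift {α : Type*} [MeasurableSpace α] (k : ℤ) :
    Measurable (fun (ω : ℤ → α) n => ω (n + k)) :=
  measurable_pi_lambda _ fun _ => measurable_pi_apply _

theorem IsShiftInvariant.measureReal_preimage {α : Type*} [MeasurableSpace α]
    {μ : Measure (ℤ → α)} (h : IsShiftInvariant μ) (k : ℤ) {A : Set (ℤ → α)}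
    (hA : MeasurableSet A) : μ.real {ω | (fun n => ω (n + k)) ∈ A} = μ.real A := by
  conv_rhs => rw [← h k]
  rw [map_measureReal_apply (measurable_shift k) hA]
  rfl

theorem IsShiftInvariant.word {α : Type*} [MeasurableSpace α] [MeasurableSingletonClass α]
    {μ : Measure (ℤ → α)} (h : IsShiftInvariant μ) (n : ℤ) (k : ℕ) (x : ℕ → α) :
    μ.real (word n k x) = μ.real (word 0 k x) := by
  rw [← h.measureReal_preimage n (measurableSet_word 0 k x)]
  congr 1
  ext ω
  simp only [BoxBall.word, Set.mem_ofPred_eq]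
  refine forall₂_congr fun i _ => ?_
  rw [show (0 : ℤ) + i + n = n + i by ring]

theorem IsShiftInvariant.map_coord {α : Type*} [MeasurableSpace α]
    {μ : Measure (ℤ → α)} (h : IsShiftInvariant μ) (m n : ℤ) :
    μ.map (fun ω => ω m) = μ.map (fun ω => ω n) := by
  conv_rhs => rw [← h (m - n)]
  rw [Measure.map_map (measurable_pi_apply n) (measurable_shift _)]
  congr 1
  ext ω
  simp

theorem IsShiftInvariant.map_map {α β : Type*} [MeasurableSpace α] [MeasurableSpace β]
    {μ : Measure (ℤ → α)} (h : IsShiftInvariant μ) {f : (ℤ → α) → ℤ → β} (hf : Measurable f)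
    (hcomm : ∀ ω k n, f (fun i => ω (i + k)) n = f ω (n + k)) :
    IsShiftInvariant (μ.map f) := by
  intro k
  rw [Measure.map_map (measurable_shift k) hf]
  conv_rhs => rw [← h k, Measure.map_map hf (measurable_shift k)]
  congr 1
  ext ω n
  simp [hcomm]

/-- Shift-invariant Markov laws on two-sided trajectories. -/
structure IsMarkovLaw {α : Type*} [MeasurableSpace α] (μ : Measure (ℤ → α))
    (Q : Matrix α α ℝ) : Prop where
  shift : IsShiftInvariant μ
  step : ∀ n k x, μ.real (word n (k + 1) x) = μ.real (word n k x) * Q (x k) (x (k + 1))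

theorem word_one {α : Type*} (n : ℤ) (x : ℕ → α) :
    word n 1 x = {ω | ω n = x 0 ∧ ω (n + 1) = x 1} := by
  have := word_succ n 0 x
  rw [zero_add] at this
  rw [this, word_zero]
  ext ω
  simp

/-- Nearest-neighbour stationary Markov chains are reversible. -/
theorem IsMarkovLaw.map_rev {α : Type*} [MeasurableSpace α] [Countable α]
    [MeasurableSingletonClass α] [Nonempty α] {μ : Measure (ℤ → α)} [IsFiniteMeasure μ]
    {Q : Matrix α α ℝ} (h : IsMarkovLaw μ Q) (f : α → ℕ) (hf : Function.Injective f)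
    (hQ : ∀ u v, Q u v ≠ 0 → f u ≤ f v + 1 ∧ f v ≤ f u + 1) (c : ℤ) : μ.map (rev c) = μ := by
  let π : α → ℝ := fun u => μ.real {ω | ω 0 = u}
  have hedge : ∀ u v, μ.real {ω | ω 0 = u ∧ ω 1 = v} = π u * Q u v := by
    intro u v
    have h1 := h.step 0 0 (fun i => if i = 0 then u else v)
    rw [zero_add, word_one, word_zero] at h1
    simpa using h1
  have hfm : Measurable f := measurable_of_countable f
  have hnn : ∀ᵐ ω ∂μ, f (ω 0) ≤ f (ω 1) + 1 ∧ f (ω 1) ≤ f (ω 0) + 1 := by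
    rw [ae_iff]
    -- A forbidden jump uses one of countably many edges of zero weight.
    have hsub : {ω : ℤ → α | ¬(f (ω 0) ≤ f (ω 1) + 1 ∧ f (ω 1) ≤ f (ω 0) + 1)} ⊆
        ⋃ p ∈ {p : α × α | Q p.1 p.2 = 0}, {ω | ω 0 = p.1 ∧ ω 1 = p.2} := by
      intro ω hω
      simp only [Set.mem_iUnion]
      refine ⟨(ω 0, ω 1), ?_, rfl, rfl⟩
      by_contra hne
      exact hω (hQ _ _ hne)
    refine measure_mono_null hsub ((measure_biUnion_null_iff (Set.to_countable _)).2 ?_)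
    rintro ⟨u, v⟩ huv
    have := hedge u v
    rw [show Q u v = 0 from huv, mul_zero] at this
    exact (measureReal_eq_zero_iff (measure_ne_top _ _)).1 this
  have hflux := fun x => flux_balance (hfm.comp (measurable_pi_apply (X := fun _ : ℤ => α) 0))
    (hfm.comp (measurable_pi_apply (X := fun _ : ℤ => α) 1)) (μ := μ) (by
      rw [← Measure.map_map hfm (measurable_pi_apply 0),
        ← Measure.map_map hfm (measurable_pi_apply 1), h.shift.map_coord 0 1])
    (hnn.mono fun _ h => h.1) (hnn.mono fun _ h => h.2) x
  have hup : ∀ u v, f v = f u + 1 → π u * Q u v = π v * Q v u := by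
    intro u v huv
    rw [← hedge, ← hedge]
    have := hflux (f u)
    rw [← huv] at this
    simp only [Function.comp_apply, hf.eq_iff] at this
    exact this
  have hsymm : ∀ u v, π u * Q u v = π v * Q v u := by
    intro u v
    rcases eq_or_ne u v with rfl | hne
    · rfl
    rcases eq_or_ne (f v) (f u + 1) with h1 | h1
    · exact hup u v h1
    rcases eq_or_ne (f u) (f v + 1) with h2 | h2
    · exact (hup v u h2).symm
    have h3 : f u ≠ f v := fun h => hne (hf h)
    have z1 : Q u v = 0 := by
      by_contra hq; have := hQ _ _ hq; omega
    have z2 : Q v u = 0 := by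
      by_contra hq; have := hQ _ _ hq; omega
    rw [z1, z2, mul_zero, mul_zero]
  refine map_rev_eq_of_balance h.shift.word (fun _ v w => Q v w) (fun u v => π u * Q u v)
    (fun k x => h.step 0 (k + 1) x) (fun x => ?_) hsymm (fun u v w => ?_) c
  · rw [word_one, zero_add, hedge]
  · rw [hsymm u v, hsymm w v]
    ring

/-! ### The invariance criterion -/

/-- Reversibility of the configuration and of its carrier gives invariance under the dynamics. -/
theorem identDistrib_boxBall {μ : Measure Config} (hgood : ∀ᵐ ω ∂μ, IsGood ω)
    (hload : (μ.map load).map (rev 0) = μ.map load) (hrev : μ.map (rev 1) = μ) :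
    IdentDistrib boxBall id μ μ := by
  have hg : Measurable fun w : ℤ → ℕ => (rev 1 (decode id w) : Config) :=
    (measurable_rev 1).comp (measurable_decode id)
  have hae : boxBall =ᵐ[μ] fun ω => rev 1 (decode id (rev 0 (load ω))) :=
    hgood.mono fun ω h => boxBall_eq h
  have hm : Measurable fun ω : Config => (rev 1 (decode id (rev 0 (load ω))) : Config) :=
    hg.comp ((measurable_rev 0).comp measurable_load)
  refine ⟨hm.aemeasurable.congr hae.symm, aemeasurable_id, ?_⟩
  rw [Measure.map_congr hae, Measure.map_id]
  have e1 : μ.map (fun ω : Config => (rev 1 (decode id (rev 0 (load ω))) : Config)) =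
      ((μ.map load).map (rev 0)).map (fun w : ℤ → ℕ => rev 1 (decode id w)) := by
    rw [Measure.map_map (measurable_rev 0) measurable_load,
      Measure.map_map hg ((measurable_rev 0).comp measurable_load)]
    rfl
  rw [e1, hload, Measure.map_map hg measurable_load]
  have hae2 : ((fun w : ℤ → ℕ => (rev 1 (decode id w) : Config)) ∘ load) =ᵐ[μ] rev 1 :=
    hgood.mono fun ω h => by simp only [Function.comp_apply, decode_load h]
  rw [Measure.map_congr hae2, hrev]

/-! ### A strong law and paths with positive speed -/

/-- With variances growing linearly, the squared normalized deviations have summable expectations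
along the squares, hence tend to `0` almost surely there. Nonnegative summands make the partial sums
monotone, which fills the gaps between squares. -/
theorem tendsto_sum_div_of_variance_le {Ω : Type*} [MeasurableSpace Ω] {μ : Measure Ω}
    [IsProbabilityMeasure μ] {Y : ℕ → Ω → ℝ} (hY : ∀ i, Measurable (Y i)) (h0 : ∀ i ω, 0 ≤ Y i ω)
    {ρ C : ℝ} (hint : ∀ n, Integrable (fun ω => (∑ i ∈ Finset.range n, (Y i ω - ρ)) ^ 2) μ)
    (hvar : ∀ n : ℕ, ∫ ω, (∑ i ∈ Finset.range n, (Y i ω - ρ)) ^ 2 ∂μ ≤ C * n) :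
    ∀ᵐ ω ∂μ, Tendsto (fun n : ℕ => (∑ i ∈ Finset.range n, Y i ω) / n) atTop (𝓝 ρ) := by
  let d : ℕ → Ω → ℝ := fun n ω => (∑ i ∈ Finset.range n, (Y i ω - ρ)) ^ 2
  -- The shift by one keeps the times positive, so that divisions are harmless.
  let c : ℕ → ℕ := fun n => (n + 1) ^ 2
  have hd : ∀ n, Measurable (d n) := fun n =>
    (Finset.measurable_sum _ fun i _ => (hY i).sub_const ρ).pow_const 2
  have hsum : ∑' n, ∫⁻ ω, ENNReal.ofReal (d (c n) ω / (c n : ℝ) ^ 2) ∂μ ≠ ⊤ := by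
    have hs : Summable fun n : ℕ => C * (1 / ((n + 1 : ℕ) : ℝ) ^ 2) :=
      ((summable_nat_add_iff 1).2 (Real.summable_one_div_nat_pow.2 one_lt_two)).mul_left C
    refine ne_top_of_le_ne_top hs.tsum_ofReal_ne_top (ENNReal.tsum_le_tsum fun n => ?_)
    rw [← ofReal_integral_eq_lintegral_ofReal ((hint _).div_const _)
      (Eventually.of_forall fun ω => by positivity)]
    refine ENNReal.ofReal_le_ofReal ?_
    rw [integral_div]
    have hc : (0 : ℝ) < c n := by simp only [c]; positivity
    calc _ ≤ C * c n / (c n : ℝ) ^ 2 := by gcongr; exact hvar _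
      _ = _ := by
        simp only [c]; push_cast
        field_simp
  rw [← lintegral_tsum fun n => (((hd _).div_const _).ennreal_ofReal).aemeasurable] at hsum
  have hae := ae_lt_top' (AEMeasurable.tsum fun n =>
    (((hd _).div_const _).ennreal_ofReal).aemeasurable) hsum
  filter_upwards [hae] with ω hω
  have ht := ENNReal.tendsto_atTop_zero_of_tsum_ne_top hω.ne
  have ht2 : Tendsto (fun n => d (c n) ω / (c n : ℝ) ^ 2) atTop (𝓝 0) := by
    have := (ENNReal.tendsto_toReal ENNReal.zero_ne_top).comp ht
    refine this.congr fun n => ?_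
    simp only [Function.comp_apply]
    rw [ENNReal.toReal_ofReal]
    simp only [d]; positivity
  have ht3 : Tendsto (fun n => (∑ i ∈ Finset.range (c n), (Y i ω - ρ)) / (c n : ℝ)) atTop
      (𝓝 0) := by
    rw [tendsto_zero_iff_abs_tendsto_zero]
    have := ht2.sqrt
    rw [Real.sqrt_zero] at this
    refine this.congr fun n => ?_
    simp only [d, Function.comp_apply]
    rw [← div_pow, Real.sqrt_sq_eq_abs]
  have ht4 : Tendsto (fun n => (∑ i ∈ Finset.range (c n), Y i ω) / (c n : ℝ)) atTop (𝓝 ρ) := by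
    have := ht3.add_const ρ
    rw [zero_add] at this
    refine this.congr fun n => ?_
    have hc : (0 : ℝ) < c n := by simp only [c]; positivity
    rw [Finset.sum_sub_distrib]
    simp only [Finset.sum_const, Finset.card_range, nsmul_eq_mul]
    field_simp
    ring
  -- Interpolation requires consecutive times of the subsequence to have ratio tending to `1`.
  refine tendsto_div_of_monotone_of_exists_subseq_tendsto_div
    (fun n => ∑ i ∈ Finset.range n, Y i ω) ρ (fun m n hmn =>
      Finset.sum_le_sum_of_subset_of_nonneg (Finset.range_mono hmn) fun i _ _ => h0 i ω)
    fun a ha => ⟨c, ?_, ?_, ht4⟩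
  · have h1 : Tendsto (fun n : ℕ => (1 + 1 / ((n : ℝ) + 1)) ^ 2) atTop (𝓝 ((1 + 0) ^ 2)) :=
      (tendsto_const_nhds.add tendsto_one_div_add_atTop_nhds_zero_nat).pow 2
    rw [add_zero, one_pow] at h1
    filter_upwards [h1.eventually_lt_const ha] with n hn
    simp only [c]
    push_cast
    have : ((n : ℝ) + 1 + 1) ^ 2 = (1 + 1 / ((n : ℝ) + 1)) ^ 2 * ((n : ℝ) + 1) ^ 2 := by
      field_simp
    rw [this]
    gcongr
  · exact (tendsto_pow_atTop two_ne_zero).comp (tendsto_add_atTop_nat 1)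

theorem path_unique {ω : Config} {S : ℤ → ℤ} (h0 : S 0 = 0)
    (h : ∀ n, S n - S (n - 1) = 1 - 2 * ((ω n : ℕ) : ℤ)) : S = path ω := by
  ext n
  induction n with
  | zero => rw [h0, path_zero]
  | succ n ih =>
    have h1 := h (n + 1)
    have h2 := path_sub_path ω (n + 1)
    rw [add_sub_cancel_right] at h1 h2
    linarith
  | pred n ih =>
    have h1 := h (-n)
    have h2 := path_sub_path ω (-n)
    linarith

/-- Reversing sites by `n ↦ 1 - n` reflects the path through the origin, so behaviour at `-∞` is
read from the reversed configuration at `+∞`. -/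
theorem path_rev (ω : Config) (n : ℤ) : path (rev 1 ω) n = - path ω (-n) := by
  refine (congrFun (path_unique (S := fun n => - path ω (-n)) (by simp [path_zero])
    fun n => ?_) n).symm
  have := path_sub_path ω (1 - n)
  simp only [rev]
  rw [show 1 - n - 1 = -n by ring] at this
  rw [show -(n - 1) = 1 - n by ring]
  linarith

theorem path_natCast (ω : Config) (n : ℕ) :
    path ω n = n - 2 * ∑ i ∈ Finset.range n, ((ω (i + 1) : ℕ) : ℤ) := by
  induction n with
  | zero => simp [path_zero]
  | succ n ih =>
    have := path_sub_path ω (n + 1)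
    rw [add_sub_cancel_right, ih] at this
    push_cast
    rw [Finset.sum_range_succ]
    linarith

/-- A path with a positive speed in both directions is sub-critical. -/
theorem isGood_and_subcritical_of_speed {ω : Config} {v : ℝ} (hv : 0 < v)
    (h1 : Tendsto (fun n : ℕ => (path ω n : ℝ) / n) atTop (𝓝 v))
    (h2 : Tendsto (fun n : ℕ => (path (rev 1 ω) n : ℝ) / n) atTop (𝓝 v)) :
    IsGood ω ∧ path ω ∈ subcritical := by
  have hF : StrictMono fun n : ℤ => v * (n : ℝ) := fun m n hmn => by
    have : (m : ℝ) < n := by exact_mod_cast hmn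
    exact mul_lt_mul_of_pos_left this hv
  have hdiv : ∀ {f : ℕ → ℝ}, Tendsto (fun n : ℕ => f n / n) atTop (𝓝 v) →
      Tendsto (fun n : ℕ => f n / (v * n)) atTop (𝓝 1) := by
    intro f hf
    have := hf.div_const v
    rw [div_self hv.ne'] at this
    refine this.congr fun n => ?_
    rw [div_div, mul_comm v]
  refine ⟨?_, ⟨path_mem ω, _, hF, ?_, ?_⟩, path_mem ω, _, hF, ?_, ?_⟩
  · have h3 := h2.eventually (lt_mem_nhds hv)
    obtain ⟨N, hN⟩ := eventually_atTop.1 h3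
    have hsub : path ω '' Set.Iic 0 ⊆ Set.Iic 0 ∪ path ω '' Set.Icc (-N) 0 := by
      rintro _ ⟨m, hm, rfl⟩
      have hm : m ≤ 0 := hm
      rcases le_or_gt (-(N : ℤ)) m with h | h
      · exact Or.inr ⟨m, ⟨h, hm⟩, rfl⟩
      · left
        have h4 := hN (-m).toNat (by omega)
        rw [path_rev, show (-(((-m).toNat : ℕ) : ℤ)) = m by omega] at h4
        by_contra h5
        have h5 : 0 < path ω m := by simpa using h5
        have h6 : (((-path ω m : ℤ)) : ℝ) / ((-m).toNat : ℝ) ≤ 0 := by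
          apply div_nonpos_of_nonpos_of_nonneg
          · have : (0 : ℝ) < path ω m := by exact_mod_cast h5
            push_cast
            linarith
          · positivity
        linarith
    exact (bddAbove_Iic.union ((Set.finite_Icc _ _).image _).bddAbove).mono hsub
  · exact Tendsto.const_mul_atBot hv (tendsto_intCast_atBot_iff.2 tendsto_id)
  · have h3 : Tendsto (fun n : ℤ => (-n).toNat) atBot atTop :=
      tendsto_atTop.2 fun b => (eventually_le_atBot (-(b : ℤ))).mono fun n hn => by omega
    refine ((hdiv h2).comp h3).congr' ?_
    filter_upwards [eventually_le_atBot (0 : ℤ)] with n hn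
    have : (((-n).toNat : ℕ) : ℤ) = -n := by omega
    simp only [Function.comp_apply]
    rw [path_rev, this, neg_neg]
    have e : (((-n).toNat : ℕ) : ℝ) = -(n : ℝ) := by exact_mod_cast congrArg (Int.cast (R := ℝ)) this
    rw [e]
    push_cast
    rw [mul_neg, neg_div_neg_eq]
  · exact Tendsto.const_mul_atTop hv tendsto_intCast_atTop_atTop
  · have h3 : Tendsto (fun n : ℤ => n.toNat) atTop atTop :=
      tendsto_atTop.2 fun b => (eventually_ge_atTop (b : ℤ)).mono fun n hn => by omega
    refine ((hdiv h1).comp h3).congr' ?_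
    filter_upwards [eventually_ge_atTop (0 : ℤ)] with n hn
    have : ((n.toNat : ℕ) : ℤ) = n := by omega
    have e : ((n.toNat : ℕ) : ℝ) = (n : ℝ) := by exact_mod_cast congrArg (Int.cast (R := ℝ)) this
    simp only [Function.comp_apply]
    rw [this, e]

/-! ### Variance of additive functionals and density of Markov configurations -/

theorem sum_measureReal_inter_fiber {Ω β : Type*} [MeasurableSpace Ω] [Fintype β]
    [MeasurableSpace β] [MeasurableSingletonClass β] {μ : Measure Ω} [IsFiniteMeasure μ]
    {f : Ω → β} (hf : Measurable f) {s : Set Ω} (hs : MeasurableSet s) :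
    ∑ b, μ.real (s ∩ {ω | f ω = b}) = μ.real s := by
  have hU : s = ⋃ b ∈ (Finset.univ : Finset β), (s ∩ {ω | f ω = b}) := by
    ext ω; simp
  conv_rhs => rw [hU]
  refine (measureReal_biUnion_finset (fun a _ b _ hab => ?_) fun b _ =>
    hs.inter (hf (measurableSet_singleton b))).symm
  exact Set.disjoint_left.2 fun ω h1 h2 => hab (h1.2.symm.trans h2.2)

theorem IsMarkovLaw.measureReal_inter_succ {α : Type*} [MeasurableSpace α] [Fintype α]
    [MeasurableSingletonClass α] [Nonempty α] {μ : Measure (ℤ → α)} [IsFiniteMeasure μ]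
    {Q : Matrix α α ℝ} (h : IsMarkovLaw μ Q) (hQ : ∀ a b, 0 ≤ Q a b) {m : ℤ} {A : Set (ℤ → α)}
    (hA : IsPast m A) (b : α) :
    μ.real (A ∩ {ω | ω (m + 1) = b}) = ∑ c, μ.real (A ∩ {ω | ω m = c}) * Q c b := by
  rw [← sum_measureReal_inter_fiber (measurable_pi_apply m)
    (hA.1.inter (measurableSet_coord (m + 1) b))]
  refine Finset.sum_congr rfl fun c _ => ?_
  rw [← markov_past hQ h.step hA c b, Set.inter_right_comm]

theorem integral_comp_coord {α : Type*} [MeasurableSpace α] [Fintype α]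
    [MeasurableSingletonClass α] {μ : Measure (ℤ → α)} [IsFiniteMeasure μ] (y : α → ℝ)
    (i j : ℤ) :
    ∫ ω, y (ω i) * y (ω j) ∂μ = ∑ a, ∑ b, μ.real ({ω | ω i = a} ∩ {ω | ω j = b}) * (y a * y b) := by
  have hm : Measurable fun ω : ℤ → α => (ω i, ω j) :=
    (measurable_pi_apply i).prodMk (measurable_pi_apply j)
  have h1 : ∫ ω, y (ω i) * y (ω j) ∂μ =
      ∫ q, y q.1 * y q.2 ∂(μ.map fun ω => (ω i, ω j)) := by
    rw [integral_map hm.aemeasurable (measurable_of_countable _).aestronglyMeasurable]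
  rw [h1, integral_fintype .of_finite, Fintype.sum_prod_type]
  refine Finset.sum_congr rfl fun a _ => Finset.sum_congr rfl fun b _ => ?_
  rw [map_measureReal_apply hm (measurableSet_singleton _), smul_eq_mul]
  congr 2
  ext ω
  simp [Prod.ext_iff]

/-- Linear growth of the variance of additive functionals `∑ y (ω i)` with `Q y = θ y`. -/
theorem IsMarkovLaw.integral_sum_sq_le {α : Type*} [MeasurableSpace α] [Fintype α]
    [MeasurableSingletonClass α] [Nonempty α] {μ : Measure (ℤ → α)} [IsProbabilityMeasure μ]
    {Q : Matrix α α ℝ} (h : IsMarkovLaw μ Q) (hQ : ∀ a b, 0 ≤ Q a b) {y : α → ℝ} {θ : ℝ}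
    (hθ : |θ| < 1) (hy : ∀ a, |y a| ≤ 1) (hQy : ∀ c, ∑ b, Q c b * y b = θ * y c) :
    (∀ n, Integrable (fun ω : ℤ → α => (∑ i ∈ Finset.range n, y (ω (i + 1))) ^ 2) μ) ∧
    ∀ n : ℕ, ∫ ω, (∑ i ∈ Finset.range n, y (ω (i + 1))) ^ 2 ∂μ ≤ (2 * (1 / (1 - |θ|)) + 1) * n := by
  have hym : ∀ i : ℤ, Measurable fun ω : ℤ → α => y (ω i) := fun i =>
    (measurable_of_countable y).comp (measurable_pi_apply i)
  have hI : ∀ i j : ℤ, Integrable (fun ω : ℤ → α => y (ω i) * y (ω j)) μ := fun i j => by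
    refine Integrable.of_bound ((hym i).mul (hym j)).aestronglyMeasurable 1
      (Eventually.of_forall fun ω => ?_)
    rw [Real.norm_eq_abs, abs_mul]
    exact mul_le_one₀ (hy _) (abs_nonneg _) (hy _)
  let G : ℤ → ℤ → ℝ := fun i j => ∫ ω, y (ω i) * y (ω j) ∂μ
  have hG1 : ∀ i j, |G i j| ≤ 1 := fun i j => by
    have := norm_integral_le_of_norm_le_const (μ := μ) (f := fun ω : ℤ → α => y (ω i) * y (ω j))
      (C := 1) (Eventually.of_forall fun ω => by
        rw [Real.norm_eq_abs, abs_mul]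
        exact mul_le_one₀ (hy _) (abs_nonneg _) (hy _))
    simpa using this
  -- By the Markov property and `Q y = θ y`, moving the later time by one multiplies the correlation
  -- by `θ`.
  have hG : ∀ i n, i ≤ n → G i (n + 1) = θ * G i n := by
    intro i n hin
    simp only [G]
    rw [integral_comp_coord, integral_comp_coord, Finset.mul_sum]
    refine Finset.sum_congr rfl fun a _ => ?_
    have hA : IsPast n {ω : ℤ → α | ω i = a} := (IsPast.coord i a).mono hin
    simp only [h.measureReal_inter_succ hQ hA, Finset.sum_mul]
    rw [Finset.sum_comm, Finset.mul_sum]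
    refine Finset.sum_congr rfl fun c _ => ?_
    have : ∀ b, μ.real ({ω : ℤ → α | ω i = a} ∩ {ω | ω n = c}) * Q c b * (y a * y b) =
        μ.real ({ω : ℤ → α | ω i = a} ∩ {ω | ω n = c}) * y a * (Q c b * y b) := fun b => by ring
    simp only [this]
    rw [← Finset.mul_sum, hQy]
    ring
  -- The sums satisfy `c (n + 1) = θ * (c n + G)` with `|G| ≤ 1`, and the bound `1 / (1 - |θ|)` is
  -- preserved because `|θ| * (2 - |θ|) ≤ 1`.
  have hc : ∀ n : ℕ, |∑ i ∈ Finset.range n, G (i + 1) (n + 1)| ≤ 1 / (1 - |θ|) := by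
    have hpos : 0 < 1 - |θ| := by linarith
    intro n
    induction n with
    | zero => simpa using hθ.le
    | succ n ih =>
      have e : ∑ i ∈ Finset.range (n + 1), G (i + 1) ((n + 1 : ℕ) + 1) =
          θ * (∑ i ∈ Finset.range n, G (i + 1) (n + 1) + G (n + 1) (n + 1)) := by
        rw [← Finset.sum_range_succ (fun i : ℕ => G (i + 1) (n + 1)), Finset.mul_sum]
        refine Finset.sum_congr rfl fun i hi => ?_
        have : i < n + 1 := Finset.mem_range.1 hi
        push_cast
        exact hG _ _ (by omega)
      rw [e, abs_mul]
      calc |θ| * |∑ i ∈ Finset.range n, G (i + 1) (n + 1) + G (n + 1) (n + 1)|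
          ≤ |θ| * (1 / (1 - |θ|) + 1) := by
            gcongr
            exact (abs_add_le _ _).trans (add_le_add ih (hG1 _ _))
        _ ≤ 1 / (1 - |θ|) := by
            rw [le_div_iff₀ hpos]
            field_simp
            nlinarith [abs_nonneg θ]
  have hexp : ∀ (n : ℕ) (ω : ℤ → α), (∑ i ∈ Finset.range (n + 1), y (ω (i + 1))) ^ 2 =
      (∑ i ∈ Finset.range n, y (ω (i + 1))) ^ 2 +
        (2 * ∑ i ∈ Finset.range n, y (ω (i + 1)) * y (ω (n + 1)) +
          y (ω (n + 1)) * y (ω (n + 1))) := by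
    intro n ω
    rw [Finset.sum_range_succ, ← Finset.sum_mul]
    ring
  have hS : ∀ n : ℕ, Integrable (fun ω : ℤ → α =>
      ∑ i ∈ Finset.range n, y (ω (i + 1)) * y (ω (n + 1))) μ := fun n =>
    integrable_finsetSum _ fun i _ => hI _ _
  have hint : ∀ n, Integrable (fun ω : ℤ → α => (∑ i ∈ Finset.range n, y (ω (i + 1))) ^ 2) μ := by
    intro n
    induction n with
    | zero => simp
    | succ n ih =>
      simp only [hexp]
      exact ih.add (((hS n).const_mul 2).add (hI _ _))
  refine ⟨hint, fun n => ?_⟩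
  induction n with
  | zero => simp
  | succ n ih =>
    simp only [hexp]
    have hR : Integrable (fun ω : ℤ → α =>
        2 * ∑ i ∈ Finset.range n, y (ω (i + 1)) * y (ω (n + 1)) +
          y (ω (n + 1)) * y (ω (n + 1))) μ := ((hS n).const_mul 2).add (hI _ _)
    rw [integral_add (hint n) hR,
      integral_add ((hS n).const_mul 2) (hI _ _), integral_const_mul,
      integral_finsetSum _ fun i _ => hI _ _]
    have h1 := (le_abs_self _).trans (hc n)
    have h2 := (le_abs_self _).trans (hG1 (n + 1) (n + 1))
    simp only [G] at h1 h2
    push_cast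
    linarith

/-- The transition matrix of a Markov configuration. -/
def siteMatrix (p₀ p₁ : ℝ) : Matrix (Fin 2) (Fin 2) ℝ := !![1 - p₀, p₀; 1 - p₁, p₁]

theorem siteMatrix_nonneg {p₀ p₁ : ℝ} (h0 : 0 ≤ p₀) (h0' : p₀ ≤ 1) (h1 : 0 ≤ p₁) (h1' : p₁ ≤ 1) :
    ∀ a b, 0 ≤ siteMatrix p₀ p₁ a b := by
  intro a b
  fin_cases a <;> fin_cases b <;> simp [siteMatrix] <;> assumption

theorem IsMarkovLaw.map_rev_site {μ : Measure Config} [IsFiniteMeasure μ] {p₀ p₁ : ℝ}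
    (h : IsMarkovLaw μ (siteMatrix p₀ p₁)) (c : ℤ) : μ.map (rev c) = μ :=
  h.map_rev (fun a => (a : ℕ)) Fin.val_injective (fun u v _ => by omega) c

/-- The density of particles converges almost surely to the stationary value `ρ`, giving the speed
`1 - 2 * ρ > 0`; the other direction follows by reversibility. -/
theorem IsMarkovLaw.isGood_and_subcritical {μ : Measure Config} [IsProbabilityMeasure μ]
    {p₀ p₁ : ℝ} (h : IsMarkovLaw μ (siteMatrix p₀ p₁)) (h0 : 0 < p₀) (h0' : p₀ < 1) (h1 : 0 ≤ p₁)
    (h1' : p₁ < 1) (h01 : p₀ + p₁ < 1) : ∀ᵐ ω ∂μ, IsGood ω ∧ path ω ∈ subcritical := by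
  have hden : 0 < 1 + p₀ - p₁ := by linarith
  let ρ := p₀ / (1 + p₀ - p₁)
  have hρ : ρ * (1 + p₀ - p₁) = p₀ := div_mul_cancel₀ _ hden.ne'
  have hρ0 : 0 < ρ := div_pos h0 hden
  have hρ1 : ρ < 1 / 2 := by rw [div_lt_div_iff₀ hden two_pos]; linarith
  -- As `ρ` is the stationary density, the centred occupation is an eigenvector of the site matrix,
  -- with eigenvalue `p₁ - p₀` in `(-1, 1)`. The bound `ρ < 1 / 2` is equivalent to `p₀ + p₁ < 1`.
  let y : Fin 2 → ℝ := fun a => ((a : ℕ) : ℝ) - ρ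
  obtain ⟨hint, hvar⟩ := h.integral_sum_sq_le (siteMatrix_nonneg h0.le h0'.le h1 h1'.le) (y := y)
    (θ := p₁ - p₀) (by rw [abs_lt]; constructor <;> linarith)
    (by
      intro a
      fin_cases a
      · simp only [y]; rw [abs_le]; constructor <;> simp <;> linarith
      · simp only [y]; rw [abs_le]; constructor <;> simp <;> linarith)
    (by
      intro c
      fin_cases c <;> simp [siteMatrix, y] <;> linarith)
  have hlim := tendsto_sum_div_of_variance_le (μ := μ)
    (Y := fun (i : ℕ) (ω : Config) => ((ω (i + 1) : ℕ) : ℝ)) (ρ := ρ)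
    (fun i => (measurable_of_countable fun a : Fin 2 => ((a : ℕ) : ℝ)).comp
      (measurable_pi_apply ((i : ℤ) + 1))) (fun i ω => by positivity) hint hvar
  have hpath : ∀ᵐ ω ∂μ, Tendsto (fun n : ℕ => (path ω n : ℝ) / n) atTop (𝓝 (1 - 2 * ρ)) := by
    filter_upwards [hlim] with ω hω
    have h2 := (hω.const_mul 2).const_sub 1
    refine h2.congr' ?_
    filter_upwards [eventually_gt_atTop 0] with n hn
    have hn : (0 : ℝ) < n := by exact_mod_cast hn
    rw [path_natCast]
    push_cast
    field_simp
  have hpath' : ∀ᵐ ω ∂μ, Tendsto (fun n : ℕ => (path (rev 1 ω) n : ℝ) / n) atTop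
      (𝓝 (1 - 2 * ρ)) := by
    refine ae_of_ae_map (measurable_rev (α := Fin 2) 1).aemeasurable
      (p := fun ω : Config => Tendsto (fun n : ℕ => (path ω n : ℝ) / n) atTop
        (𝓝 (1 - 2 * ρ))) ?_
    rwa [h.map_rev_site 1]
  filter_upwards [hpath, hpath'] with ω h2 h3
  exact isGood_and_subcritical_of_speed (by linarith) h2 h3

/-! ### Reversibility of the carrier of a Markov configuration -/

theorem isPast_load_word (n : ℤ) (k : ℕ) (x : ℕ → ℕ) : IsPast (n + k) (load ⁻¹' word n k x) := by
  refine ⟨measurable_load (measurableSet_word n k x), fun ω ω' h hω i hi => ?_⟩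
  rw [← hω i hi]
  exact (load_congr fun j hj => h j (by omega)).symm

/-- Transition weights of the carrier given the last site `c` and the current load `v`. -/
def loadStep (Q : Matrix (Fin 2) (Fin 2) ℝ) (c : Fin 2) (v w : ℕ) : ℝ :=
  if w = v + 1 then Q c 1 else if w = v - 1 then Q c 0 else 0

/-- On an event that fixes the last site and the load, the next load is a function of the next site,
whose law is given by the Markov property for the whole past. Loads depend on the infinite past, so
words of finite length would not be enough. -/
theorem measureReal_inter_load_succ {μ : Measure Config} [IsFiniteMeasure μ]
    {Q : Matrix (Fin 2) (Fin 2) ℝ} (h : IsMarkovLaw μ Q) (hQ : ∀ a b, 0 ≤ Q a b)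
    (hgood : ∀ᵐ ω ∂μ, IsGood ω) {m : ℤ} {A : Set Config} (hA : IsPast m A) (c : Fin 2) (v w : ℕ)
    (hc : ∀ᵐ ω ∂μ, ω ∈ A → ω m = c) (hv : ∀ᵐ ω ∂μ, ω ∈ A → load ω m = v) :
    μ.real (A ∩ {ω | load ω (m + 1) = w}) = μ.real A * loadStep Q c v w := by
  have hAc : μ.real (A ∩ {ω | ω m = c}) = μ.real A := by
    refine measureReal_congr ?_
    filter_upwards [hc] with ω hω
    exact propext ⟨fun h => h.1, fun h => ⟨h, hω h⟩⟩
  -- Exactly one value `b` of the next site takes the load from `v` to `w`.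
  have key : ∀ b : Fin 2, (∀ e : Fin 2, w = carry v e ↔ e = b) →
      μ.real (A ∩ {ω | load ω (m + 1) = w}) = μ.real A * Q c b := by
    intro b hb
    rw [← hAc, ← markov_past hQ h.step hA c b]
    refine measureReal_congr ?_
    filter_upwards [hc, hv, hgood] with ω h1 h2 h3
    refine propext ⟨fun h4 => ⟨⟨h4.1, h1 h4.1⟩, ?_⟩, fun h4 => ⟨h4.1.1, ?_⟩⟩
    · have h5 : load ω (m + 1) = w := h4.2
      rw [load_step_succ h3, h2 h4.1] at h5
      exact (hb _).1 h5.symm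
    · change load ω (m + 1) = w
      rw [load_step_succ h3, h2 h4.1.1]
      exact ((hb _).2 h4.2).symm
  unfold loadStep
  split_ifs with h1 h2
  · refine key 1 fun e => ?_
    unfold carry
    split_ifs with he
    · exact ⟨fun _ => he, fun _ => h1⟩
    · exact ⟨fun h => by omega, fun h => absurd h he⟩
  · refine key 0 fun e => ?_
    unfold carry
    split_ifs with he
    · exact ⟨fun h => absurd h h1, fun h => by rw [he] at h; exact absurd h (by decide)⟩
    · exact ⟨fun _ => fin_two_ne_one.1 he, fun _ => h2⟩
  · rw [mul_zero]
    refine (measureReal_eq_zero_iff (measure_ne_top _ _)).2 (measure_eq_zero_iff_ae_notMem.2 ?_)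
    filter_upwards [hv, hgood] with ω h3 h4 h5
    have h6 : load ω (m + 1) = w := h5.2
    rw [load_step_succ h4, h3 h5.1] at h6
    unfold carry at h6
    split_ifs at h6 <;> omega

/-- The last site seen by a carrier moving from `u` to `v`. -/
def lastSite (u v : ℕ) : Fin 2 := if v = u + 1 then 1 else 0

theorem lastSite_load {ω : Config} (h : IsGood ω) (n : ℤ) :
    lastSite (load ω n) (load ω (n + 1)) = ω (n + 1) := by
  have := load_step_succ h n
  unfold carry at this
  unfold lastSite
  split_ifs at this with h1
  · rw [if_pos this, h1]
  · rw [if_neg (by omega), fin_two_ne_one.1 h1]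

/-- The carrier of a stationary Markov configuration is reversible. -/
theorem IsMarkovLaw.map_rev_load {μ : Measure Config} [IsProbabilityMeasure μ]
    {Q : Matrix (Fin 2) (Fin 2) ℝ} (h : IsMarkovLaw μ Q) (hQ : ∀ a b, 0 ≤ Q a b)
    (hQ1 : Q 0 0 + Q 0 1 = 1) (hgood : ∀ᵐ ω ∂μ, IsGood ω) (c : ℤ) :
    (μ.map load).map (rev c) = μ.map load := by
  have hprob : IsProbabilityMeasure (μ.map load) :=
    Measure.isProbabilityMeasure_map measurable_load.aemeasurable
  have hshift : IsShiftInvariant (μ.map load) := h.shift.map_map measurable_load load_shift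
  -- The last step `u → v` of the carrier reveals the last site, so the pair `(u, v)` determines the
  -- law of the next load: second-order dependence.
  let q : ℕ → ℕ → ℕ → ℝ := fun u v w => loadStep Q (lastSite u v) v w
  have hreal : ∀ n k x, (μ.map load).real (word n k x) = μ.real (load ⁻¹' word n k x) :=
    fun n k x => map_measureReal_apply measurable_load (measurableSet_word n k x)
  have hrec : ∀ k x, (μ.map load).real (word 0 (k + 2) x) =
      (μ.map load).real (word 0 (k + 1) x) * q (x k) (x (k + 1)) (x (k + 2)) := by
    intro k x
    rw [hreal, hreal, word_succ]
    refine measureReal_inter_load_succ h hQ hgood (isPast_load_word 0 (k + 1) x) _ _ _ ?_ ?_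
    · filter_upwards [hgood] with ω hω hx
      have h1 := hx k (by omega)
      have h2 := hx (k + 1) le_rfl
      rw [← h1, ← h2]
      have := lastSite_load hω (0 + k)
      rw [show (0 : ℤ) + k + 1 = 0 + ((k + 1 : ℕ) : ℤ) by push_cast; ring] at this
      exact this.symm
    · exact Eventually.of_forall fun ω hx => hx (k + 1) le_rfl
  let a : ℕ → ℕ → ℝ := fun u v => μ.real {ω | load ω 0 = u ∧ load ω 1 = v}
  have hlm : ∀ n, Measurable fun ω : Config => load ω n := fun n =>
    (measurable_pi_apply n).comp measurable_load
  have ha : ∀ x, (μ.map load).real (word 0 1 x) = a (x 0) (x 1) := by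
    intro x
    rw [hreal, word_one, zero_add]
    rfl
  have hstep : ∀ᵐ ω ∂μ, load ω 1 = load ω 0 + 1 ∨ load ω 1 = load ω 0 - 1 := by
    filter_upwards [hgood] with ω hω
    have := load_step_succ hω 0
    rw [zero_add] at this
    unfold carry at this
    split_ifs at this
    · exact Or.inl this
    · exact Or.inr this
  have hflux : ∀ x, a x (x + 1) = a (x + 1) x := by
    refine flux_balance (hlm 0) (hlm 1) ?_ (hstep.mono fun _ h => by omega)
      (hstep.mono fun _ h => by omega)
    have := hshift.map_coord 0 1
    rwa [Measure.map_map (measurable_pi_apply 0) measurable_load,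
      Measure.map_map (measurable_pi_apply 1) measurable_load] at this
  have ha0 : ∀ u v, v ≠ u + 1 → v ≠ u - 1 → a u v = 0 := by
    intro u v h1 h2
    refine (measureReal_eq_zero_iff (measure_ne_top _ _)).2 (measure_eq_zero_iff_ae_notMem.2 ?_)
    filter_upwards [hstep] with ω h3 h4
    obtain ⟨h5, h6⟩ : load ω 0 = u ∧ load ω 1 = v := h4
    omega
  have hsymm : ∀ u v, a u v = a v u := by
    intro u v
    rcases eq_or_ne v (u + 1) with rfl | h1
    · exact hflux u
    rcases eq_or_ne u (v + 1) with rfl | h2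
    · exact (hflux v).symm
    rcases eq_or_ne u v with rfl | h3
    · rfl
    rw [ha0 u v h1 (by omega), ha0 v u h2 (by omega)]
  have h3 : ∀ u v w, μ.real {ω | load ω 0 = u ∧ load ω 1 = v ∧ load ω 2 = w} =
      a u v * q u v w := by
    intro u v w
    have := hrec 0 (fun i => if i = 0 then u else if i = 1 then v else w)
    rw [zero_add, zero_add, ha, hreal] at this
    simp only [if_true, one_ne_zero, if_false, OfNat.ofNat_ne_zero, OfNat.ofNat_ne_one] at this
    rw [← this]
    congr 1
    ext ω
    simp only [word, Set.mem_ofPred_eq, Set.mem_preimage]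
    constructor
    · rintro ⟨e0, e1, e2⟩ i hi
      interval_cases i <;> simp [e0, e1, e2]
    · intro hi
      exact ⟨by simpa using hi 0 (by omega), by simpa using hi 1 (by omega),
        by simpa using hi 2 (by omega)⟩
  -- The edge `v → v + 1` is shifted one step later and split according to the preceding load. For
  -- `v = 0` the truncated `v - 1` denotes a rest at `0`.
  have hbalance : ∀ v, a v (v + 1) =
      a (v + 1) v * q (v + 1) v (v + 1) + a (v - 1) v * q (v - 1) v (v + 1) := by
    intro v
    have e1 : a v (v + 1) = μ.real {ω | load ω 1 = v ∧ load ω 2 = v + 1} := by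
      have := h.shift.measureReal_preimage 1
        (A := {ω | load ω 0 = v ∧ load ω 1 = v + 1})
        ((hlm 0 (measurableSet_singleton v)).inter (hlm 1 (measurableSet_singleton (v + 1))))
      simp only [a, ← this]
      congr 1
      ext ω
      simp only [Set.mem_ofPred_eq, load_shift]
      norm_num
    rw [e1, ← h3, ← h3, ← measureReal_union]
    · refine measureReal_congr ?_
      filter_upwards [hstep] with ω hω
      apply propext
      change (load ω 1 = v ∧ load ω 2 = v + 1) ↔
        ((load ω 0 = v + 1 ∧ load ω 1 = v ∧ load ω 2 = v + 1) ∨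
          (load ω 0 = v - 1 ∧ load ω 1 = v ∧ load ω 2 = v + 1))
      omega
    · refine Set.disjoint_left.2 fun ω h1 h2 => ?_
      have h1 : load ω 0 = v + 1 := h1.1
      have h2 : load ω 0 = v - 1 := h2.1
      omega
    · exact (hlm 0 (measurableSet_singleton _)).inter ((hlm 1 (measurableSet_singleton _)).inter
        (hlm 2 (measurableSet_singleton _)))
  -- After a descent from `v + 1` to `v` the last site is empty, so the walk turns back with weight
  -- `Q 0 1` and continues down with weight `1 - Q 0 1`. Subtracting the turning part from the
  -- balance of edges leaves the equality of straight passages up and down through `v`.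
  have hcross : ∀ v, a (v - 1) v * q (v - 1) v (v + 1) = a (v + 1) v * q (v + 1) v (v - 1) := by
    intro v
    have h1 := hbalance v
    rw [hflux v] at h1
    have el : lastSite (v + 1) v = 0 := if_neg (by omega)
    have e1 : q (v + 1) v (v + 1) = Q 0 1 := by
      change loadStep Q (lastSite (v + 1) v) v (v + 1) = Q 0 1
      rw [el]
      exact if_pos rfl
    have e2 : q (v + 1) v (v - 1) = Q 0 0 := by
      change loadStep Q (lastSite (v + 1) v) v (v - 1) = Q 0 0
      rw [el]
      exact (if_neg (by omega)).trans (if_pos rfl)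
    rw [e1] at h1
    rw [e2]
    have e3 : Q 0 0 = 1 - Q 0 1 := by linarith
    rw [e3]
    linarith
  have hq0 : ∀ u v w, w ≠ v + 1 → w ≠ v - 1 → q u v w = 0 := by
    intro u v w h1 h2
    simp only [q, loadStep]
    rw [if_neg h1, if_neg h2]
  refine map_rev_eq_of_balance hshift.word q a hrec ha hsymm (fun u v w => ?_) c
  by_cases hu : u = v + 1 ∨ u = v - 1
  · by_cases hw : w = v + 1 ∨ w = v - 1
    · rcases hu with rfl | rfl <;> rcases hw with rfl | rfl
      · rfl
      · exact (hcross v).symm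
      · exact hcross v
      · rfl
    · rw [hq0 u v w (by omega) (by omega), ha0 w v (by omega) (by omega), mul_zero, zero_mul]
  · rw [hq0 w v u (by omega) (by omega), ha0 u v (by omega) (by omega), mul_zero, zero_mul]

/-! ### Markov and independent configurations -/

/-- Canonical form of the conclusion of the invariance theorems. -/
theorem isSubcriticalInvariant_of_map {Ω : Type*} [MeasurableSpace Ω] {P : Measure Ω}
    {η : Ω → Config} (hη : Measurable η) (hg : ∀ᵐ ω ∂(P.map η), IsGood ω ∧ path ω ∈ subcritical)
    (hinv : IdentDistrib boxBall id (P.map η) (P.map η)) : IsSubcriticalInvariant P η := by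
  have h1 := ae_of_ae_map hη.aemeasurable hg
  refine ⟨h1.mono fun _ h => h.2, h1.mono fun _ h => mem_dynamicsDomain h.1, ?_⟩
  refine ⟨hinv.aemeasurable_fst.comp_measurable hη, hη.aemeasurable, ?_⟩
  have h2 := hinv.map_eq
  rw [Measure.map_id, AEMeasurable.map_map_of_aemeasurable hinv.aemeasurable_fst
    hη.aemeasurable] at h2
  exact h2

theorem measurable_of_coord {Ω α : Type*} [MeasurableSpace Ω] [MeasurableSpace α]
    {X : Ω → ℤ → α} (h : ∀ n, Measurable fun ω => X ω n) : Measurable X :=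
  measurable_pi_lambda _ h

theorem IsStationaryMarkovChain.isMarkovLaw {Ω α : Type*} [MeasurableSpace Ω] [MeasurableSpace α]
    [MeasurableSingletonClass α] {P : Measure Ω} {X : Ω → ℤ → α} {Q : Matrix α α ℝ}
    (h : IsStationaryMarkovChain P X Q) : IsMarkovLaw (P.map X) Q := by
  have hX := measurable_of_coord h.1
  refine ⟨fun k => ?_, fun n k x => ?_⟩
  · rw [Measure.map_map (measurable_shift k) hX]
    exact (h.2.1 k).map_eq
  · rw [map_measureReal_apply hX (measurableSet_word _ _ _),
      map_measureReal_apply hX (measurableSet_word _ _ _)]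
    exact h.2.2 n k x

theorem IsMarkovLaw.isStationaryMarkovChain {Ω α : Type*} [MeasurableSpace Ω] [MeasurableSpace α]
    [MeasurableSingletonClass α] {P : Measure Ω} {X : Ω → ℤ → α} {Q : Matrix α α ℝ}
    (hX : Measurable X) (h : IsMarkovLaw (P.map X) Q) : IsStationaryMarkovChain P X Q := by
  refine ⟨fun n => (measurable_pi_apply n).comp hX, fun k => ?_, fun n k x => ?_⟩
  · refine ⟨((measurable_shift k).comp hX).aemeasurable, hX.aemeasurable, ?_⟩
    have := h.shift k
    rwa [Measure.map_map (measurable_shift k) hX] at this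
  · have := h.step n k x
    rwa [map_measureReal_apply hX (measurableSet_word _ _ _),
      map_measureReal_apply hX (measurableSet_word _ _ _)] at this

/-- Stationary Markov configurations with density below one half are invariant. -/
theorem isSubcriticalInvariant_markov {Ω : Type*} [MeasurableSpace Ω] {P : Measure Ω}
    [IsProbabilityMeasure P] {η : Ω → Config} (hη : Measurable η) {p₀ p₁ : ℝ}
    (h : IsMarkovLaw (P.map η) (siteMatrix p₀ p₁)) (h0 : 0 < p₀) (h0' : p₀ < 1) (h1 : 0 ≤ p₁)
    (h1' : p₁ < 1) (h01 : p₀ + p₁ < 1) : IsSubcriticalInvariant P η := by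
  have hprob : IsProbabilityMeasure (P.map η) := Measure.isProbabilityMeasure_map hη.aemeasurable
  have hg := h.isGood_and_subcritical h0 h0' h1 h1' h01
  have hgood := hg.mono fun _ h => h.1
  exact isSubcriticalInvariant_of_map hη hg (identDistrib_boxBall hgood
    (h.map_rev_load (siteMatrix_nonneg h0.le h0'.le h1 h1'.le) (by simp [siteMatrix]) hgood 0)
    (h.map_rev_site 1))

theorem IsIIDBernoulli.measureReal_eq {Ω : Type*} [MeasurableSpace Ω] {P : Measure Ω}
    [IsProbabilityMeasure P] {η : Ω → Config} {p : ℝ} (h : IsIIDBernoulli P η p) (n : ℤ)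
    (a : Fin 2) : P.real {ω | η ω n = a} = if a = 1 then p else 1 - p := by
  by_cases ha : a = 1
  · rw [if_pos ha, ha, h.2.2 n]
  · rw [if_neg ha, fin_two_ne_one.1 ha]
    have e : {ω | η ω n = 0} = {ω | η ω n = 1}ᶜ := by
      ext ω
      simp only [Set.mem_ofPred_eq, Set.mem_compl_iff]
      exact fin_two_ne_one.symm
    have hm : MeasurableSet {ω | η ω n = 1} := h.1 n (measurableSet_singleton 1)
    rw [e, probReal_compl_eq_one_sub hm, h.2.2 n]

theorem IsIIDBernoulli.measureReal_word {Ω : Type*} [MeasurableSpace Ω] {P : Measure Ω}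
    [IsProbabilityMeasure P] {η : Ω → Config} {p : ℝ} (h : IsIIDBernoulli P η p) (n : ℤ) (k : ℕ)
    (x : ℕ → Fin 2) : (P.map η).real (word n k x) =
      ∏ i ∈ Finset.range (k + 1), if x i = 1 then p else 1 - p := by
  have hη := measurable_of_coord h.1
  rw [map_measureReal_apply hη (measurableSet_word n k x)]
  have hinj : Function.Injective fun i : ℕ => n + (i : ℤ) := fun i j hij => by
    simpa using hij
  have hind := (h.2.1.precomp hinj).measure_inter_preimage_eq_mul (Finset.range (k + 1))
    (sets := fun i => {x i}) (fun i _ => measurableSet_singleton _)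
  have e : η ⁻¹' word n k x =
      ⋂ i ∈ Finset.range (k + 1), (fun ω => η ω (n + (i : ℤ))) ⁻¹' {x i} := by
    ext ω
    simp only [word, Set.mem_preimage, Set.mem_ofPred_eq, Set.mem_iInter, Finset.mem_range,
      Nat.lt_succ_iff, Set.mem_singleton_iff]
  rw [e, measureReal_def, hind, ENNReal.toReal_prod]
  exact Finset.prod_congr rfl fun i _ => h.measureReal_eq (n + i) (x i)

theorem IsIIDBernoulli.isMarkovLaw {Ω : Type*} [MeasurableSpace Ω] {P : Measure Ω}
    [IsProbabilityMeasure P] {η : Ω → Config} {p : ℝ} (h : IsIIDBernoulli P η p) :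
    IsMarkovLaw (P.map η) (siteMatrix p p) := by
  have hη := measurable_of_coord h.1
  have hprob : IsProbabilityMeasure (P.map η) := Measure.isProbabilityMeasure_map hη.aemeasurable
  refine ⟨fun k => ?_, fun n k x => ?_⟩
  · have hfin : IsFiniteMeasure ((P.map η).map fun (ω : Config) n => ω (n + k)) := inferInstance
    refine measure_ext_word _ _ fun n j x => ?_
    rw [← ENNReal.toReal_eq_toReal_iff' (measure_ne_top _ _) (measure_ne_top _ _),
      Measure.map_apply (measurable_shift k) (measurableSet_word n j x)]
    change (P.map η).real _ = (P.map η).real _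
    have e : (fun (ω : Config) n => ω (n + k)) ⁻¹' word n j x = word (n + k) j x := by
      ext ω
      simp only [word, Set.mem_preimage, Set.mem_ofPred_eq]
      refine forall₂_congr fun i _ => ?_
      rw [show n + (i : ℤ) + k = n + k + i by ring]
    rw [e, h.measureReal_word, h.measureReal_word]
  · rw [h.measureReal_word, h.measureReal_word, Finset.prod_range_succ _ (k + 1)]
    congr 1
    generalize x k = a
    generalize x (k + 1) = b
    fin_cases a <;> fin_cases b <;> simp [siteMatrix]

/-- The Markov argument needs `p₀ > 0`, so independent sites with `p = 0` are treated through the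
empty configuration. -/
theorem isGood_and_subcritical_zero :
    IsGood (fun _ => 0) ∧ path (fun _ => 0) ∈ subcritical := by
  have hp : path (fun _ => 0) = fun n => n := (path_unique rfl fun n => by simp).symm
  have hl : Tendsto (fun n : ℕ => (path (fun _ => 0) n : ℝ) / n) atTop (𝓝 1) := by
    refine tendsto_const_nhds.congr' ?_
    filter_upwards [eventually_gt_atTop 0] with n hn
    rw [hp]
    have : (n : ℝ) ≠ 0 := by exact_mod_cast hn.ne'
    push_cast
    rw [div_self this]
  exact isGood_and_subcritical_of_speed one_pos hl hl

theorem boxBall_zero : boxBall (fun _ => 0) = fun _ => 0 := by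
  have hg := isGood_and_subcritical_zero.1
  have hl : load (fun _ => 0) = fun _ => 0 :=
    (isGood_and_load_eq (ω := fun _ => 0) (w := fun _ => 0) (fun n => by simp [carry])
      fun n => ⟨n, le_rfl, rfl⟩).2
  rw [boxBall_eq hg, hl]
  ext n
  simp [rev, decode]

/-- Independent Bernoulli configurations with density below one half are invariant. -/
theorem isSubcriticalInvariant_iid {Ω : Type*} [MeasurableSpace Ω] {P : Measure Ω}
    [IsProbabilityMeasure P] {η : Ω → Config} {p : ℝ} (h : IsIIDBernoulli P η p) (h0 : 0 ≤ p)
    (h1 : p < 1 / 2) : IsSubcriticalInvariant P η := by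
  have hη := measurable_of_coord h.1
  rcases h0.eq_or_lt with rfl | h0
  · have hae : ∀ᵐ ω ∂P, η ω = fun _ => 0 := by
      have : ∀ᵐ ω ∂P, ∀ n, η ω n = 0 := ae_all_iff.2 fun n => by
        have h2 := (measureReal_eq_zero_iff (measure_ne_top _ _)).1 (h.2.2 n)
        filter_upwards [measure_eq_zero_iff_ae_notMem.1 h2] with ω hω
        exact fin_two_ne_one.1 hω
      exact this.mono fun ω hω => funext hω
    refine ⟨hae.mono fun ω hω => ?_, hae.mono fun ω hω => ?_, ?_⟩
    · rw [hω]; exact isGood_and_subcritical_zero.2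
    · rw [hω]; exact mem_dynamicsDomain isGood_and_subcritical_zero.1
    · have : (fun ω => boxBall (η ω)) =ᵐ[P] η := hae.mono fun ω hω => by
        simp only [hω, boxBall_zero]
      exact ⟨hη.aemeasurable.congr this.symm, hη.aemeasurable, Measure.map_congr this⟩
  · exact isSubcriticalInvariant_markov hη h.isMarkovLaw h0 (by linarith) h0.le (by linarith)
      (by linarith)

/-! ### Convergence of powers of stochastic matrices -/

open Matrix in
theorem rowStochastic_mulVec_mem_Icc {ι : Type*} [Fintype ι] [DecidableEq ι] {Q : Matrix ι ι ℝ}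
    (hQ : Q ∈ rowStochastic ℝ ι) {f : ι → ℝ} {lo hi : ℝ} (hf : ∀ x, f x ∈ Set.Icc lo hi) (x : ι) :
    (Q *ᵥ f) x ∈ Set.Icc lo hi := by
  have hs := sum_row_of_mem_rowStochastic hQ x
  have h0 : ∀ y, 0 ≤ Q x y := fun y => hQ.1 x y
  simp only [mulVec, dotProduct]
  constructor
  · calc lo = ∑ y, Q x y * lo := by rw [← Finset.sum_mul, hs, one_mul]
      _ ≤ _ := Finset.sum_le_sum fun y _ => mul_le_mul_of_nonneg_left (hf y).1 (h0 y)
  · calc ∑ y, Q x y * f y ≤ ∑ y, Q x y * hi :=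
          Finset.sum_le_sum fun y _ => mul_le_mul_of_nonneg_left (hf y).2 (h0 y)
      _ = hi := by rw [← Finset.sum_mul, hs, one_mul]

open Matrix in
/-- A stochastic matrix with a column bounded below by `δ` contracts oscillations. -/
theorem rowStochastic_mulVec_contract {ι : Type*} [Fintype ι] [DecidableEq ι] {Q : Matrix ι ι ℝ}
    (hQ : Q ∈ rowStochastic ℝ ι) {δ : ℝ} {y₀ : ι} (hδ : ∀ x, δ ≤ Q x y₀) {f : ι → ℝ} {lo hi : ℝ}
    (hf : ∀ x, f x ∈ Set.Icc lo hi) :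
    ∃ lo' hi', hi' - lo' ≤ (1 - δ) * (hi - lo) ∧ ∀ x, (Q *ᵥ f) x ∈ Set.Icc lo' hi' := by
  -- Each row gives mass at least `δ` to `y₀`; only the remaining mass `1 - δ` can spread averages
  -- over `[lo, hi]`.
  refine ⟨δ * f y₀ + (1 - δ) * lo, δ * f y₀ + (1 - δ) * hi, by linarith, fun x => ?_⟩
  have hs := sum_row_of_mem_rowStochastic hQ x
  have h0 : ∀ y, 0 ≤ Q x y := fun y => hQ.1 x y
  simp only [mulVec, dotProduct]
  have e : ∀ c : ℝ, ∑ y, Q x y * (f y - c) = ∑ y, Q x y * f y - c := fun c => by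
    simp only [mul_sub, Finset.sum_sub_distrib]
    rw [← Finset.sum_mul, hs, one_mul]
  constructor
  · have h1 : Q x y₀ * (f y₀ - lo) ≤ ∑ y, Q x y * (f y - lo) :=
      Finset.single_le_sum (f := fun y => Q x y * (f y - lo))
        (fun y _ => mul_nonneg (h0 y) (sub_nonneg.2 (hf y).1)) (Finset.mem_univ y₀)
    have h2 : δ * (f y₀ - lo) ≤ Q x y₀ * (f y₀ - lo) :=
      mul_le_mul_of_nonneg_right (hδ x) (sub_nonneg.2 (hf y₀).1)
    rw [e] at h1
    linarith
  · have h1 : Q x y₀ * (hi - f y₀) ≤ ∑ y, Q x y * (hi - f y) :=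
      Finset.single_le_sum (f := fun y => Q x y * (hi - f y))
        (fun y _ => mul_nonneg (h0 y) (sub_nonneg.2 (hf y).2)) (Finset.mem_univ y₀)
    have h2 : δ * (hi - f y₀) ≤ Q x y₀ * (hi - f y₀) :=
      mul_le_mul_of_nonneg_right (hδ x) (sub_nonneg.2 (hf y₀).2)
    have h3 : ∑ y, Q x y * (hi - f y) = hi - ∑ y, Q x y * f y := by
      rw [← neg_sub, ← e hi, ← Finset.sum_neg_distrib]
      exact Finset.sum_congr rfl fun y _ => by ring
    rw [h3] at h1
    linarith

open Matrix in
/-- Powers of a stochastic matrix with an eventually positive column converge. -/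
theorem exists_tendsto_pow_mulVec {ι : Type*} [Fintype ι] [DecidableEq ι] {Q : Matrix ι ι ℝ}
    (hQ : Q ∈ rowStochastic ℝ ι) {k : ℕ} {y₀ : ι} (hk : ∀ x, 0 < (Q ^ k) x y₀) (f : ι → ℝ) :
    ∃ c, ∀ x, Tendsto (fun n => (Q ^ n *ᵥ f) x) atTop (𝓝 c) := by
  have hne : Nonempty ι := ⟨y₀⟩
  obtain ⟨x₁, hx₁⟩ := Finite.exists_min fun x => (Q ^ k) x y₀
  set δ := (Q ^ k) x₁ y₀ with hδ
  have hδ0 : 0 < δ := hk x₁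
  have hδ1 : δ ≤ 1 := le_one_of_mem_rowStochastic (pow_mem hQ k)
  obtain ⟨xm, hxm⟩ := Finite.exists_min f
  obtain ⟨xM, hxM⟩ := Finite.exists_max f
  -- Each block of `k` steps shrinks the oscillation by `1 - δ`, and further steps keep the values
  -- in the same interval.
  have hosc : ∀ j : ℕ, ∃ lo hi, hi - lo ≤ (1 - δ) ^ j * (f xM - f xm) ∧
      ∀ n, k * j ≤ n → ∀ x, (Q ^ n *ᵥ f) x ∈ Set.Icc lo hi := by
    intro j
    induction j with
    | zero =>
      exact ⟨f xm, f xM, by simp, fun n _ x =>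
        rowStochastic_mulVec_mem_Icc (pow_mem hQ n) (fun x => ⟨hxm x, hxM x⟩) x⟩
    | succ j ih =>
      obtain ⟨lo, hi, h1, h2⟩ := ih
      obtain ⟨lo', hi', h3, h4⟩ := rowStochastic_mulVec_contract (pow_mem hQ k) hx₁
        (h2 (k * j) le_rfl)
      refine ⟨lo', hi', h3.trans ?_, fun n hn x => ?_⟩
      · calc (1 - δ) * (hi - lo) ≤ (1 - δ) * ((1 - δ) ^ j * (f xM - f xm)) :=
              mul_le_mul_of_nonneg_left h1 (by linarith)
          _ = _ := by ring
      · obtain ⟨m, rfl⟩ := Nat.exists_eq_add_of_le hn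
        rw [show k * (j + 1) + m = m + (k + k * j) by ring, pow_add, pow_add, ← mulVec_mulVec,
          ← mulVec_mulVec]
        exact rowStochastic_mulVec_mem_Icc (pow_mem hQ m) h4 x
  have hsmall : ∀ ε > 0, ∃ N, ∀ m ≥ N, ∀ n ≥ N, ∀ x x',
      |(Q ^ m *ᵥ f) x - (Q ^ n *ᵥ f) x'| < ε := by
    intro ε hε
    have ht : Tendsto (fun j : ℕ => (1 - δ) ^ j * (f xM - f xm)) atTop (𝓝 0) := by
      have := (tendsto_pow_atTop_nhds_zero_of_lt_one (by linarith : 0 ≤ 1 - δ)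
        (by linarith)).mul_const (f xM - f xm)
      rwa [zero_mul] at this
    obtain ⟨j, hj⟩ := (ht.eventually (gt_mem_nhds hε)).exists
    obtain ⟨lo, hi, h1, h2⟩ := hosc j
    refine ⟨k * j, fun m hm n hn x x' => ?_⟩
    have h3 := h2 m hm x
    have h4 := h2 n hn x'
    rw [abs_lt]
    constructor <;> linarith [h3.1, h3.2, h4.1, h4.2]
  have hc : CauchySeq fun n => (Q ^ n *ᵥ f) y₀ := Metric.cauchySeq_iff.2 fun ε hε => by
    obtain ⟨N, hN⟩ := hsmall ε hε
    exact ⟨N, fun m hm n hn => hN m hm n hn y₀ y₀⟩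
  obtain ⟨c, hc⟩ := cauchySeq_tendsto_of_complete hc
  refine ⟨c, fun x => ?_⟩
  have hd : Tendsto (fun n => (Q ^ n *ᵥ f) x - (Q ^ n *ᵥ f) y₀) atTop (𝓝 0) :=
    Metric.tendsto_atTop.2 fun ε hε => by
      obtain ⟨N, hN⟩ := hsmall ε hε
      exact ⟨N, fun n hn => by simpa [Real.dist_eq] using hN n hn n hn x y₀⟩
  have := hd.add hc
  simpa using this

/-! ### The Perron pair of the restricted carrier matrix -/

/-- The solution of the eigenvector recursion of the carrier matrix for the eigenvalue `l`. -/
noncomputable def eigenSeq (p l : ℝ) : ℕ → ℝ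
  | 0 => 1
  | 1 => (l - (1 - p)) / p
  | n + 2 => (l * eigenSeq p l (n + 1) - (1 - p) * eigenSeq p l n) / p

theorem continuous_eigenSeq (p : ℝ) (n : ℕ) : Continuous fun l => eigenSeq p l n := by
  induction n using Nat.twoStepInduction with
  | zero => simp only [eigenSeq]; fun_prop
  | one => simp only [eigenSeq]; fun_prop
  | more n ih1 ih2 => simp only [eigenSeq]; fun_prop

theorem eigenSeq_one {p : ℝ} (hp : 0 < p) (n : ℕ) : eigenSeq p 1 n = 1 := by
  induction n using Nat.twoStepInduction with
  | zero => simp [eigenSeq]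
  | one => simp [eigenSeq, hp.ne']
  | more n ih1 ih2 => simp [eigenSeq, ih1, ih2, hp.ne']

/-- Rows `0` to `K - 1` of the eigenvector equation are the recursion, and row `K` asks the next
term to vanish. At eigenvalue `1` all terms equal `1`; lowering the eigenvalue to the first value
where some term up to `K + 1` fails to be positive gives the root, and that failure must be at `K +
1`. -/
theorem exists_eigenSeq_root {p : ℝ} (hp : 0 < p) (hp1 : p < 1) (K : ℕ) :
    ∃ l, 0 < l ∧ l < 1 ∧ (∀ n ≤ K, 0 < eigenSeq p l n) ∧ eigenSeq p l (K + 1) = 0 := by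
  let S : Set ℝ := ⋃ n ∈ Finset.range (K + 2), {l | l ≤ 1} ∩ {l | eigenSeq p l n ≤ 0}
  have hmem : ∀ l, l ∈ S ↔ l ≤ 1 ∧ ∃ n ≤ K + 1, eigenSeq p l n ≤ 0 := by
    intro l
    simp only [S, Set.mem_iUnion, Finset.mem_range, Set.mem_inter_iff, Set.mem_ofPred_eq,
      exists_prop]
    constructor
    · rintro ⟨n, h1, h2, h3⟩; exact ⟨h2, n, by omega, h3⟩
    · rintro ⟨h2, n, h1, h3⟩; exact ⟨n, by omega, h2, h3⟩
  have hclosed : IsClosed S := by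
    refine Set.Finite.isClosed_biUnion (Finset.finite_toSet _) fun n _ => ?_
    exact (isClosed_le continuous_id continuous_const).inter
      (isClosed_le (continuous_eigenSeq p n) continuous_const)
  have hbdd : BddAbove S := ⟨1, fun l hl => ((hmem l).1 hl).1⟩
  -- At the eigenvalue `1 - p` the term of index `1` vanishes, so the supremum is at least `1 - p >
  -- 0`.
  have hin : 1 - p ∈ S := (hmem _).2 ⟨by linarith, 1, by omega, by simp [eigenSeq]⟩
  set l := sSup S with hl
  have hlS : l ∈ S := hclosed.csSup_mem ⟨_, hin⟩ hbdd
  have hl0 : 0 < l := lt_of_lt_of_le (by linarith) (le_csSup hbdd hin)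
  obtain ⟨hl1, n, hn, hn0⟩ := (hmem l).1 hlS
  have hl1' : l < 1 := by
    refine lt_of_le_of_ne hl1 fun h => ?_
    rw [h, eigenSeq_one hp] at hn0
    linarith
  -- Between the supremum and `1` all these terms are positive, so by continuity they are
  -- nonnegative at the supremum.
  have hpos : ∀ m ≤ K + 1, 0 ≤ eigenSeq p l m := by
    intro m hm
    have ht : Tendsto (fun x => eigenSeq p x m) (𝓝[>] l) (𝓝 (eigenSeq p l m)) :=
      ((continuous_eigenSeq p m).tendsto l).mono_left nhdsWithin_le_nhds
    refine ge_of_tendsto ht ?_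
    filter_upwards [Ioo_mem_nhdsGT hl1'] with x hx
    by_contra hneg
    have := le_csSup hbdd ((hmem x).2 ⟨hx.2.le, m, hm, (not_le.1 hneg).le⟩)
    exact absurd hx.1 (not_lt.2 this)
  -- A zero at `m + 1` after a positive term would make the term of index `m + 2` negative.
  have hstep : ∀ m ≤ K, (∀ j ≤ m, 0 < eigenSeq p l j) → m < K → 0 < eigenSeq p l (m + 1) := by
    intro m hm h1 hmK
    refine lt_of_le_of_ne (hpos (m + 1) (by omega)) fun h0 => ?_
    have h2 := hpos (m + 2) (by omega)
    rw [eigenSeq, ← h0] at h2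
    have h3 := h1 m le_rfl
    have : (l * 0 - (1 - p) * eigenSeq p l m) / p < 0 := by
      apply div_neg_of_neg_of_pos _ hp
      have : 0 < (1 - p) * eigenSeq p l m := mul_pos (by linarith) h3
      linarith
    linarith
  have hall : ∀ m ≤ K, ∀ j ≤ m, 0 < eigenSeq p l j := by
    intro m
    induction m with
    | zero =>
      intro _ j hj
      obtain rfl : j = 0 := by omega
      simp [eigenSeq]
    | succ m ih =>
      intro hm j hj
      rcases Nat.lt_or_ge m j with h | h
      · obtain rfl : j = m + 1 := by omega
        exact hstep m (by omega) (ih (by omega)) (by omega)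
      · exact ih (by omega) j h
  refine ⟨l, hl0, hl1', hall K le_rfl, ?_⟩
  rcases Nat.lt_or_ge n (K + 1) with h | h
  · exact absurd hn0 (not_le.2 (hall K le_rfl n (by omega)))
  · obtain rfl : n = K + 1 := by omega
    exact le_antisymm hn0 (hpos _ le_rfl)

theorem sum_carrierMatrix_mul {p l : ℝ} (hp : 0 < p) {K : ℕ} (hK : eigenSeq p l (K + 1) = 0)
    {x : ℕ} (hx : x ≤ K) :
    ∑ y ∈ Finset.range (K + 1), carrierMatrix p x y * eigenSeq p l y = l * eigenSeq p l x := by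
  -- Adding the vanishing term `K + 1` makes row `K` look like every other row.
  have h1 : ∑ y ∈ Finset.range (K + 1), carrierMatrix p x y * eigenSeq p l y =
      ∑ y ∈ Finset.range (K + 2), carrierMatrix p x y * eigenSeq p l y := by
    rw [Finset.sum_range_succ _ (K + 1), hK, mul_zero, add_zero]
  rw [h1]
  rcases x with _ | x
  · have h2 : ∀ y ∈ Finset.range (K + 2), carrierMatrix p 0 y * eigenSeq p l y =
        (if y = 0 then (1 - p) * eigenSeq p l 0 else 0) +
          if y = 1 then p * eigenSeq p l 1 else 0 := by
      intro y _
      rcases y with _ | _ | y <;> simp [carrierMatrix]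
    rw [Finset.sum_congr rfl h2, Finset.sum_add_distrib, Finset.sum_ite_eq', Finset.sum_ite_eq',
      if_pos (by simp), if_pos (by simp)]
    simp only [eigenSeq]
    field_simp
    ring
  · have h2 : ∀ y ∈ Finset.range (K + 2), carrierMatrix p (x + 1) y * eigenSeq p l y =
        (if y = x then (1 - p) * eigenSeq p l x else 0) +
          if y = x + 2 then p * eigenSeq p l (x + 2) else 0 := by
      intro y _
      simp only [carrierMatrix, Matrix.of_apply]
      by_cases e1 : y = x + 2
      · subst e1; simp
      · by_cases e2 : y = x
        · subst e2
          rw [if_neg (by omega), if_pos rfl, if_pos rfl, if_neg e1, add_zero]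
        · rw [if_neg (by omega), if_neg (by omega), if_neg (by omega), if_neg e2, if_neg e1]
          ring
    rw [Finset.sum_congr rfl h2, Finset.sum_add_distrib, Finset.sum_ite_eq', Finset.sum_ite_eq',
      if_pos (by simp; omega), if_pos (by simp; omega)]
    rw [eigenSeq]
    field_simp
    ring

open Matrix in
theorem exists_positive_eigenvector {p : ℝ} (hp : 0 < p) (hp1 : p < 1) (K : ℕ) :
    ∃ (l : ℝ) (h : Fin (K + 1) → ℝ), 0 < l ∧ l < 1 ∧ (∀ x, 0 < h x) ∧
      restrictedCarrierMatrix p K *ᵥ h = l • h := by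
  obtain ⟨l, h0, h1, h2, h3⟩ := exists_eigenSeq_root hp hp1 K
  refine ⟨l, fun x => eigenSeq p l x, h0, h1, fun x => h2 x (by omega), ?_⟩
  ext x
  have := sum_carrierMatrix_mul hp h3 (x := x) (by omega)
  rw [Finset.sum_range] at this
  simpa [mulVec, dotProduct, restrictedCarrierMatrix] using this

theorem carrierMatrix_nonneg {p : ℝ} (hp : 0 < p) (hp1 : p < 1) (x y : ℕ) :
    0 ≤ carrierMatrix p x y := by
  simp only [carrierMatrix, Matrix.of_apply]
  split_ifs <;> linarith

theorem carrierMatrix_ne_zero {p : ℝ} {x y : ℕ} (h : carrierMatrix p x y ≠ 0) :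
    x ≤ y + 1 ∧ y ≤ x + 1 := by
  simp only [carrierMatrix, Matrix.of_apply] at h
  split_ifs at h <;> first | omega | exact absurd rfl h

theorem carrierMatrix_down {p : ℝ} (x : ℕ) : carrierMatrix p x (x - 1) = 1 - p := by
  simp only [carrierMatrix, Matrix.of_apply]
  rw [if_neg (by omega)]
  rcases x with _ | x <;> simp

theorem carrierMatrix_up {p : ℝ} (x : ℕ) : carrierMatrix p x (x + 1) = p := by
  simp [carrierMatrix]

/-- A positive eigenvector of the restricted carrier matrix. -/
structure PositiveEigenpair (p : ℝ) (K : ℕ) (l : ℝ) (h : Fin (K + 1) → ℝ) : Prop where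
  p_pos : 0 < p
  p_lt_one : p < 1
  pos : 0 < l
  vec_pos : ∀ x, 0 < h x
  eq : (restrictedCarrierMatrix p K).mulVec h = l • h

namespace PositiveEigenpair

variable {p : ℝ} {K : ℕ} {l : ℝ} {h : Fin (K + 1) → ℝ}

open Matrix in
theorem doob_mem_rowStochastic (H : PositiveEigenpair p K l h) :
    doobTransform (restrictedCarrierMatrix p K) l h ∈ rowStochastic ℝ (Fin (K + 1)) := by
  rw [mem_rowStochastic_iff_sum]
  refine ⟨fun x y => ?_, fun x => ?_⟩
  · exact div_nonneg (mul_nonneg (carrierMatrix_nonneg H.p_pos H.p_lt_one _ _) (H.vec_pos y).le)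
      (mul_pos H.pos (H.vec_pos x)).le
  · have := congrFun H.eq x
    simp only [mulVec, dotProduct, Pi.smul_apply, smul_eq_mul] at this
    simp only [doobTransform, of_apply]
    rw [← Finset.sum_div, this, div_self (mul_pos H.pos (H.vec_pos x)).ne']

theorem doob_pos (H : PositiveEigenpair p K l h) {x y : Fin (K + 1)}
    (hxy : 0 < carrierMatrix p x y) :
    0 < doobTransform (restrictedCarrierMatrix p K) l h x y :=
  div_pos (mul_pos hxy (H.vec_pos y)) (mul_pos H.pos (H.vec_pos x))

theorem doob_down_pos (H : PositiveEigenpair p K l h) (x y : Fin (K + 1))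
    (hy : (y : ℕ) = (x : ℕ) - 1) :
    0 < doobTransform (restrictedCarrierMatrix p K) l h x y := by
  refine H.doob_pos ?_
  rw [hy, carrierMatrix_down]
  linarith [H.p_lt_one]

theorem doob_ne_zero {x y : Fin (K + 1)}
    (hxy : doobTransform (restrictedCarrierMatrix p K) l h x y ≠ 0) :
    (x : ℕ) ≤ y + 1 ∧ (y : ℕ) ≤ x + 1 := by
  refine carrierMatrix_ne_zero (p := p) fun h0 => hxy ?_
  simp [doobTransform, restrictedCarrierMatrix, h0]

/-- The chain can step down and can rest at `0`, so `0` is reached from `x` in any number of steps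
that is at least `x`. Resting removes any parity obstruction, and the column of `0` in the power `K`
is positive. -/
theorem doob_pow_zero_pos (H : PositiveEigenpair p K l h) (n : ℕ) (x : Fin (K + 1))
    (hx : (x : ℕ) ≤ n) : 0 < (doobTransform (restrictedCarrierMatrix p K) l h ^ n) x 0 := by
  induction n generalizing x with
  | zero =>
    obtain rfl : x = 0 := Fin.ext (by simpa using hx)
    simp
  | succ n ih =>
    rw [pow_succ', Matrix.mul_apply]
    have hQ := H.doob_mem_rowStochastic
    let y : Fin (K + 1) := ⟨(x : ℕ) - 1, by omega⟩
    have h1 := H.doob_down_pos x y rfl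
    have h2 := ih y (show (x : ℕ) - 1 ≤ n by omega)
    refine lt_of_lt_of_le (mul_pos h1 h2) (Finset.single_le_sum
      (f := fun y => doobTransform (restrictedCarrierMatrix p K) l h x y *
        (doobTransform (restrictedCarrierMatrix p K) l h ^ n) y 0)
      (fun z _ => mul_nonneg (hQ.1 _ _) ((pow_mem hQ n).1 _ _)) (Finset.mem_univ y))

theorem exists_tendsto (H : PositiveEigenpair p K l h) (f : Fin (K + 1) → ℝ) :
    ∃ c, ∀ x, Tendsto (fun n => ((doobTransform (restrictedCarrierMatrix p K) l h ^ n).mulVec f) x)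
      atTop (𝓝 c) :=
  exists_tendsto_pow_mulVec H.doob_mem_rowStochastic
    (fun x => H.doob_pow_zero_pos K x (by omega)) f

/-- The Doob transform is conjugation by the diagonal of `h` with division by `l`, so it commutes
with powers. -/
theorem doob_pow_apply (H : PositiveEigenpair p K l h) (n : ℕ) (x y : Fin (K + 1)) :
    (restrictedCarrierMatrix p K ^ n) x y =
      l ^ n * h x * (doobTransform (restrictedCarrierMatrix p K) l h ^ n) x y / h y := by
  have hne : ∀ x, h x ≠ 0 := fun x => (H.vec_pos x).ne'
  have hl : l ≠ 0 := H.pos.ne'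
  induction n generalizing y with
  | zero =>
    by_cases hxy : x = y
    · subst hxy
      simp [hne]
    · simp [Matrix.one_apply_ne hxy]
  | succ n ih =>
    rw [pow_succ, Matrix.mul_apply, pow_succ l, pow_succ (doobTransform _ l h), Matrix.mul_apply,
      Finset.mul_sum, Finset.sum_div]
    refine Finset.sum_congr rfl fun z _ => ?_
    rw [ih]
    simp only [doobTransform, Matrix.of_apply]
    have := hne z
    have := hne y
    field_simp

theorem mulVec_one (H : PositiveEigenpair p K l h) (n : ℕ) (x : Fin (K + 1)) :
    ((restrictedCarrierMatrix p K ^ n).mulVec 1) x = l ^ n * h x *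
      ((doobTransform (restrictedCarrierMatrix p K) l h ^ n).mulVec fun y => (h y)⁻¹) x := by
  simp only [Matrix.mulVec, dotProduct, Finset.mul_sum]
  refine Finset.sum_congr rfl fun y _ => ?_
  rw [H.doob_pow_apply]
  simp only [Pi.one_apply]
  ring

-- Dividing an eigenvector by `h` gives one of the stochastic Doob matrix with eigenvalue `w = z /
-- l`. If `‖w‖ ≥ 1`, convergence of the powers to constants forces that vector to be constant,
-- whence `w = 1` and `z = l`.
open Matrix in
theorem isPerronPair (H : PositiveEigenpair p K l h) :
    IsPerronPair (restrictedCarrierMatrix p K) l h := by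
  refine ⟨H.vec_pos, H.eq, fun z hz hzl => ?_⟩
  set A := restrictedCarrierMatrix p K with hA
  set Q := doobTransform A l h with hQ
  obtain ⟨v, hv, hv0⟩ : ∃ v : Fin (K + 1) → ℂ, (A.map Complex.ofReal) *ᵥ v = z • v ∧ v ≠ 0 := by
    rw [← Matrix.spectrum_toLin', ← Module.End.hasEigenvalue_iff_mem_spectrum] at hz
    obtain ⟨v, hv⟩ := hz.exists_hasEigenvector
    exact ⟨v, by simpa using hv.apply_eq_smul, hv.2⟩
  by_contra hlt
  have hlt : l ≤ ‖z‖ := not_lt.1 hlt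
  have hl : (l : ℂ) ≠ 0 := by exact_mod_cast H.pos.ne'
  let w : ℂ := z / l
  have hw : 1 ≤ ‖w‖ := by
    simp only [w, norm_div, Complex.norm_real, Real.norm_eq_abs, abs_of_pos H.pos]
    rwa [one_le_div H.pos]
  let u : Fin (K + 1) → ℂ := fun x => v x / h x
  have hne : ∀ x, (h x : ℂ) ≠ 0 := fun x => by exact_mod_cast (H.vec_pos x).ne'
  have hu : ∀ x, ∑ y, (Q x y : ℂ) * u y = w * u x := by
    intro x
    have h1 := congrFun hv x
    simp only [mulVec, dotProduct, Pi.smul_apply, smul_eq_mul, map_apply] at h1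
    have h2 : w * u x = (l * h x : ℂ)⁻¹ * (z * v x) := by
      simp only [w, u]
      have := hne x
      field_simp
    rw [h2, ← h1, Finset.mul_sum]
    refine Finset.sum_congr rfl fun y _ => ?_
    simp only [hQ, doobTransform, of_apply, u]
    have := hne x
    have := hne y
    push_cast
    field_simp
  have hpow : ∀ n : ℕ, ∀ x, ∑ y, ((Q ^ n) x y : ℂ) * u y = w ^ n * u x := by
    intro n
    induction n with
    | zero =>
      intro x
      simp [Matrix.one_apply, apply_ite Complex.ofReal]
    | succ n ih =>
      intro x
      have e : ∀ y, ((Q ^ (n + 1)) x y : ℂ) * u y = ∑ k, ((Q ^ n) x k : ℂ) * ((Q k y : ℂ) * u y) := by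
        intro y
        rw [pow_succ, mul_apply]
        push_cast
        rw [Finset.sum_mul]
        exact Finset.sum_congr rfl fun k _ => by ring
      simp only [e]
      rw [Finset.sum_comm]
      simp only [← Finset.mul_sum, hu]
      have : ∀ k, ((Q ^ n) x k : ℂ) * (w * u k) = w * (((Q ^ n) x k : ℂ) * u k) :=
        fun k => by ring
      simp only [this]
      rw [← Finset.mul_sum, ih]
      ring
  obtain ⟨c₁, hc₁⟩ := H.exists_tendsto fun y => (u y).re
  obtain ⟨c₂, hc₂⟩ := H.exists_tendsto fun y => (u y).im
  have hlim : ∀ x, Tendsto (fun n : ℕ => w ^ n * u x) atTop (𝓝 (c₁ + c₂ * Complex.I)) := by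
    intro x
    have h1 := (Complex.continuous_ofReal.tendsto _).comp (hc₁ x)
    have h2 := (Complex.continuous_ofReal.tendsto _).comp (hc₂ x)
    refine (h1.add (h2.mul_const Complex.I)).congr fun n => ?_
    rw [← hpow]
    simp only [Function.comp_apply, mulVec, dotProduct]
    push_cast
    rw [Finset.sum_mul, ← Finset.sum_add_distrib]
    refine Finset.sum_congr rfl fun y _ => ?_
    conv_rhs => rw [← Complex.re_add_im (u y)]
    ring
  -- The difference `w ^ n * (u x - u y)` tends to `0`, yet its norm never drops below that of `u x
  -- - u y`.
  have hconst : ∀ x y, u x = u y := by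
    intro x y
    have h1 := (hlim x).sub (hlim y)
    rw [sub_self] at h1
    have h2 : Tendsto (fun n : ℕ => ‖w ^ n * u x - w ^ n * u y‖) atTop (𝓝 0) := by
      simpa using h1.norm
    have h3 : ‖u x - u y‖ ≤ 0 := by
      refine ge_of_tendsto h2 (Eventually.of_forall fun n => ?_)
      rw [← mul_sub, norm_mul, norm_pow]
      exact le_mul_of_one_le_left (norm_nonneg _) (one_le_pow₀ hw)
    exact sub_eq_zero.1 (norm_le_zero_iff.1 h3)
  have hw1 : w * u 0 = u 0 := by
    rw [← hu 0]
    have : ∀ y, (Q 0 y : ℂ) * u y = Q 0 y * u 0 := fun y => by rw [hconst y 0]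
    simp only [this]
    rw [← Finset.sum_mul]
    have hs := sum_row_of_mem_rowStochastic H.doob_mem_rowStochastic 0
    have hs' : ∑ y, (Q 0 y : ℂ) = 1 := by
      rw [← Complex.ofReal_sum, hs, Complex.ofReal_one]
    rw [hs', one_mul]
  have hu0 : u 0 ≠ 0 := by
    intro h0
    refine hv0 (funext fun x => ?_)
    have h1 : u x = 0 := by rw [hconst x 0, h0]
    simpa [u, hne x] using h1
  have hw2 : w = 1 := by
    have := mul_right_cancel₀ hu0 (hw1.trans (one_mul _).symm)
    exact this
  exact hzl ((div_eq_one_iff_eq hl).1 hw2)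

end PositiveEigenpair

/-! ### Weak convergence through words -/

theorem isClopen_word {α : Type*} [TopologicalSpace α] [DiscreteTopology α] (n : ℤ) (k : ℕ)
    (x : ℕ → α) : IsClopen (word n k x) := by
  have : word n k x = ⋂ i ∈ Finset.range (k + 1), (fun ω : ℤ → α => ω (n + i)) ⁻¹' {x i} := by
    ext ω
    simp only [word, Set.mem_ofPred_eq, Set.mem_iInter, Finset.mem_range, Nat.lt_succ_iff,
      Set.mem_preimage, Set.mem_singleton_iff]
  rw [this]
  exact isClopen_biInter_finset fun i _ =>
    (isClopen_discrete {x i}).preimage (continuous_apply (n + (i : ℤ)))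

/-- Convergence of the probabilities of all words implies weak convergence to a law on
trajectories in a finite state space. -/
theorem exists_tendsto_of_tendsto_word {α : Type*} [MeasurableSpace α] [TopologicalSpace α]
    [DiscreteTopology α] [BorelSpace α] [Finite α] [Nonempty α]
    {ρ : ℕ → ProbabilityMeasure (ℤ → α)} {L : ℤ → ℕ → (ℕ → α) → ℝ}
    (h : ∀ n k x, Tendsto (fun N => (ρ N : Measure (ℤ → α)).real (word n k x)) atTop
      (𝓝 (L n k x))) :
    ∃ ν : ProbabilityMeasure (ℤ → α), Tendsto ρ atTop (𝓝 ν) ∧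
      ∀ n k x, (ν : Measure (ℤ → α)).real (word n k x) = L n k x := by
  -- Words are clopen, so a cluster point inherits the limiting word probabilities. These determine
  -- it, and compactness turns the unique cluster point into a limit.
  have hcl : ∀ ν, MapClusterPt ν atTop ρ →
      ∀ n k x, (ν : Measure (ℤ → α)).real (word n k x) = L n k x := by
    intro ν hν n k x
    obtain ⟨U, hU, hUν⟩ := mapClusterPt_iff_ultrafilter.1 hν
    have h1 := ProbabilityMeasure.tendsto_measure_of_isClopen_of_tendsto hUν
      (isClopen_word n k x)
    have h2 : Tendsto (fun N => (ρ N : Measure (ℤ → α)).real (word n k x)) U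
        (𝓝 ((ν : Measure (ℤ → α)).real (word n k x))) :=
      (NNReal.tendsto_coe.2 h1)
    exact tendsto_nhds_unique h2 ((h n k x).mono_left hU)
  obtain ⟨ν, -, hν⟩ := isCompact_univ.exists_mapClusterPt (f := atTop) (u := ρ) (by simp)
  refine ⟨ν, tendsto_nhds_of_unique_mapClusterPt fun ν' hν' => ?_, hcl ν hν⟩
  refine Subtype.ext (measure_ext_word (ν' : Measure (ℤ → α)) (ν : Measure (ℤ → α))
    fun n k x => ?_)
  rw [← ENNReal.toReal_eq_toReal_iff' (measure_ne_top _ _) (measure_ne_top _ _)]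
  exact (hcl ν' hν' n k x).trans (hcl ν hν n k x).symm

/-- If in addition the limits have the Markov form, the limit is a stationary Markov law. -/
theorem isMarkovLaw_of_word {α : Type*} [MeasurableSpace α] [Countable α]
    [MeasurableSingletonClass α] [Nonempty α] {ν : Measure (ℤ → α)} [IsFiniteMeasure ν]
    {Q : Matrix α α ℝ} {π : α → ℝ} (h : ∀ n k x, ν.real (word n k x) =
      π (x 0) * ∏ i ∈ Finset.range k, Q (x i) (x (i + 1))) : IsMarkovLaw ν Q := by
  refine ⟨fun k => ?_, fun n k x => ?_⟩
  · have hfin : IsFiniteMeasure (ν.map fun (ω : ℤ → α) n => ω (n + k)) := inferInstance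
    refine measure_ext_word _ _ fun n j x => ?_
    rw [← ENNReal.toReal_eq_toReal_iff' (measure_ne_top _ _) (measure_ne_top _ _),
      Measure.map_apply (measurable_shift k) (measurableSet_word n j x)]
    change ν.real _ = ν.real _
    have e : (fun (ω : ℤ → α) n => ω (n + k)) ⁻¹' word n j x = word (n + k) j x := by
      ext ω
      simp only [word, Set.mem_preimage, Set.mem_ofPred_eq]
      refine forall₂_congr fun i _ => ?_
      rw [show n + (i : ℤ) + k = n + k + i by ring]
    rw [e, h, h]
  · rw [h, h, Finset.prod_range_succ]
    ring

/-! ### The carrier of a truncated configuration -/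

theorem isGood_of_eq_zero {ω : Config} {a : ℤ} (h : ∀ i ≤ a, ω i = 0) :
    IsGood ω ∧ ∀ n ≤ a, load ω n = 0 := by
  have hex : ∀ n ≤ a, ∀ j, excess ω n j = -j := by
    intro n hn j
    have : ∀ i ∈ Finset.range j, (2 * ((ω (n - i) : ℕ) : ℤ) - 1) = -1 := fun i _ => by
      rw [h _ (by omega)]; simp
    rw [excess, Finset.sum_congr rfl this]
    simp
  have hg : IsGood ω := by
    have hsub : path ω '' Set.Iic 0 ⊆ Set.Iic (path ω a) ∪ path ω '' Set.Icc a 0 := by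
      rintro _ ⟨m, hm, rfl⟩
      have hm : m ≤ 0 := hm
      rcases le_or_gt a m with h1 | h1
      · exact Or.inr ⟨m, ⟨h1, hm⟩, rfl⟩
      · left
        have h2 := hex a le_rfl (a - m).toNat
        rw [excess_eq, show a - ((a - m).toNat : ℤ) = m by omega] at h2
        change path ω m ≤ path ω a
        omega
    exact (bddAbove_Iic.union ((Set.finite_Icc _ _).image _).bddAbove).mono hsub
  refine ⟨hg, fun n hn => load_eq_of hg (fun j => ?_) ⟨0, by simp [excess_zero]⟩⟩
  rw [hex n hn]
  simp

theorem truncate_of_le {N : ℕ} (ω : Config) {i : ℤ} (h : i ≤ -N) : truncate N ω i = 0 := by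
  rw [truncate, if_neg (by omega)]

theorem truncate_of_gt {N : ℕ} (ω : Config) {i : ℤ} (h : N < i) : truncate N ω i = 0 := by
  rw [truncate, if_neg (by omega)]

theorem truncate_of_mem {N : ℕ} (ω : Config) {i : ℤ} (h : -(N : ℤ) < i) (h' : i ≤ N) :
    truncate N ω i = ω i := by
  rw [truncate, if_pos ⟨h, h'⟩]

theorem isGood_truncate (N : ℕ) (ω : Config) : IsGood (truncate N ω) :=
  (isGood_of_eq_zero fun _ h => truncate_of_le ω h).1

/-- The carrier of the truncated configuration. -/
noncomputable def truncLoad (N : ℕ) (ω : Config) : ℤ → ℕ := load (truncate N ω)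

theorem truncLoad_of_le {N : ℕ} (ω : Config) {n : ℤ} (h : n ≤ -N) : truncLoad N ω n = 0 :=
  (isGood_of_eq_zero fun _ h => truncate_of_le ω h).2 n h

theorem truncLoad_succ {N : ℕ} (ω : Config) {n : ℤ} (h : -(N : ℤ) ≤ n) (h' : n < N) :
    truncLoad N ω (n + 1) = carry (truncLoad N ω n) (ω (n + 1)) := by
  have := load_step_succ (isGood_truncate N ω) n
  rwa [truncate_of_mem ω (by omega) (by omega)] at this

/-- Beyond the window all sites are empty and the load only decreases, so boundedness is decided by
time `N`. -/
theorem truncLoad_le_of_ge {N : ℕ} (ω : Config) {n : ℤ} (h : N ≤ n) :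
    truncLoad N ω n ≤ truncLoad N ω N := by
  induction n, h using Int.leInduction with
  | base => exact le_rfl
  | succ n hn ih =>
    have := load_step_succ (isGood_truncate N ω) n
    rw [truncate_of_gt ω (by omega)] at this
    simp only [carry, Fin.isValue, zero_ne_one, if_false] at this
    change load _ _ ≤ _
    rw [this]
    exact (Nat.sub_le _ _).trans ih

theorem measurable_truncate (N : ℕ) : Measurable (truncate N) := by
  refine measurable_pi_lambda _ fun n => ?_
  unfold truncate
  split_ifs
  · exact measurable_pi_apply n
  · exact measurable_const

theorem measurable_truncLoad (N : ℕ) : Measurable (truncLoad N) :=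
  measurable_load.comp (measurable_truncate N)

theorem truncLoad_congr {N : ℕ} {ω ω' : Config} {n : ℤ} (h : ∀ i ≤ n, ω i = ω' i) :
    truncLoad N ω n = truncLoad N ω' n :=
  load_congr fun i hi => by simp only [truncate, h i hi]

/-- The event that the truncated carrier stays below `K` up to time `m`. -/
def boundedUpTo (N K : ℕ) (m : ℤ) : Set Config := {ω | ∀ i ≤ m, truncLoad N ω i ≤ K}

theorem isPast_boundedUpTo (N K : ℕ) (m : ℤ) : IsPast m (boundedUpTo N K m) := by
  refine ⟨?_, fun ω ω' h hω i hi => ?_⟩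
  · have : boundedUpTo N K m = ⋂ i : ℤ, ⋂ _ : i ≤ m, {ω | truncLoad N ω i ≤ K} := by
      ext ω; simp [boundedUpTo]
    rw [this]
    refine MeasurableSet.iInter fun i => MeasurableSet.iInter fun _ => ?_
    exact ((measurable_pi_apply i).comp (measurable_truncLoad N)) measurableSet_Iic
  · rw [← truncLoad_congr fun j hj => h j (hj.trans hi)]
    exact hω i hi

theorem boundedUpTo_succ (N K : ℕ) (m : ℤ) :
    boundedUpTo N K (m + 1) = boundedUpTo N K m ∩ {ω | truncLoad N ω (m + 1) ≤ K} := by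
  ext ω
  simp only [boundedUpTo, Set.mem_ofPred_eq, Set.mem_inter_iff]
  refine ⟨fun h => ⟨fun i hi => h i (by omega), h _ le_rfl⟩, fun h i hi => ?_⟩
  rcases eq_or_lt_of_le hi with rfl | hi
  · exact h.2
  · exact h.1 i (by omega)

theorem boundedUpTo_mono (N K : ℕ) {m n : ℤ} (h : m ≤ n) :
    boundedUpTo N K n ⊆ boundedUpTo N K m := fun _ hω i hi => hω i (hi.trans h)

theorem isPast_truncLoad (N : ℕ) (m : ℤ) (s : Set ℕ) : IsPast m {ω | truncLoad N ω m ∈ s} :=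
  isPast_of_fun (f := fun ω => truncLoad N ω m)
    ((measurable_pi_apply m).comp (measurable_truncLoad N)) (fun _ _ h => truncLoad_congr h)
    (MeasurableSpace.measurableSet_top (s := s))

/-- The truncated carrier with values clipped to `{0, …, K}`. -/
noncomputable def clip (K : ℕ) (w : ℕ) : Fin (K + 1) := ⟨min w K, by omega⟩

theorem clip_eq_iff {K w : ℕ} (h : w ≤ K) (c : Fin (K + 1)) : clip K w = c ↔ w = c := by
  simp only [clip, Fin.ext_iff, min_eq_left h]

/-- The clipped trajectory. -/
noncomputable def clipped (N K : ℕ) (ω : Config) (n : ℤ) : Fin (K + 1) := clip K (truncLoad N ω n)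

theorem measurable_clipped (N K : ℕ) : Measurable (clipped N K) :=
  measurable_pi_lambda _ fun n => (measurable_of_countable (clip K)).comp
    ((measurable_pi_apply n).comp (measurable_truncLoad N))

section

variable {μ : Measure Config} [IsProbabilityMeasure μ] {p : ℝ}

theorem IsMarkovLaw.measureReal_inter_site (hμ : IsMarkovLaw μ (siteMatrix p p)) (hp : 0 < p)
    (hp1 : p < 1) {m : ℤ} {A : Set Config} (hA : IsPast m A) (b : Fin 2) :
    μ.real (A ∩ {ω | ω (m + 1) = b}) = μ.real A * (if b = 1 then p else 1 - p) := by
  rw [hμ.measureReal_inter_succ (siteMatrix_nonneg hp.le hp1.le hp.le hp1.le) hA b,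
    ← sum_measureReal_inter_fiber (measurable_pi_apply m) hA.1, Finset.sum_mul]
  refine Finset.sum_congr rfl fun c _ => ?_
  congr 1
  fin_cases c <;> fin_cases b <;> simp [siteMatrix]

/-- Within the window the next site is independent of the past, so the truncated carrier is Markov
with the carrier matrix, even relative to the whole past of the configuration. -/
theorem IsMarkovLaw.measureReal_inter_truncLoad (hμ : IsMarkovLaw μ (siteMatrix p p)) (hp : 0 < p)
    (hp1 : p < 1) {N : ℕ} {m : ℤ} (hm : -(N : ℤ) ≤ m) (hm' : m < N) {A : Set Config}
    (hA : IsPast m A) {v : ℕ} (hv : ∀ ω ∈ A, truncLoad N ω m = v) (w : ℕ) :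
    μ.real (A ∩ {ω | truncLoad N ω (m + 1) = w}) = μ.real A * carrierMatrix p v w := by
  have key : ∀ b : Fin 2, (∀ e : Fin 2, w = carry v e ↔ e = b) →
      μ.real (A ∩ {ω | truncLoad N ω (m + 1) = w}) = μ.real A * (if b = 1 then p else 1 - p) := by
    intro b hb
    rw [← hμ.measureReal_inter_site hp hp1 hA b]
    congr 1
    ext ω
    simp only [Set.mem_inter_iff, Set.mem_ofPred_eq]
    refine and_congr_right fun hω => ?_
    rw [truncLoad_succ ω hm hm', hv ω hω, ← hb, eq_comm]
  by_cases h1 : w = v + 1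
  · rw [key 1 fun e => ?_, h1, carrierMatrix_up, if_pos rfl]
    unfold carry
    split_ifs with he
    · exact ⟨fun _ => he, fun _ => h1⟩
    · exact ⟨fun h => by omega, fun h => absurd h he⟩
  by_cases h2 : w = v - 1
  · rw [key 0 fun e => ?_, h2, carrierMatrix_down, if_neg (by decide)]
    unfold carry
    split_ifs with he
    · exact ⟨fun h => absurd h h1, fun h => by rw [he] at h; exact absurd h (by decide)⟩
    · exact ⟨fun _ => fin_two_ne_one.1 he, fun _ => h2⟩
  · have h3 : carrierMatrix p v w = 0 := by
      simp only [carrierMatrix, Matrix.of_apply]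
      rw [if_neg h1, if_neg (by omega), if_neg (by omega)]
    rw [h3, mul_zero]
    have h4 : A ∩ {ω | truncLoad N ω (m + 1) = w} = ∅ := by
      ext ω
      simp only [Set.mem_inter_iff, Set.mem_ofPred_eq, Set.mem_empty_iff_false, iff_false, not_and]
      intro hω h5
      rw [truncLoad_succ ω hm hm', hv ω hω] at h5
      unfold carry at h5
      split_ifs at h5 <;> omega
    rw [h4, measureReal_empty]

/-- Weight of the trajectories of the bounded truncated carrier ending in a given state. -/
theorem IsMarkovLaw.measureReal_boundedUpTo (hμ : IsMarkovLaw μ (siteMatrix p p)) (hp : 0 < p)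
    (hp1 : p < 1) {N K : ℕ} (j : ℕ) (hj : j ≤ 2 * N) (x : Fin (K + 1)) :
    μ.real (boundedUpTo N K (-N + j) ∩ {ω | truncLoad N ω (-N + j) = x}) =
      (restrictedCarrierMatrix p K ^ j) 0 x := by
  induction j generalizing x with
  | zero =>
    by_cases hx : (0 : Fin (K + 1)) = x
    · have : boundedUpTo N K (-N + (0 : ℕ)) ∩ {ω | truncLoad N ω (-N + (0 : ℕ)) = x} =
          Set.univ := by
        refine Set.eq_univ_of_forall fun ω => ⟨fun i hi => ?_, ?_⟩
        · rw [truncLoad_of_le ω (by simpa using hi)]; exact Nat.zero_le _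
        · change truncLoad N ω _ = _
          rw [truncLoad_of_le ω (by simp), ← hx]; simp
      rw [this, probReal_univ, pow_zero, hx, Matrix.one_apply_eq]
    · have : boundedUpTo N K (-N + (0 : ℕ)) ∩ {ω | truncLoad N ω (-N + (0 : ℕ)) = x} = ∅ := by
        refine Set.eq_empty_of_forall_notMem fun ω hω => hx ?_
        have h1 : truncLoad N ω (-N + (0 : ℕ)) = x := hω.2
        rw [truncLoad_of_le ω (by simp)] at h1
        exact Fin.ext h1
      rw [this, measureReal_empty, pow_zero, Matrix.one_apply_ne hx]
  | succ j ih =>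
    have e0 : (-(N : ℤ) + ((j + 1 : ℕ) : ℤ)) = -N + j + 1 := by push_cast; ring
    rw [e0, boundedUpTo_succ, pow_succ, Matrix.mul_apply]
    have e1 : boundedUpTo N K (-N + j) ∩ {ω | truncLoad N ω (-N + j + 1) ≤ K} ∩
        {ω | truncLoad N ω (-N + j + 1) = x} =
        boundedUpTo N K (-N + j) ∩ {ω | truncLoad N ω (-N + j + 1) = x} := by
      ext ω
      simp only [Set.mem_inter_iff, Set.mem_ofPred_eq]
      refine ⟨fun h => ⟨h.1.1, h.2⟩, fun h => ⟨⟨h.1, ?_⟩, h.2⟩⟩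
      rw [h.2]; omega
    have hs : MeasurableSet (boundedUpTo N K (-N + j) ∩ {ω | truncLoad N ω (-N + j + 1) = x}) :=
      (isPast_boundedUpTo N K _).1.inter (isPast_truncLoad N _ {(x : ℕ)}).1
    rw [e1, ← sum_measureReal_inter_fiber ((measurable_pi_apply (-(N : ℤ) + j)).comp
      (measurable_clipped N K)) hs]
    refine Finset.sum_congr rfl fun c _ => ?_
    rw [← ih (by omega) c]
    have h2 := hμ.measureReal_inter_truncLoad hp hp1 (N := N) (m := -N + j) (by omega) (by omega)
      (A := boundedUpTo N K (-N + j) ∩ {ω | truncLoad N ω (-N + j) = c})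
      ((isPast_boundedUpTo N K _).inter (isPast_truncLoad N _ {(c : ℕ)})) (v := c)
      (fun ω hω => hω.2) x
    refine Eq.trans ?_ h2
    congr 1
    ext ω
    simp only [Set.mem_inter_iff, Set.mem_ofPred_eq, Function.comp_apply]
    constructor
    · rintro ⟨⟨h1, h2⟩, h3⟩
      exact ⟨⟨h1, (clip_eq_iff (h1 _ le_rfl) c).1 h3⟩, h2⟩
    · rintro ⟨⟨h1, h3⟩, h2⟩
      exact ⟨⟨h1, h2⟩, (clip_eq_iff (h1 _ le_rfl) c).2 h3⟩

/-- The weight of the bounded continuations of a past event. -/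
theorem IsMarkovLaw.measureReal_inter_boundedUpTo (hμ : IsMarkovLaw μ (siteMatrix p p))
    (hp : 0 < p) (hp1 : p < 1) {N K : ℕ} (r : ℕ) {m : ℤ} (hm : -(N : ℤ) ≤ m) (hm' : m + r ≤ N)
    {A : Set Config} (hA : IsPast m A) (hAb : A ⊆ boundedUpTo N K m) {y : Fin (K + 1)}
    (hy : ∀ ω ∈ A, truncLoad N ω m = y) :
    μ.real (A ∩ boundedUpTo N K (m + r)) =
      μ.real A * ((restrictedCarrierMatrix p K ^ r).mulVec 1) y := by
  induction r generalizing m A y with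
  | zero =>
    rw [Nat.cast_zero, add_zero, Set.inter_eq_left.2 hAb]
    simp
  | succ r ih =>
    have hmr : m + ((r + 1 : ℕ) : ℤ) = m + 1 + r := by push_cast; ring
    have hs : MeasurableSet (A ∩ boundedUpTo N K (m + 1 + r)) :=
      hA.1.inter (isPast_boundedUpTo N K _).1
    rw [hmr, ← sum_measureReal_inter_fiber ((measurable_pi_apply (m + 1)).comp
      (measurable_clipped N K)) hs, pow_succ', ← Matrix.mulVec_mulVec]
    conv_rhs => rw [Matrix.mulVec, dotProduct, Finset.mul_sum]
    refine Finset.sum_congr rfl fun z _ => ?_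
    have h1 := hμ.measureReal_inter_truncLoad hp hp1 (N := N) (m := m) hm (by omega) hA hy z
    have h2 := ih (m := m + 1) (by omega) (by omega)
      (A := A ∩ {ω | truncLoad N ω (m + 1) = z})
      ((hA.mono (by omega)).inter (isPast_truncLoad N _ {(z : ℕ)}))
      (fun ω hω => by
        rw [boundedUpTo_succ]
        refine ⟨hAb hω.1, ?_⟩
        have : truncLoad N ω (m + 1) = z := hω.2
        change truncLoad N ω (m + 1) ≤ K
        omega) (y := z) (fun ω hω => hω.2)
    rw [h1, mul_assoc] at h2
    refine Eq.trans ?_ h2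
    congr 1
    ext ω
    simp only [Set.mem_inter_iff, Set.mem_ofPred_eq, Function.comp_apply]
    constructor
    · rintro ⟨⟨h1, h2⟩, h3⟩
      exact ⟨⟨h1, (clip_eq_iff (h2 _ (by omega)) z).1 h3⟩, h2⟩
    · rintro ⟨⟨h1, h3⟩, h2⟩
      exact ⟨⟨h1, h2⟩, (clip_eq_iff (h2 _ (by omega)) z).2 h3⟩

end

/-! ### Conditioned word probabilities and their limits -/

section

variable {μ : Measure Config} [IsProbabilityMeasure μ] {p : ℝ}

theorem isPast_clipped_word (N K : ℕ) (n : ℤ) (k : ℕ) (x : ℕ → Fin (K + 1)) :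
    IsPast (n + k) (clipped N K ⁻¹' word n k x) := by
  refine ⟨measurable_clipped N K (measurableSet_word n k x), fun ω ω' h hω i hi => ?_⟩
  rw [← hω i hi]
  simp only [clipped]
  rw [truncLoad_congr fun j hj => h j (by omega)]

theorem IsMarkovLaw.measureReal_clipped_word (hμ : IsMarkovLaw μ (siteMatrix p p)) (hp : 0 < p)
    (hp1 : p < 1) {N K : ℕ} {n : ℤ} (hn : -(N : ℤ) ≤ n) (k : ℕ) (hk : n + k ≤ N)
    (x : ℕ → Fin (K + 1)) :
    μ.real (boundedUpTo N K (n + k) ∩ clipped N K ⁻¹' word n k x) =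
      (restrictedCarrierMatrix p K ^ (n + N).toNat) 0 (x 0) *
        ∏ i ∈ Finset.range k, restrictedCarrierMatrix p K (x i) (x (i + 1)) := by
  induction k with
  | zero =>
    rw [Finset.prod_range_zero, mul_one,
      ← hμ.measureReal_boundedUpTo hp hp1 (N := N) _ (by omega) (x 0)]
    have e : -(N : ℤ) + ((n + N).toNat : ℤ) = n := by omega
    rw [e]
    congr 1
    ext ω
    simp only [Nat.cast_zero, add_zero, word_zero, Set.mem_inter_iff, Set.mem_preimage,
      Set.mem_ofPred_eq]
    refine and_congr_right fun hω => ?_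
    exact clip_eq_iff (hω _ le_rfl) _
  | succ k ih =>
    have hs : boundedUpTo N K (n + (k + 1 : ℕ)) ∩ clipped N K ⁻¹' word n (k + 1) x =
        (boundedUpTo N K (n + k) ∩ clipped N K ⁻¹' word n k x) ∩
          {ω | truncLoad N ω (n + k + 1) = x (k + 1)} := by
      have e : n + ((k + 1 : ℕ) : ℤ) = n + k + 1 := by push_cast; ring
      ext ω
      rw [word_succ, e, boundedUpTo_succ]
      simp only [Set.mem_inter_iff, Set.mem_preimage, Set.mem_ofPred_eq]
      constructor
      · rintro ⟨⟨h1, h2⟩, h3, h4⟩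
        exact ⟨⟨h1, h3⟩, (clip_eq_iff h2 _).1 h4⟩
      · rintro ⟨⟨h1, h3⟩, h4⟩
        have h2 : truncLoad N ω (n + k + 1) ≤ K := by omega
        exact ⟨⟨h1, h2⟩, h3, (clip_eq_iff h2 _).2 h4⟩
    rw [hs, Finset.prod_range_succ, ← mul_assoc, ← ih (by omega)]
    refine hμ.measureReal_inter_truncLoad hp hp1 (by omega) (by omega)
      ((isPast_boundedUpTo N K _).inter (isPast_clipped_word N K n k x)) (fun ω hω => ?_) _
    exact (clip_eq_iff (hω.1 _ le_rfl) _).1 (hω.2 k le_rfl)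

theorem IsMarkovLaw.measureReal_boundedUpTo_clipped_word (hμ : IsMarkovLaw μ (siteMatrix p p))
    (hp : 0 < p) (hp1 : p < 1) {N K : ℕ} {n : ℤ} (hn : -(N : ℤ) ≤ n) (k : ℕ) (hk : n + k ≤ N)
    (x : ℕ → Fin (K + 1)) :
    μ.real (boundedUpTo N K N ∩ clipped N K ⁻¹' word n k x) =
      (restrictedCarrierMatrix p K ^ (n + N).toNat) 0 (x 0) *
        (∏ i ∈ Finset.range k, restrictedCarrierMatrix p K (x i) (x (i + 1))) *
          ((restrictedCarrierMatrix p K ^ (N - n - k).toNat).mulVec 1) (x k) := by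
  rw [← hμ.measureReal_clipped_word hp hp1 hn k hk x,
    ← hμ.measureReal_inter_boundedUpTo hp hp1 (N := N) (K := K) (N - n - k).toNat (m := n + k)
      (by omega) (by omega) ((isPast_boundedUpTo N K _).inter (isPast_clipped_word N K n k x))
      Set.inter_subset_left (fun ω hω => (clip_eq_iff (hω.1 _ le_rfl) _).1 (hω.2 k le_rfl))]
  have e : n + k + ((N - n - k).toNat : ℤ) = N := by omega
  rw [e]
  congr 1
  ext ω
  simp only [Set.mem_inter_iff]
  exact ⟨fun h => ⟨⟨boundedUpTo_mono N K hk h.1, h.2⟩, h.1⟩, fun h => ⟨h.2, h.1.2⟩⟩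

theorem IsMarkovLaw.measureReal_boundedUpTo_last (hμ : IsMarkovLaw μ (siteMatrix p p))
    (hp : 0 < p) (hp1 : p < 1) (N K : ℕ) :
    μ.real (boundedUpTo N K N) = ((restrictedCarrierMatrix p K ^ (2 * N)).mulVec 1) 0 := by
  have h := hμ.measureReal_inter_boundedUpTo hp hp1 (N := N) (K := K) (2 * N) (m := -N) le_rfl
    (by omega) (isPast_univ _) (fun ω _ i hi => by
      rw [truncLoad_of_le ω hi]; exact Nat.zero_le _) (y := 0) (fun ω _ => by
      rw [truncLoad_of_le ω le_rfl]; simp)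
  rw [Set.univ_inter, probReal_univ, one_mul] at h
  have e : (-(N : ℤ) + ((2 * N : ℕ) : ℤ)) = N := by push_cast; ring
  rwa [e] at h

variable {K : ℕ} {l : ℝ} {h : Fin (K + 1) → ℝ}

/-- Averages of `1 / h` stay above its minimum. The uniform bound makes the conditioning events of
positive probability and keeps the limiting denominator away from zero. -/
theorem PositiveEigenpair.mulVec_inv_pos (H : PositiveEigenpair p K l h) :
    ∃ δ > 0, ∀ n x, δ ≤
      ((doobTransform (restrictedCarrierMatrix p K) l h ^ n).mulVec fun y => (h y)⁻¹) x := by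
  obtain ⟨x₀, hx₀⟩ := Finite.exists_min fun y => (h y)⁻¹
  obtain ⟨x₁, hx₁⟩ := Finite.exists_max fun y => (h y)⁻¹
  exact ⟨(h x₀)⁻¹, inv_pos.2 (H.vec_pos _), fun n x =>
    (rowStochastic_mulVec_mem_Icc (pow_mem H.doob_mem_rowStochastic n)
      (fun y => ⟨hx₀ y, hx₁ y⟩) x).1⟩

theorem PositiveEigenpair.measureReal_boundedUpTo_pos (H : PositiveEigenpair p K l h)
    (hμ : IsMarkovLaw μ (siteMatrix p p)) (N : ℕ) : 0 < μ.real (boundedUpTo N K N) := by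
  obtain ⟨δ, hδ, hδ'⟩ := H.mulVec_inv_pos
  rw [hμ.measureReal_boundedUpTo_last H.p_pos H.p_lt_one, H.mulVec_one]
  exact mul_pos (mul_pos (pow_pos H.pos _) (H.vec_pos _)) (hδ.trans_le (hδ' _ _))

theorem PositiveEigenpair.prod_eq (H : PositiveEigenpair p K l h) (k : ℕ) (x : ℕ → Fin (K + 1)) :
    ∏ i ∈ Finset.range k, restrictedCarrierMatrix p K (x i) (x (i + 1)) =
      l ^ k * h (x 0) / h (x k) *
        ∏ i ∈ Finset.range k, doobTransform (restrictedCarrierMatrix p K) l h (x i) (x (i + 1)) := by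
  have hne : ∀ x, h x ≠ 0 := fun x => (H.vec_pos x).ne'
  induction k with
  | zero => simp [hne]
  | succ k ih =>
    have hd : doobTransform (restrictedCarrierMatrix p K) l h (x k) (x (k + 1)) =
      restrictedCarrierMatrix p K (x k) (x (k + 1)) * h (x (k + 1)) / (l * h (x k)) := rfl
    rw [Finset.prod_range_succ, Finset.prod_range_succ, ih, hd, pow_succ]
    have := hne (x k)
    have := hne (x (k + 1))
    have := H.pos.ne'
    field_simp

/-- The approach, the word and the continuation take `2 * N` steps in total, as many as in the
normalization. All powers of `l` therefore cancel and the factors of `h` telescope. -/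
theorem PositiveEigenpair.cond_word (H : PositiveEigenpair p K l h)
    (hμ : IsMarkovLaw μ (siteMatrix p p)) {N : ℕ} {n : ℤ} (hn : -(N : ℤ) ≤ n) (k : ℕ)
    (hk : n + k ≤ N) (x : ℕ → Fin (K + 1)) :
    (cond μ (boundedUpTo N K N)).real (clipped N K ⁻¹' word n k x) =
      (doobTransform (restrictedCarrierMatrix p K) l h ^ (n + N).toNat) 0 (x 0) *
        (∏ i ∈ Finset.range k,
          doobTransform (restrictedCarrierMatrix p K) l h (x i) (x (i + 1))) *
        (((doobTransform (restrictedCarrierMatrix p K) l h ^ (N - n - k).toNat).mulVec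
          fun y => (h y)⁻¹) (x k) /
        ((doobTransform (restrictedCarrierMatrix p K) l h ^ (2 * N)).mulVec
          fun y => (h y)⁻¹) 0) := by
  have hne : ∀ x, h x ≠ 0 := fun x => (H.vec_pos x).ne'
  have hl := H.pos.ne'
  have h1 : (cond μ (boundedUpTo N K N)).real (clipped N K ⁻¹' word n k x) =
      (μ.real (boundedUpTo N K N))⁻¹ *
        μ.real (boundedUpTo N K N ∩ clipped N K ⁻¹' word n k x) := by
    rw [measureReal_def, cond_apply (isPast_boundedUpTo N K N).1, ENNReal.toReal_mul,
      ENNReal.toReal_inv]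
    rfl
  obtain ⟨δ, hδ, hδ'⟩ := H.mulVec_inv_pos
  have hpos := (hδ.trans_le (hδ' (2 * N) 0)).ne'
  rw [h1, hμ.measureReal_boundedUpTo_last H.p_pos H.p_lt_one,
    hμ.measureReal_boundedUpTo_clipped_word H.p_pos H.p_lt_one hn k hk x, H.mulVec_one,
    H.mulVec_one, H.doob_pow_apply, H.prod_eq]
  have e : 2 * N = (n + N).toNat + k + (N - n - k).toNat := by omega
  have e2 : l ^ (2 * N) = l ^ (n + N).toNat * l ^ k * l ^ (N - n - k).toNat := by
    rw [← pow_add, ← pow_add, ← e]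
  rw [e2]
  have := hne (x 0)
  have := hne (x k)
  have := hne 0
  field_simp

/-- The equilibrium law of the Doob transform. -/
noncomputable def PositiveEigenpair.equilibrium (H : PositiveEigenpair p K l h)
    (y : Fin (K + 1)) : ℝ := (H.exists_tendsto (Pi.single y 1)).choose

theorem PositiveEigenpair.tendsto_equilibrium (H : PositiveEigenpair p K l h)
    (y x : Fin (K + 1)) : Tendsto (fun n =>
      ((doobTransform (restrictedCarrierMatrix p K) l h ^ n).mulVec (Pi.single y 1)) x) atTop
      (𝓝 (H.equilibrium y)) :=
  (H.exists_tendsto (Pi.single y 1)).choose_spec x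

theorem PositiveEigenpair.tendsto_cond_word (H : PositiveEigenpair p K l h)
    (hμ : IsMarkovLaw μ (siteMatrix p p)) (n : ℤ) (k : ℕ) (x : ℕ → Fin (K + 1)) :
    Tendsto (fun N => (cond μ (boundedUpTo N K N)).real (clipped N K ⁻¹' word n k x)) atTop
      (𝓝 (H.equilibrium (x 0) * ∏ i ∈ Finset.range k,
        doobTransform (restrictedCarrierMatrix p K) l h (x i) (x (i + 1)))) := by
  -- The averages of `1 / h` in numerator and denominator have the same nonzero limit `c`, so the
  -- boundary factor tends to `1`.
  obtain ⟨c, hc⟩ := H.exists_tendsto fun y => (h y)⁻¹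
  obtain ⟨δ, hδ, hδ'⟩ := H.mulVec_inv_pos
  have hc0 : c ≠ 0 :=
    (hδ.trans_le (ge_of_tendsto (hc 0) (Eventually.of_forall fun n => hδ' n 0))).ne'
  have t1 : Tendsto (fun N : ℕ => (n + N).toNat) atTop atTop :=
    tendsto_atTop.2 fun b => (eventually_ge_atTop (b + n.natAbs)).mono fun N hN => by omega
  have t2 : Tendsto (fun N : ℕ => ((N : ℤ) - n - k).toNat) atTop atTop :=
    tendsto_atTop.2 fun b => (eventually_ge_atTop (b + n.natAbs + k)).mono fun N hN => by omega
  have t3 : Tendsto (fun N : ℕ => 2 * N) atTop atTop :=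
    tendsto_atTop.2 fun b => (eventually_ge_atTop b).mono fun N hN => by omega
  have l1 : Tendsto (fun N : ℕ => (doobTransform (restrictedCarrierMatrix p K) l h ^
      (n + N).toNat) 0 (x 0)) atTop (𝓝 (H.equilibrium (x 0))) := by
    have := (H.tendsto_equilibrium (x 0) 0).comp t1
    simpa only [Matrix.mulVec_single_one, Function.comp_def, Matrix.col_apply] using this
  have l2 := ((hc (x k)).comp t2).div ((hc 0).comp t3) hc0
  rw [div_self hc0] at l2
  have l3 := (l1.mul_const (∏ i ∈ Finset.range k,
    doobTransform (restrictedCarrierMatrix p K) l h (x i) (x (i + 1)))).mul l2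
  rw [mul_one] at l3
  refine l3.congr' ?_
  filter_upwards [eventually_ge_atTop (n.natAbs + k)] with N hN
  exact (H.cond_word hμ (by omega) k (by omega) x).symm

end

/-! ### Rests at zero and sub-criticality of bounded carriers -/

/-- The configuration `w` rests at `0` between times `n` and `n + 1`. -/
def IsFlat (w : ℤ → ℕ) (n : ℤ) : Prop := w n = 0 ∧ w (n + 1) = 0

theorem pastMax_eq {ω : Config} (h : IsGood ω) (n : ℤ) :
    pastMax (path ω) n = load ω n + path ω n := by
  rw [← carrier_eq_load h, carrier]; ring

-- A new maximum is reached exactly when an empty carrier meets an empty site, so `M` counts the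
-- rests at `0`.
open Classical in
theorem pastMax_succ {ω : Config} (h : IsGood ω) (n : ℤ) :
    pastMax (path ω) (n + 1) = pastMax (path ω) n + if IsFlat (load ω) n then 1 else 0 := by
  rw [pastMax_eq h, pastMax_eq h]
  have h1 := load_step_succ h n
  have h2 := path_sub_path ω (n + 1)
  rw [add_sub_cancel_right] at h2
  unfold carry at h1
  unfold IsFlat
  split_ifs at h1 with h3
  · rw [h3] at h2
    simp only [Fin.isValue, Fin.val_one] at h2
    rw [if_neg (by omega)]
    omega
  · rw [fin_two_ne_one.1 h3] at h2
    simp only [Fin.isValue, Fin.val_zero] at h2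
    split_ifs with h4 <;> omega

/-- A path with a bounded carrier resting at `0` infinitely often in both directions is
sub-critical. -/
theorem mem_subcritical_of_flat {ω : Config} (h : IsGood ω) {K : ℕ} (hK : ∀ n, load ω n ≤ K)
    (h1 : ∀ n, ∃ i ≥ n, IsFlat (load ω) i) (h2 : ∀ n, ∃ i < n, IsFlat (load ω) i) :
    path ω ∈ subcritical := by
  set M : ℤ → ℤ := pastMax (path ω) with hM
  have hmono : Monotone M := monotone_int_of_le_succ fun n => by
    rw [hM, pastMax_succ h n]
    split_ifs <;> omega
  have hup : ∀ k : ℕ, ∃ a, M 0 + k ≤ M a := by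
    intro k
    induction k with
    | zero => exact ⟨0, by simp⟩
    | succ k ih =>
      obtain ⟨a, ha⟩ := ih
      obtain ⟨i, hi, hf⟩ := h1 a
      refine ⟨i + 1, ?_⟩
      have h3 := pastMax_succ h i
      rw [if_pos hf] at h3
      have := hmono hi
      simp only [hM] at *
      push_cast
      omega
  have hdown : ∀ k : ℕ, ∃ a, M a ≤ M 0 - k := by
    intro k
    induction k with
    | zero => exact ⟨0, by simp⟩
    | succ k ih =>
      obtain ⟨a, ha⟩ := ih
      obtain ⟨i, hi, hf⟩ := h2 a
      refine ⟨i, ?_⟩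
      have h3 := pastMax_succ h i
      rw [if_pos hf] at h3
      have := hmono (show i + 1 ≤ a by omega)
      simp only [hM] at *
      push_cast
      omega
  have ht : Tendsto M atTop atTop := tendsto_atTop_atTop_of_monotone hmono fun b => by
    obtain ⟨a, ha⟩ := hup (b - M 0).toNat
    exact ⟨a, by omega⟩
  have hb : Tendsto M atBot atBot := tendsto_atBot_atBot_of_monotone hmono fun b => by
    obtain ⟨a, ha⟩ := hdown (M 0 - b).toNat
    exact ⟨a, by omega⟩
  -- `M` is only weakly increasing; adding the bounded, strictly increasing `arctan` makes it strict
  -- and keeps `F - S` bounded.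
  let F : ℤ → ℝ := fun n => M n + Real.arctan n
  have hF : StrictMono F := fun m n hmn => by
    have e1 : (M m : ℝ) ≤ M n := by exact_mod_cast hmono hmn.le
    have e2 : Real.arctan m < Real.arctan n := Real.arctan_strictMono (by exact_mod_cast hmn)
    exact add_lt_add_of_le_of_lt e1 e2
  have hFt : Tendsto F atTop atTop :=
    tendsto_atTop_add_right_of_le _ (-(Real.pi / 2)) (tendsto_intCast_atTop_iff.2 ht)
      fun n => (Real.neg_pi_div_two_lt_arctan n).le
  have hFb : Tendsto F atBot atBot :=
    tendsto_atBot_add_right_of_ge _ (Real.pi / 2) (tendsto_intCast_atBot_iff.2 hb)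
      fun n => (Real.arctan_lt_pi_div_two n).le
  let d : ℤ → ℝ := fun n => load ω n + Real.arctan n
  have hd : ∀ n, ‖d n‖ ≤ K + Real.pi / 2 := by
    intro n
    have e1 : (load ω n : ℝ) ≤ K := by exact_mod_cast hK n
    have e2 : (0 : ℝ) ≤ load ω n := by positivity
    have e3 := Real.neg_pi_div_two_lt_arctan n
    have e4 := Real.arctan_lt_pi_div_two n
    rw [Real.norm_eq_abs, abs_le]
    have e5 : (0 : ℝ) ≤ K := by positivity
    constructor <;> simp only [d] <;> linarith
  have hlim : ∀ f : Filter ℤ, Tendsto (fun n => (F n)⁻¹) f (𝓝 0) → (∀ᶠ n in f, F n ≠ 0) →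
      Tendsto (fun n => (path ω n : ℝ) / F n) f (𝓝 1) := by
    intro f h3 h4
    have h5 : Tendsto (fun n => d n * (F n)⁻¹) f (𝓝 0) :=
      isBoundedUnder_le_mul_tendsto_zero (isBoundedUnder_of ⟨_, hd⟩) h3
    have h6 := h5.const_sub 1
    rw [sub_zero] at h6
    refine h6.congr' (h4.mono fun n hn => ?_)
    have e : (path ω n : ℝ) = F n - d n := by
      have := pastMax_eq h n
      simp only [F, d, hM, this]
      push_cast
      ring
    change _ = (path ω n : ℝ) / F n
    rw [e]
    field_simp
  exact ⟨⟨path_mem ω, F, hF, hFb, hlim _ hFb.inv_tendsto_atBot (hFb.eventually_ne_atBot 0)⟩,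
    path_mem ω, F, hF, hFt, hlim _ hFt.inv_tendsto_atTop (hFt.eventually_ne_atTop 0)⟩

/-! ### Trajectories of the bounded carrier chain -/

theorem carrierMatrix_ne_zero' {p : ℝ} {x y : ℕ} (h : carrierMatrix p x y ≠ 0) :
    y = x + 1 ∨ y = x - 1 := by
  simp only [carrierMatrix, Matrix.of_apply] at h
  split_ifs at h <;> first | omega | exact absurd rfl h

theorem IsMarkovLaw.measureReal_edge {α : Type*} [MeasurableSpace α] {μ : Measure (ℤ → α)}
    {Q : Matrix α α ℝ} (h : IsMarkovLaw μ Q) (n : ℤ) (u v : α) :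
    μ.real {ω | ω n = u ∧ ω (n + 1) = v} = μ.real {ω | ω n = u} * Q u v := by
  have h1 := h.step n 0 (fun i => if i = 0 then u else v)
  rw [zero_add, word_one, word_zero] at h1
  simpa using h1

/-- Forget the bound on a trajectory. -/
def natPath {K : ℕ} (w : ℤ → Fin (K + 1)) (n : ℤ) : ℕ := w n

theorem isFlat_natPath {K : ℕ} {w : ℤ → Fin (K + 1)} {n : ℤ} :
    IsFlat (natPath w) n ↔ w n = 0 ∧ w (n + 1) = 0 := by
  simp [IsFlat, natPath]

theorem measurable_natPath {K : ℕ} : Measurable (natPath : (ℤ → Fin (K + 1)) → ℤ → ℕ) :=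
  measurable_pi_lambda _ fun n => (measurable_of_countable fun a : Fin (K + 1) => (a : ℕ)).comp
    (measurable_pi_apply n)

section

variable {p : ℝ} {K : ℕ} {l : ℝ} {h : Fin (K + 1) → ℝ} {ν : Measure (ℤ → Fin (K + 1))}
  [IsProbabilityMeasure ν]

theorem IsMarkovLaw.ae_step
    (hν : IsMarkovLaw ν (doobTransform (restrictedCarrierMatrix p K) l h)) :
    ∀ᵐ w ∂ν, ∀ n, natPath w (n + 1) = natPath w n + 1 ∨
      natPath w (n + 1) = natPath w n - 1 := by
  refine ae_all_iff.2 fun n => ?_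
  have hne : ∀ u v : Fin (K + 1), ¬ ((v : ℕ) = u + 1 ∨ (v : ℕ) = u - 1) →
      ∀ᵐ w ∂ν, ¬ (w n = u ∧ w (n + 1) = v) := by
    intro u v huv
    have h0 : doobTransform (restrictedCarrierMatrix p K) l h u v = 0 := by
      have : carrierMatrix p u v = 0 := by
        by_contra h1
        exact huv (carrierMatrix_ne_zero' h1)
      simp [doobTransform, restrictedCarrierMatrix, this]
    have h1 := hν.measureReal_edge n u v
    rw [h0, mul_zero] at h1
    exact measure_eq_zero_iff_ae_notMem.1 ((measureReal_eq_zero_iff (measure_ne_top _ _)).1 h1)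
  have hall : ∀ᵐ w ∂ν, ∀ u v : Fin (K + 1), ¬ ((v : ℕ) = u + 1 ∨ (v : ℕ) = u - 1) →
      ¬ (w n = u ∧ w (n + 1) = v) :=
    ae_all_iff.2 fun u => ae_all_iff.2 fun v => by
      by_cases huv : (v : ℕ) = u + 1 ∨ (v : ℕ) = u - 1
      · exact Eventually.of_forall fun w h => absurd huv h
      · exact (hne u v huv).mono fun w hw _ => hw
  filter_upwards [hall] with w hw
  by_contra hcon
  exact hw (w n) (w (n + 1)) hcon ⟨rfl, rfl⟩

/-- The bounded carrier chain has rested at `0` before time `0`. -/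
theorem PositiveEigenpair.ae_exists_flat (H : PositiveEigenpair p K l h)
    (hν : IsMarkovLaw ν (doobTransform (restrictedCarrierMatrix p K) l h)) :
    ∀ᵐ w ∂ν, ∃ i < (0 : ℤ), IsFlat (natPath w) i := by
  set Q := doobTransform (restrictedCarrierMatrix p K) l h with hQ
  have hQ0 : ∀ a b, 0 ≤ Q a b := H.doob_mem_rowStochastic.1
  -- Shifting time by one turns "no rest before `0`" into "no rest before `1`".
  let E : Set (ℤ → Fin (K + 1)) := {w | ∀ i < (0 : ℤ), ¬ IsFlat (natPath w) i}
  have hE : IsPast 0 E := by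
    constructor
    · have : E = ⋂ i : ℤ, ⋂ _ : i < 0, {w | w i = 0 ∧ w (i + 1) = 0}ᶜ := by
        ext w
        simp [E, isFlat_natPath]
      rw [this]
      exact MeasurableSet.iInter fun i => MeasurableSet.iInter fun _ =>
        ((measurableSet_coord i 0).inter (measurableSet_coord (i + 1) 0)).compl
    · intro w w' hw hwE i hi hf
      refine hwE i hi ?_
      unfold IsFlat natPath at hf ⊢
      rwa [hw i hi.le, hw (i + 1) (by omega)]
  have hEs : {w : ℤ → Fin (K + 1) | (fun n => w (n + 1)) ∈ E} =
      E \ {w | IsFlat (natPath w) 0} := by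
    ext w
    simp only [E, Set.mem_ofPred_eq, Set.mem_sdiff, IsFlat, natPath]
    constructor
    · intro hw
      refine ⟨fun i hi => ?_, ?_⟩
      · have := hw (i - 1) (by omega)
        simpa using this
      · have := hw (-1) (by omega)
        simpa using this
    · rintro ⟨h1, h2⟩ i hi
      rcases eq_or_lt_of_le (show i + 1 ≤ 0 by omega) with h3 | h3
      · rw [h3]; exact h2
      · exact h1 (i + 1) h3
  have hflat0 : MeasurableSet {w : ℤ → Fin (K + 1) | IsFlat (natPath w) 0} := by
    have : {w : ℤ → Fin (K + 1) | IsFlat (natPath w) 0} = {w | w 0 = 0} ∩ {w | w (0 + 1) = 0} := by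
      ext w
      simp [isFlat_natPath]
    rw [this]
    exact (measurableSet_coord _ _).inter (measurableSet_coord _ _)
  -- By stationarity `E` and its shift have equal probability, so a first rest at time `0` has
  -- probability zero.
  have hnull : ν.real (E ∩ {w | IsFlat (natPath w) 0}) = 0 := by
    have h1 := hν.shift.measureReal_preimage 1 hE.1
    rw [hEs] at h1
    have h2 := measureReal_inter_add_sdiff (μ := ν) (s := E) hflat0
    linarith
  -- From level `0` a rest follows with positive probability, which contradicts `hnull` unless the
  -- event is null. From level `m + 1` a step down reaches the null event for level `m`, shifted by
  -- one.
  have hx : ∀ m : ℕ, ∀ x : Fin (K + 1), (x : ℕ) = m → ν.real (E ∩ {w | w 0 = x}) = 0 := by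
    intro m
    induction m with
    | zero =>
      intro x hx
      have h1 := markov_past hQ0 hν.step hE x x
      have h2 : ν.real (E ∩ {w | w 0 = x} ∩ {w | w (0 + 1) = x}) = 0 := by
        refine le_antisymm ((measureReal_mono ?_).trans hnull.le) measureReal_nonneg
        rintro w ⟨⟨h3, h4⟩, h5⟩
        have h4 : w 0 = x := h4
        have h5 : w (0 + 1) = x := h5
        refine ⟨h3, ?_⟩
        change (w 0 : ℕ) = 0 ∧ (w (0 + 1) : ℕ) = 0
        rw [h4, h5]
        exact ⟨hx, hx⟩
      rw [h2] at h1
      have h3 := H.doob_down_pos x x (by omega)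
      exact (mul_eq_zero.1 h1.symm).resolve_right h3.ne'
    | succ m ih =>
      intro x hx
      let y : Fin (K + 1) := ⟨m, by omega⟩
      have h1 := markov_past hQ0 hν.step hE x y
      have h2 : ν.real (E ∩ {w | w 0 = x} ∩ {w | w (0 + 1) = y}) = 0 := by
        have h6 := hν.shift.measureReal_preimage 1 (hE.1.inter (measurableSet_coord 0 y))
        rw [ih y rfl] at h6
        refine le_antisymm ((measureReal_mono ?_).trans h6.le) measureReal_nonneg
        rintro w ⟨⟨h3, h4⟩, h5⟩
        have h4 : w 0 = x := h4
        have h5 : w (0 + 1) = y := h5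
        refine ⟨?_, h5⟩
        change w ∈ {w : ℤ → Fin (K + 1) | (fun n => w (n + 1)) ∈ E}
        rw [hEs]
        refine ⟨h3, fun hf => ?_⟩
        have : (w 0 : ℕ) = 0 := hf.1
        rw [h4] at this
        omega
      rw [h2] at h1
      have h3 := H.doob_down_pos x y (by simp only [y]; omega)
      exact (mul_eq_zero.1 h1.symm).resolve_right h3.ne'
  have hE0 : ν.real E = 0 := by
    rw [← sum_measureReal_inter_fiber (measurable_pi_apply 0) hE.1]
    exact Finset.sum_eq_zero fun x _ => hx x x rfl
  have := measure_eq_zero_iff_ae_notMem.1 ((measureReal_eq_zero_iff (measure_ne_top _ _)).1 hE0)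
  filter_upwards [this] with w hw
  by_contra hcon
  exact hw fun i hi hf => hcon ⟨i, hi, hf⟩

theorem IsMarkovLaw.map_rev_doob
    (hν : IsMarkovLaw ν (doobTransform (restrictedCarrierMatrix p K) l h)) (c : ℤ) :
    ν.map (rev c) = ν :=
  hν.map_rev (fun a => (a : ℕ)) Fin.val_injective (fun _ _ hne => PositiveEigenpair.doob_ne_zero hne) c

theorem PositiveEigenpair.ae_flat_before (H : PositiveEigenpair p K l h)
    (hν : IsMarkovLaw ν (doobTransform (restrictedCarrierMatrix p K) l h)) :
    ∀ᵐ w ∂ν, ∀ n, ∃ i < n, IsFlat (natPath w) i := by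
  refine ae_all_iff.2 fun n => ?_
  have h1 := H.ae_exists_flat hν
  rw [← hν.shift n] at h1
  filter_upwards [ae_of_ae_map (measurable_shift n).aemeasurable h1] with w hw
  obtain ⟨i, hi, hf⟩ := hw
  refine ⟨i + n, by omega, ?_⟩
  unfold IsFlat natPath at hf ⊢
  rwa [show i + n + 1 = i + 1 + n by ring]

theorem PositiveEigenpair.ae_flat_after (H : PositiveEigenpair p K l h)
    (hν : IsMarkovLaw ν (doobTransform (restrictedCarrierMatrix p K) l h)) :
    ∀ᵐ w ∂ν, ∀ n, ∃ i ≥ n, IsFlat (natPath w) i := by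
  have h1 := H.ae_flat_before hν
  rw [← hν.map_rev_doob 0] at h1
  filter_upwards [ae_of_ae_map (measurable_rev 0).aemeasurable h1] with w hw n
  obtain ⟨i, hi, hf⟩ := hw (-n)
  -- Under `n ↦ -n` the edge from `i` to `i + 1` becomes the edge from `-i - 1` to `-i`.
  refine ⟨-i - 1, by omega, ?_⟩
  unfold IsFlat natPath at hf ⊢
  unfold rev at hf
  rw [show (0 : ℤ) - i = -i - 1 + 1 by ring, show (0 : ℤ) - (i + 1) = -i - 1 by ring] at hf
  exact ⟨hf.2, hf.1⟩

/-- Almost surely the bounded carrier chain is the carrier of the configuration of its up-steps,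
which is sub-critical. -/
theorem PositiveEigenpair.ae_decode (H : PositiveEigenpair p K l h)
    (hν : IsMarkovLaw ν (doobTransform (restrictedCarrierMatrix p K) l h)) :
    ∀ᵐ w ∂ν, (IsGood (decode Fin.val w) ∧ path (decode Fin.val w) ∈ subcritical) ∧
      load (decode Fin.val w) = natPath w := by
  filter_upwards [hν.ae_step, H.ae_flat_before hν, H.ae_flat_after hν] with w h1 h2 h3
  obtain ⟨hg, hl⟩ := isGood_and_load_eq (ω := decode Fin.val w) (w := natPath w) (fun n => by
    have h4 := h1 (n - 1)
    rw [sub_add_cancel] at h4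
    unfold carry decode
    by_cases h5 : (w n : ℕ) = w (n - 1) + 1
    · rw [if_pos (by rw [if_pos h5])]
      exact h5
    · rw [if_neg (by rw [if_neg h5]; decide)]
      exact h4.resolve_left h5) (fun n => by
    obtain ⟨i, hi, hf⟩ := h2 n
    exact ⟨i, hi.le, hf.1⟩)
  refine ⟨⟨hg, ?_⟩, hl⟩
  refine mem_subcritical_of_flat hg (K := K) (fun n => ?_) ?_ ?_
  · rw [hl]
    exact Nat.lt_succ_iff.1 (w n).2
  · rwa [hl]
  · rwa [hl]

end

/-! ### Reversibility of the conditioned configurations -/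

/-- The window `-N < n ≤ N` is symmetric under `n ↦ 1 - n`. -/
theorem truncate_rev (N : ℕ) (ω : Config) : truncate N (rev 1 ω) = rev 1 (truncate N ω) := by
  ext n
  simp only [truncate, rev]
  by_cases h : -(N : ℤ) < n ∧ n ≤ N
  · rw [if_pos h, if_pos (by omega)]
  · rw [if_neg h, if_neg (by omega)]

/-- The bound on the carrier becomes a bound on all descents of the path, which is symmetric under
the reflection in `path_rev`. -/
theorem forall_load_le_iff {ω : Config} (h : IsGood ω) (K : ℕ) :
    (∀ n, load ω n ≤ K) ↔ ∀ m n, m ≤ n → path ω m - path ω n ≤ K := by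
  constructor
  · intro hK m n hmn
    have h1 := excess_le_load h n (n - m).toNat
    rw [excess_eq, show n - ((n - m).toNat : ℤ) = m by omega] at h1
    have := hK n
    omega
  · intro hK n
    obtain ⟨j, hj⟩ := exists_excess_eq_load h n
    rw [excess_eq] at hj
    have := hK (n - j) n (by omega)
    omega

theorem forall_truncLoad_le_iff {N K : ℕ} {ω : Config} :
    (∀ n, truncLoad N ω n ≤ K) ↔ ω ∈ boundedUpTo N K N := by
  refine ⟨fun h i _ => h i, fun h n => ?_⟩
  rcases le_total n N with hn | hn
  · exact h n hn
  · exact (truncLoad_le_of_ge ω hn).trans (h N le_rfl)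

theorem rev_mem_boundedUpTo {N K : ℕ} {ω : Config} :
    rev 1 ω ∈ boundedUpTo N K N ↔ ω ∈ boundedUpTo N K N := by
  rw [← forall_truncLoad_le_iff, ← forall_truncLoad_le_iff]
  simp only [truncLoad]
  rw [forall_load_le_iff (isGood_truncate N _), forall_load_le_iff (isGood_truncate N _),
    truncate_rev]
  constructor
  · intro h m n hmn
    have := h (-n) (-m) (by omega)
    rw [path_rev, path_rev, neg_neg, neg_neg] at this
    omega
  · intro h m n hmn
    have := h (-n) (-m) (by omega)
    rw [path_rev, path_rev]
    omega

theorem cond_map_eq {Ω Ω' : Type*} [MeasurableSpace Ω] [MeasurableSpace Ω'] {P : Measure Ω}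
    {f : Ω → Ω'} (hf : Measurable f) {E : Set Ω'} (hE : MeasurableSet E) :
    (ProbabilityTheory.cond P (f ⁻¹' E)).map f = ProbabilityTheory.cond (P.map f) E := by
  rw [ProbabilityTheory.cond, ProbabilityTheory.cond, Measure.map_smul, ← Measure.restrict_map hf hE, Measure.map_apply hf hE]

theorem cond_boundedUpTo_map_rev {μ : Measure Config} (hμ : μ.map (rev 1) = μ) (N K : ℕ) :
    (ProbabilityTheory.cond μ (boundedUpTo N K N)).map (rev 1) = ProbabilityTheory.cond μ (boundedUpTo N K N) := by
  have e : (rev 1 ⁻¹' boundedUpTo N K N : Set Config) = boundedUpTo N K N := by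
    ext ω
    exact rev_mem_boundedUpTo
  have h := cond_map_eq (P := μ) (measurable_rev 1) (isPast_boundedUpTo N K N).1
  rwa [e, hμ] at h

theorem carrier_truncate (N : ℕ) (ω : Config) (n : ℤ) :
    carrier (truncate N ω) n = truncLoad N ω n :=
  carrier_eq_load (isGood_truncate N ω) n

theorem carrierBounded_eq {Ω : Type*} (η : Ω → Config) (K N : ℕ) :
    carrierBounded η K N = η ⁻¹' boundedUpTo N K N := by
  ext ω
  simp only [carrierBounded, Set.mem_ofPred_eq, Set.mem_preimage, carrier_truncate, Nat.cast_le,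
    forall_truncLoad_le_iff]

/-- On the event that the truncated carrier is bounded by `K`, clipping does nothing. -/
theorem natPath_clipped {N K : ℕ} {ω : Config} (h : ω ∈ boundedUpTo N K N) :
    natPath (clipped N K ω) = truncLoad N ω := by
  ext n
  exact ((clip_eq_iff (forall_truncLoad_le_iff.2 h n) _).1 rfl).symm

theorem decode_clipped {N K : ℕ} {ω : Config} (h : ω ∈ boundedUpTo N K N) :
    decode Fin.val (clipped N K ω) = truncate N ω := by
  rw [← decode_load (isGood_truncate N ω)]
  change decode id (natPath (clipped N K ω)) = _
  rw [natPath_clipped h]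
  rfl

theorem ae_mem_cond {Ω : Type*} [MeasurableSpace Ω] {P : Measure Ω} {E : Set Ω}
    (hE : MeasurableSet E) : ∀ᵐ ω ∂(ProbabilityTheory.cond P E), ω ∈ E :=
  Measure.ae_smul_measure (ae_restrict_mem hE) _

/-! ### The limiting configuration -/

/-- The carrier stays below `K` and rests at `0` infinitely often in both directions. -/
def HasBoundedCarrier (K : ℕ) (ξ : Config) : Prop :=
  ∀ n : ℤ, (load ξ n = carry (load ξ (n - 1)) (ξ n) ∧ load ξ n ≤ K) ∧
    (∃ i < n, IsFlat (load ξ) i) ∧ ∃ i ≥ n, IsFlat (load ξ) i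

/-- `load` takes a default value where the dynamics is undefined. The recursion, together with zeros
at arbitrarily early times, rules this out. -/
theorem HasBoundedCarrier.isGood_and_subcritical {K : ℕ} {ξ : Config}
    (h : HasBoundedCarrier K ξ) : IsGood ξ ∧ path ξ ∈ subcritical := by
  have hg : IsGood ξ := (isGood_and_load_eq (fun n => (h n).1.1) fun n => by
    obtain ⟨i, hi, hf⟩ := (h n).2.1
    exact ⟨i, hi.le, hf.1⟩).1
  exact ⟨hg, mem_subcritical_of_flat hg (fun n => (h n).1.2) (fun n => (h n).2.2)
    fun n => (h n).2.1⟩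

/-- Measurability is what lets the almost sure property be transferred from trajectories to the
image law on configurations. -/
theorem measurableSet_hasBoundedCarrier (K : ℕ) : MeasurableSet {ξ | HasBoundedCarrier K ξ} := by
  have hl : ∀ n, Measurable fun ξ : Config => load ξ n := fun n =>
    (measurable_pi_apply n).comp measurable_load
  have hflat : ∀ n, MeasurableSet {ξ : Config | IsFlat (load ξ) n} := fun n =>
    (hl n (measurableSet_singleton 0)).inter (hl (n + 1) (measurableSet_singleton 0))
  have hcarry : ∀ n : ℤ, Measurable fun ξ : Config => carry (load ξ (n - 1)) (ξ n) := fun n => by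
    have h : Measurable fun ξ : Config => (load ξ (n - 1), ξ n) :=
      (hl (n - 1)).prodMk (measurable_pi_apply n)
    exact (measurable_of_countable fun q : ℕ × Fin 2 => carry q.1 q.2).comp h
  have e : {ξ | HasBoundedCarrier K ξ} =
      ⋂ n : ℤ, ({ξ | load ξ n = carry (load ξ (n - 1)) (ξ n)} ∩ {ξ | load ξ n ≤ K}) ∩
        ((⋃ i ∈ Set.Iio n, {ξ | IsFlat (load ξ) i}) ∩
          ⋃ i ∈ Set.Ici n, {ξ | IsFlat (load ξ) i}) := by
    ext ξ
    simp [HasBoundedCarrier]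
  rw [e]
  refine MeasurableSet.iInter fun n => ?_
  exact ((measurableSet_eq_fun (hl n) (hcarry n)).inter (hl n measurableSet_Iic)).inter
    ((MeasurableSet.biUnion (Set.to_countable _) fun i _ => hflat i).inter
      (MeasurableSet.biUnion (Set.to_countable _) fun i _ => hflat i))

section

variable {p : ℝ} {K : ℕ} {l : ℝ} {h : Fin (K + 1) → ℝ} {ν : Measure (ℤ → Fin (K + 1))}
  [IsProbabilityMeasure ν]

theorem measurable_decode_val {K : ℕ} :
    Measurable (decode Fin.val : (ℤ → Fin (K + 1)) → Config) := measurable_decode Fin.val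

theorem PositiveEigenpair.ae_hasBoundedCarrier (H : PositiveEigenpair p K l h)
    (hν : IsMarkovLaw ν (doobTransform (restrictedCarrierMatrix p K) l h)) :
    ∀ᵐ ξ ∂(ν.map (decode Fin.val)), HasBoundedCarrier K ξ := by
  rw [ae_map_iff measurable_decode_val.aemeasurable (measurableSet_hasBoundedCarrier K)]
  filter_upwards [H.ae_decode hν, H.ae_flat_before hν, H.ae_flat_after hν] with w h1 h2 h3 n
  refine ⟨⟨load_step h1.1.1 n, ?_⟩, ?_, ?_⟩
  · rw [h1.2]; exact Nat.lt_succ_iff.1 (w n).2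
  · rw [h1.2]; exact h2 n
  · rw [h1.2]; exact h3 n

theorem PositiveEigenpair.isSubcriticalInvariant (H : PositiveEigenpair p K l h)
    (hν : IsMarkovLaw ν (doobTransform (restrictedCarrierMatrix p K) l h))
    (hrev : (ν.map (decode Fin.val)).map (rev 1) = ν.map (decode Fin.val)) :
    IsSubcriticalInvariant (ν.map (decode Fin.val)) id := by
  have hg := (H.ae_hasBoundedCarrier hν).mono fun ξ hξ => hξ.isGood_and_subcritical
  have hload : (ν.map (decode Fin.val)).map load = ν.map natPath := by
    rw [Measure.map_map measurable_load measurable_decode_val]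
    exact Measure.map_congr ((H.ae_decode hν).mono fun w hw => hw.2)
  have hflip : (ν.map natPath).map (rev 0) = ν.map natPath := by
    conv_rhs => rw [← hν.map_rev_doob 0]
    rw [Measure.map_map (measurable_rev 0) measurable_natPath,
      Measure.map_map measurable_natPath (measurable_rev 0)]
    rfl
  exact ⟨hg.mono fun ξ h => h.2, hg.mono fun ξ h => mem_dynamicsDomain h.1,
    identDistrib_boxBall (hg.mono fun ξ h => h.1) (by rw [hload, hflip]) hrev⟩

/-- The trajectory read off from a configuration with a bounded carrier. -/
noncomputable def clippedLoad (K : ℕ) (ξ : Config) (n : ℤ) : Fin (K + 1) := clip K (load ξ n)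

theorem measurable_clippedLoad (K : ℕ) : Measurable (clippedLoad K) :=
  measurable_pi_lambda _ fun n => (measurable_of_countable (clip K)).comp
    ((measurable_pi_apply n).comp measurable_load)

/-- Almost surely the load of the decoded configuration is the original trajectory, so decoding
loses nothing and the limiting carrier has the Markov law. -/
theorem PositiveEigenpair.map_clippedLoad (H : PositiveEigenpair p K l h)
    (hν : IsMarkovLaw ν (doobTransform (restrictedCarrierMatrix p K) l h)) :
    (ν.map (decode Fin.val)).map (clippedLoad K) = ν := by
  rw [Measure.map_map (measurable_clippedLoad K) measurable_decode_val]
  conv_rhs => rw [← Measure.map_id (μ := ν)]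
  refine Measure.map_congr ?_
  filter_upwards [H.ae_decode hν] with w hw
  ext n
  simp only [Function.comp_apply, clippedLoad, hw.2, id]
  rw [(clip_eq_iff (K := K) (w := natPath w n) (Nat.lt_succ_iff.1 (w n).2) (w n)).2 rfl]

end

/-! ### Assembly of the conditioned case -/

/-- Trajectories as integer-valued paths. -/
def intPath {K : ℕ} (w : ℤ → Fin (K + 1)) (n : ℤ) : ℤ := ((w n : ℕ) : ℤ)

theorem continuous_intPath {K : ℕ} : Continuous (intPath : (ℤ → Fin (K + 1)) → ℤ → ℤ) :=
  continuous_pi fun n => (continuous_of_discreteTopology (f := fun a : Fin (K + 1) =>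
    ((a : ℕ) : ℤ))).comp (continuous_apply n)

theorem tendsto_probabilityMeasure_congr {E : Type*} [MeasurableSpace E] [TopologicalSpace E]
    [OpensMeasurableSpace E] {ρ σ : ℕ → ProbabilityMeasure E} {ν ν' : ProbabilityMeasure E}
    (h : Tendsto ρ atTop (𝓝 ν)) (h1 : ∀ N, (ρ N : Measure E) = σ N)
    (h2 : (ν : Measure E) = ν') : Tendsto σ atTop (𝓝 ν') := by
  rwa [← funext fun N => Subtype.ext (h1 N), ← (Subtype.ext h2 : ν = ν')]

/-- Independent Bernoulli configurations conditioned on a bounded carrier. -/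
theorem conditioned_iid {Ω : Type*} [MeasurableSpace Ω] {P : Measure Ω} [IsProbabilityMeasure P]
    {η : Ω → Config} {p : ℝ} (K : ℕ) (hp : 0 < p) (hp1 : p < 1) (hη : IsIIDBernoulli P η p) :
    ∃ _ : ∀ N : ℕ, IsProbabilityMeasure (ProbabilityTheory.cond P (carrierBounded η K N)),
      ∃ ν : ProbabilityMeasure Config,
        TendstoInDistribution (fun (N : ℕ) ω => truncate N (η ω)) atTop id
          (fun N => ProbabilityTheory.cond P (carrierBounded η K N)) (ν : Measure Config) ∧
        TendstoInDistribution (fun (N : ℕ) ω => carrier (truncate N (η ω))) atTop carrier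
          (fun N => ProbabilityTheory.cond P (carrierBounded η K N)) (ν : Measure Config) ∧
        (∃ (lam : ℝ) (h : Fin (K + 1) → ℝ) (W : Config → ℤ → Fin (K + 1)),
          0 < lam ∧ lam < 1 ∧ IsPerronPair (restrictedCarrierMatrix p K) lam h ∧
          IsStationaryMarkovChain (ν : Measure Config) W
            (doobTransform (restrictedCarrierMatrix p K) lam h) ∧
          ∀ᵐ ξ ∂(ν : Measure Config), ∀ n : ℤ, carrier ξ n = ((W ξ n : ℕ) : ℤ)) ∧
        IsSubcriticalInvariant (ν : Measure Config) id := by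
  have hηm := measurable_of_coord hη.1
  have hprob : IsProbabilityMeasure (P.map η) := Measure.isProbabilityMeasure_map hηm.aemeasurable
  have hμ := hη.isMarkovLaw
  obtain ⟨l, h, hl0, hl1, hh, heq⟩ := exists_positive_eigenvector hp hp1 K
  have H : PositiveEigenpair p K l h := ⟨hp, hp1, hl0, hh, heq⟩
  have hpos : ∀ N, P.map η (boundedUpTo N K N) ≠ 0 := fun N h0 => by
    have := H.measureReal_boundedUpTo_pos hμ N
    rw [measureReal_def, h0] at this
    simp at this
  have hEm : ∀ N : ℕ, MeasurableSet (boundedUpTo N K N) := fun N => (isPast_boundedUpTo N K N).1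
  have hcond : ∀ N : ℕ, IsProbabilityMeasure (ProbabilityTheory.cond P (carrierBounded η K N)) :=
    fun N => cond_isProbabilityMeasure (by
      rw [carrierBounded_eq, ← Measure.map_apply hηm (hEm N)]
      exact hpos N)
  have hmap : ∀ N : ℕ, (ProbabilityTheory.cond P (carrierBounded η K N)).map η =
      ProbabilityTheory.cond (P.map η) (boundedUpTo N K N) := fun N => by
    rw [carrierBounded_eq, cond_map_eq hηm (hEm N)]
  have hcondμ : ∀ N : ℕ, IsProbabilityMeasure
      (ProbabilityTheory.cond (P.map η) (boundedUpTo N K N)) :=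
    fun N => cond_isProbabilityMeasure (hpos N)
  -- Clipping gives a compact trajectory space and changes nothing on the conditioning event.
  -- Configuration and carrier are then continuous images of the trajectory, so one weak limit
  -- serves both.
  let ρ : ℕ → ProbabilityMeasure (ℤ → Fin (K + 1)) := fun N =>
    ⟨(ProbabilityTheory.cond (P.map η) (boundedUpTo N K N)).map (clipped N K),
      Measure.isProbabilityMeasure_map (measurable_clipped N K).aemeasurable⟩
  obtain ⟨ν, hν, hνw⟩ := exists_tendsto_of_tendsto_word (ρ := ρ)
    (L := fun _ k x => H.equilibrium (x 0) * ∏ i ∈ Finset.range k,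
      doobTransform (restrictedCarrierMatrix p K) l h (x i) (x (i + 1))) fun n k x => by
    refine (H.tendsto_cond_word hμ n k x).congr fun N => ?_
    exact (map_measureReal_apply (measurable_clipped N K) (measurableSet_word n k x)).symm
  have hνM := isMarkovLaw_of_word hνw
  let ν' : ProbabilityMeasure Config := ν.map measurable_decode_val.aemeasurable
  have hν'c : (ν' : Measure Config) = (ν : Measure (ℤ → Fin (K + 1))).map (decode Fin.val) := rfl
  have hdec : ∀ N : ℕ, (ρ N : Measure (ℤ → Fin (K + 1))).map (decode Fin.val) =
      (ProbabilityTheory.cond (P.map η) (boundedUpTo N K N)).map (truncate N) := fun N => by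
    change ((ProbabilityTheory.cond (P.map η) (boundedUpTo N K N)).map (clipped N K)).map _ = _
    rw [Measure.map_map measurable_decode_val (measurable_clipped N K)]
    exact Measure.map_congr ((ae_mem_cond (hEm N)).mono fun ω hω => decode_clipped hω)
  have hint : ∀ N : ℕ, (ρ N : Measure (ℤ → Fin (K + 1))).map intPath =
      (ProbabilityTheory.cond (P.map η) (boundedUpTo N K N)).map
        fun ω => carrier (truncate N ω) := fun N => by
    change ((ProbabilityTheory.cond (P.map η) (boundedUpTo N K N)).map (clipped N K)).map _ = _
    rw [Measure.map_map continuous_intPath.measurable (measurable_clipped N K)]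
    refine Measure.map_congr ((ae_mem_cond (hEm N)).mono fun ω hω => ?_)
    ext n
    have := congrFun (natPath_clipped hω) n
    change ((clipped N K ω n : ℕ) : ℤ) = carrier (truncate N ω) n
    rw [carrier_truncate, ← this]
    rfl
  have hlim := ProbabilityMeasure.tendsto_map_of_tendsto_of_continuous ρ ν hν
    (continuous_decode (Fin.val : Fin (K + 1) → ℕ))
  have hlim2 := ProbabilityMeasure.tendsto_map_of_tendsto_of_continuous ρ ν hν continuous_intPath
  -- reversibility of the limiting configuration
  have hrev : (ν' : Measure Config).map (rev 1) = ν' := by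
    have h1 := ProbabilityMeasure.tendsto_map_of_tendsto_of_continuous _ _ hlim
      (continuous_rev (α := Fin 2) 1)
    -- Reversibility holds exactly for every `N`, since the law of the sites, the window and the
    -- conditioning event are all reversal-invariant.
    have h2 : ∀ N, ((ρ N).map (continuous_decode (Fin.val : Fin (K + 1) → ℕ)).aemeasurable).map
        (continuous_rev (α := Fin 2) 1).aemeasurable =
        (ρ N).map (continuous_decode (Fin.val : Fin (K + 1) → ℕ)).aemeasurable := fun N => by
      refine Subtype.ext ?_
      change ((ρ N : Measure (ℤ → Fin (K + 1))).map (decode Fin.val)).map (rev 1) =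
        (ρ N : Measure (ℤ → Fin (K + 1))).map (decode Fin.val)
      rw [hdec, Measure.map_map (measurable_rev 1) (measurable_truncate N)]
      conv_rhs => rw [← cond_boundedUpTo_map_rev (hμ.map_rev_site 1),
        Measure.map_map (measurable_truncate N) (measurable_rev 1)]
      congr 1
      ext1 ω
      exact (truncate_rev N ω).symm
    simp only [h2] at h1
    have h3 := tendsto_nhds_unique h1 hlim
    exact congrArg (fun m : ProbabilityMeasure Config => (m : Measure Config)) h3
  have hbc := H.ae_hasBoundedCarrier hνM
  have hcar : ∀ᵐ w ∂(ν : Measure (ℤ → Fin (K + 1))), carrier (decode Fin.val w) = intPath w := by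
    filter_upwards [H.ae_decode hνM] with w hw
    ext n
    rw [carrier_eq_load hw.1.1, hw.2]
    rfl
  -- Measurability of `carrier` is needed only up to null sets, and it comes from `load`, which
  -- agrees with it where the dynamics is defined.
  have hcarm : (fun ξ n => (load ξ n : ℤ)) =ᵐ[(ν' : Measure Config)] carrier :=
    hbc.mono fun ξ hξ => funext fun n => (carrier_eq_load hξ.isGood_and_subcritical.1 n).symm
  have hlm : Measurable fun (ξ : Config) (n : ℤ) => (load ξ n : ℤ) :=
    measurable_pi_lambda _ fun n => (measurable_of_countable fun k : ℕ => (k : ℤ)).comp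
      ((measurable_pi_apply n).comp measurable_load)
  have hcarrier : AEMeasurable carrier (ν' : Measure Config) := hlm.aemeasurable.congr hcarm
  have htm : ∀ N, Measurable fun ω => carrier (truncate N ω) := fun N => by
    have : (fun ω => carrier (truncate N ω)) = fun ω n => (load (truncate N ω) n : ℤ) := by
      ext ω n
      exact carrier_truncate N ω n
    rw [this]
    exact hlm.comp (measurable_truncate N)
  refine ⟨hcond, ν', ⟨fun N => ((measurable_truncate N).comp hηm).aemeasurable, aemeasurable_id,
    ?_⟩, ⟨fun N => ((htm N).comp hηm).aemeasurable, hcarrier, ?_⟩,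
    ⟨l, h, clippedLoad K, hl0, hl1, H.isPerronPair, ?_, ?_⟩, ?_⟩
  · refine tendsto_probabilityMeasure_congr hlim (fun N => ?_) Measure.map_id.symm
    change (ρ N : Measure (ℤ → Fin (K + 1))).map (decode Fin.val) = _
    rw [hdec, ← hmap, Measure.map_map (measurable_truncate N) hηm]
    rfl
  · refine tendsto_probabilityMeasure_congr hlim2 (fun N => ?_) ?_
    · change (ρ N : Measure (ℤ → Fin (K + 1))).map intPath = _
      rw [hint, ← hmap, Measure.map_map (htm N) hηm]
      rfl
    · change (ν : Measure (ℤ → Fin (K + 1))).map intPath =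
        ((ν : Measure (ℤ → Fin (K + 1))).map (decode Fin.val)).map carrier
      rw [AEMeasurable.map_map_of_aemeasurable hcarrier measurable_decode_val.aemeasurable]
      exact (Measure.map_congr hcar).symm
  · exact IsMarkovLaw.isStationaryMarkovChain (measurable_clippedLoad K) (by
      rw [hν'c, H.map_clippedLoad hνM]; exact hνM)
  · refine hbc.mono fun ξ hξ n => ?_
    rw [carrier_eq_load hξ.isGood_and_subcritical.1]
    have := (clip_eq_iff (hξ n).1.2 (clippedLoad K ξ n)).1 rfl
    rw [← this]
  · exact H.isSubcriticalInvariant hνM hrev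

end BoxBall

theorem theorem1p6 {Ω : Type*} [MeasurableSpace Ω] (P : Measure Ω) [IsProbabilityMeasure P]
    (η : Ω → BoxBall.Config) :
    -- (a) independent Bernoulli configurations
    (∀ p : ℝ, 0 ≤ p → p < 1 / 2 → BoxBall.IsIIDBernoulli P η p →
      BoxBall.IsSubcriticalInvariant P η) ∧
    -- (b) stationary Markov configurations
    (∀ p₀ p₁ : ℝ, 0 < p₀ → p₀ < 1 → 0 ≤ p₁ → p₁ < 1 → p₀ + p₁ < 1 →
      BoxBall.IsStationaryMarkovChain P η !![1 - p₀, p₀; 1 - p₁, p₁] →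
      BoxBall.IsSubcriticalInvariant P η) ∧
    -- (c) independent Bernoulli configurations conditioned on a bounded carrier
    (∀ (p : ℝ) (K : ℕ), 0 < p → p < 1 → BoxBall.IsIIDBernoulli P η p →
      ∃ _ : ∀ N : ℕ, IsProbabilityMeasure (cond P (BoxBall.carrierBounded η K N)),
      ∃ ν : ProbabilityMeasure BoxBall.Config,
        -- the conditioned truncated configurations converge in distribution to `ν`
        TendstoInDistribution (fun (N : ℕ) ω => BoxBall.truncate N (η ω)) atTop id
          (fun N => cond P (BoxBall.carrierBounded η K N)) (ν : Measure BoxBall.Config) ∧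
        -- and so do their carriers
        TendstoInDistribution (fun (N : ℕ) ω => BoxBall.carrier (BoxBall.truncate N (η ω))) atTop
          BoxBall.carrier
          (fun N => cond P (BoxBall.carrierBounded η K N)) (ν : Measure BoxBall.Config) ∧
        -- the limiting carrier is a stationary Markov chain on `{0, …, K}`, whose transition
        -- matrix is the Doob transform of the restricted carrier matrix
        (∃ (lam : ℝ) (h : Fin (K + 1) → ℝ) (W : BoxBall.Config → ℤ → Fin (K + 1)),
          0 < lam ∧ lam < 1 ∧
          BoxBall.IsPerronPair (BoxBall.restrictedCarrierMatrix p K) lam h ∧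
          BoxBall.IsStationaryMarkovChain (ν : Measure BoxBall.Config) W
            (BoxBall.doobTransform (BoxBall.restrictedCarrierMatrix p K) lam h) ∧
          ∀ᵐ ξ ∂(ν : Measure BoxBall.Config), ∀ n : ℤ,
            BoxBall.carrier ξ n = ((W ξ n : ℕ) : ℤ)) ∧
        -- the limiting configuration is sub-critical and invariant
        BoxBall.IsSubcriticalInvariant (ν : Measure BoxBall.Config) id) := by
  refine ⟨fun p hp hp' h => BoxBall.isSubcriticalInvariant_iid h hp hp',
    fun p₀ p₁ h0 h0' h1 h1' h01 h => BoxBall.isSubcriticalInvariant_markov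
      (BoxBall.measurable_of_coord h.1) h.isMarkovLaw h0 h0' h1 h1' h01,
    fun p K hp hp' h => BoxBall.conditioned_iid K hp hp' h⟩
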